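/- **Setting.** Let $Q=(0,\infty)\times(0,\pi/2)$ with coordinates $(y,\theta)$ and the measure $dy\,d\theta$. For $\alpha>0$ put $\eta=\frac{99}{100}$, $\gamma=1+\frac{\alpha}{10}$, $w(y)=\frac{(1+y)^2}{y^2}$, $W(y,\theta)=w(y)\sin(2\theta)^{-\gamma/2}$, $D_y=y\partial_y$, $D_\theta=\sin(2\theta)\partial_\theta$. For an integer $k\ge 1$, $\mathcal H^k$ (which depends on $\alpha$ through $\gamma$) is the space of real measurable functions $f$ on $Q$ (modulo a.e. equality) whose weak derivatives $D_\theta^iD_y^jf$, $i+j\le k$, exist and for which $$|f|_{\mathcal H^k}^2=\sum_{j=0}^k\Big\|D_y^jf\,\frac{w}{\sin(2\theta)^{\eta/2}}\Big\|_{L^2(Q)}^2+\sum_{i\ge1,\ i+j\le k}\big\|D_\theta^iD_y^jf\,W\big\|_{L^2(Q)}^2<\infty .$$ Let $\Gamma(\theta)=(\sin\theta\cos^2\theta)^{\alpha/3}$, $K(\theta)=3\sin\theta\cos^2\theta$, $c=\int_0^{\pi/2}\Gamma K\,d\theta$, and $$L_{12}(f)(z)=\int_z^\infty 3\int_0^{\pi/2}\frac{f(r,\theta)\sin\theta\cos^2\theta}{r}\,d\theta\,dr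 .$$ Define $$\mathcal L_{F_*}f=f+y\partial_yf-\frac{2f}{1+y}-\frac{2y\,\Gamma(\theta)}{c(1+y)^2}L_{12}(f)(y),$$ and, for either choice of the sign, $$\mathcal L^{T,\pm}_{F_*}f=\mathcal L_{F_*}f\pm\Big(\frac{3}{1+y}\sin(2\theta)\partial_\theta f-\frac{\Gamma(\theta)}{c}\,\frac{2y^2}{(1+y)^3}\,L_{12}\Big(\frac{3}{1+y}\sin(2\theta)\partial_\theta f\Big)(0)\Big).$$ **Proposition 3.1.** There is $\alpha_0>0$ such that for every integer $k\ge1$ there are constants $m,M>0$, depending only on $k$, with the following property. For every $0<\alpha<\alpha_0$ there is an inner product $(\cdot,\cdot)$ on $\mathcal H^k$ such that $$m\,|f|_{\mathcal H^k}\le (f,f)^{1/2}\le M\,|f|_{\mathcal H^k}\qquad\text{for all } f\in\mathcal H^k,$$ and such that for every $f\in\mathcal H^k$ with $L_{12}(f)(0)=0$: 1. for each of the two signs, $(\mathcal L^{T,\pm}_{F_*}f,f)\ge|f|_{\mathcal H^k}^2$ whenever $\mathcal L^{T,\pm}_{F_*}f\in\mathcal H^k$; 2. $(\mathcal L_{F_*}f,f)\ge|f|_{\mathcal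 H^k}^2$ whenever $\mathcal L_{F_*}f\in\mathcal H^k$. Here $|\cdot|_{\mathcal H^k}$ is the norm displayed above, not the norm of the inner product. -/

import Mathlib

open MeasureTheory Set
open scoped ContDiff

noncomputable section

namespace EulerLin

/-- The open half-strip of points `(y, θ)` with `0 < y` and `0 < θ < π/2`. -/
def Q : Set (ℝ × ℝ) := Ioi 0 ×ˢ Ioo 0 (Real.pi / 2)

/-- The measure `dy dθ` on the half-strip. -/
abbrev μQ : Measure (ℝ × ℝ) := volume.restrict Q

/-- Real measurable functions on the half-strip, up to equality almost everywhere. -/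
abbrev X : Type := (ℝ × ℝ) →ₘ[μQ] ℝ

/-- `g` is the weak derivative of `f` on the half-strip in the constant direction `e`. -/
def IsWeakDeriv (e : ℝ × ℝ) (f g : X) : Prop :=
  LocallyIntegrableOn f Q ∧ LocallyIntegrableOn g Q ∧
    ∀ φ : ℝ × ℝ → ℝ, ContDiff ℝ ∞ φ → HasCompactSupport φ → tsupport φ ⊆ Q →
      ∫ p in Q, f p * fderiv ℝ φ p e = -∫ p in Q, g p * φ p

def HasWeakDeriv (e : ℝ × ℝ) (f : X) : Prop := ∃ g : X, IsWeakDeriv e f g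

open Classical in
/-- The weak derivative in the direction `e` (and `0` where there is none). -/
def wDeriv (e : ℝ × ℝ) (f : X) : X := if h : HasWeakDeriv e f then h.choose else 0

/-- The direction of `∂_y`. -/
def ey : ℝ × ℝ := (1, 0)

/-- The direction of `∂_θ`. -/
def eθ : ℝ × ℝ := (0, 1)

def yX : X := AEEqFun.mk (fun p => p.1) (by fun_prop)

def sinX : X := AEEqFun.mk (fun p => Real.sin (2 * p.2))
  (by exact Continuous.aestronglyMeasurable (by fun_prop))

/-- `D_y f = y ∂_y f` -/
def Dy (f : X) : X := yX * wDeriv ey f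

/-- `D_θ f = sin (2θ) ∂_θ f` -/
def Dθ (f : X) : X := sinX * wDeriv eθ f

/-- `D_θ^i D_y^j f` -/
def D (i j : ℕ) (f : X) : X := Dθ^[i] (Dy^[j] f)

def η : ℝ := 99 / 100

def γ (α : ℝ) : ℝ := 1 + α / 10

/-- The radial weight `w`. -/
def w (y : ℝ) : ℝ := (1 + y) ^ 2 / y ^ 2

/-- The weight for the purely radial derivatives. -/
def W0 (p : ℝ × ℝ) : ℝ := w p.1 / Real.sin (2 * p.2) ^ (η / 2)

/-- The weight `W = w · w_θ` for the derivatives that contain `D_θ`. -/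
def W (α : ℝ) (p : ℝ × ℝ) : ℝ := w p.1 * (1 / Real.sin (2 * p.2) ^ (γ α / 2))

/-- `f` has all the weak derivatives `D_θ^i D_y^j f`, `i + j ≤ k`. -/
def HasDerivs (k : ℕ) (f : X) : Prop :=
  (∀ j, j < k → HasWeakDeriv ey (D 0 j f)) ∧
    ∀ i j, i + j < k → HasWeakDeriv eθ (D i j f)

/-- Membership in `𝓗^k`: all terms of the norm are defined and finite. -/
def MemHk (α : ℝ) (k : ℕ) (f : X) : Prop :=
  HasDerivs k f ∧
    (∀ j, j ≤ k → MemLp (fun p => D 0 j f p * W0 p) 2 μQ) ∧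
    ∀ i j, 1 ≤ i → i + j ≤ k → MemLp (fun p => D i j f p * W α p) 2 μQ

/-- The norm of `𝓗^k`. -/
def hkNorm (α : ℝ) (k : ℕ) (f : X) : ℝ :=
  Real.sqrt ((∑ j ∈ Finset.range (k + 1), (∫ p in Q, (D 0 j f p * W0 p) ^ 2))
    + (∑ i ∈ Finset.Icc 1 k, ∑ j ∈ Finset.range (k + 1 - i),
        (∫ p in Q, (D i j f p * W α p) ^ 2)))

/-! Linearity of the weak derivatives, needed to see that `𝓗^k` is a vector space. -/

theorem isOpen_Q : IsOpen Q := isOpen_Ioi.prod isOpen_Ioo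

theorem locInt_congr {u v : ℝ × ℝ → ℝ} (h : u =ᵐ[μQ] v) (hu : LocallyIntegrableOn u Q) :
    LocallyIntegrableOn v Q := by
  intro p hp
  obtain ⟨s, hs, hi⟩ := hu p hp
  refine ⟨s ∩ Q, Filter.inter_mem hs self_mem_nhdsWithin, ?_⟩
  exact (hi.mono_set inter_subset_left).congr_fun_ae
    (ae_restrict_of_ae_restrict_of_subset inter_subset_right h)

theorem integrable_test {u ψ : ℝ × ℝ → ℝ} (hu : LocallyIntegrableOn u Q) (hψ : Continuous ψ)
    (hc : HasCompactSupport ψ) (hs : tsupport ψ ⊆ Q) :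
    Integrable (fun p => u p * ψ p) μQ := by
  have h1 : IntegrableOn (fun p => u p * ψ p) (tsupport ψ) :=
    (hu.integrableOn_compact_subset hs hc).mul_continuousOn hψ.continuousOn hc
  have h2 : Integrable (fun p => u p * ψ p) volume := by
    rw [← integrableOn_iff_integrable_of_support_subset (s := tsupport ψ)]
    · exact h1
    · intro p hp
      by_contra hn
      exact hp (by simp [image_eq_zero_of_notMem_tsupport hn])
  exact h2.integrableOn

theorem IsWeakDeriv.unique {e : ℝ × ℝ} {f g g' : X} (h : IsWeakDeriv e f g)
    (h' : IsWeakDeriv e f g') : g = g' := by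
  apply AEEqFun.ext
  have key : ∀ᵐ p ∂(volume : Measure (ℝ × ℝ)), p ∈ Q → (fun p => g p - g' p) p = 0 := by
    apply isOpen_Q.ae_eq_zero_of_integral_contDiff_smul_eq_zero (h.2.1.sub h'.2.1)
    intro φ hφ hc hs
    have e1 := h.2.2 φ hφ hc hs
    have e2 := h'.2.2 φ hφ hc hs
    have hi : ∀ u : X, LocallyIntegrableOn u Q → Integrable (fun p => u p * φ p) μQ :=
      fun u hu => integrable_test hu hφ.continuous hc hs
    have e3 : ∫ p in Q, (g p * φ p - g' p * φ p) = 0 := by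
      rw [integral_sub (hi g h.2.1) (hi g' h'.2.1)]
      linarith
    rw [← e3, setIntegral_eq_integral_of_forall_compl_eq_zero]
    · exact integral_congr_ae (Filter.Eventually.of_forall fun p => by
        simp only [smul_eq_mul, Pi.sub_apply]; ring)
    · intro p hp
      have : φ p = 0 := image_eq_zero_of_notMem_tsupport (fun hn => hp (hs hn))
      simp [this]
  rw [Filter.EventuallyEq, ae_restrict_iff' isOpen_Q.measurableSet]
  filter_upwards [key] with p hp hQ
  exact sub_eq_zero.1 (hp hQ)

theorem IsWeakDeriv.eq {e : ℝ × ℝ} {f g : X} (h : IsWeakDeriv e f g) : wDeriv e f = g := by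
  have hh : HasWeakDeriv e f := ⟨g, h⟩
  rw [wDeriv, dif_pos hh]
  exact hh.choose_spec.unique h

theorem HasWeakDeriv.spec {e : ℝ × ℝ} {f : X} (h : HasWeakDeriv e f) :
    IsWeakDeriv e f (wDeriv e f) := by
  rw [wDeriv, dif_pos h]
  exact h.choose_spec

/-- Linear combinations, stated at once for sums and multiples. -/
theorem IsWeakDeriv.comb {e : ℝ × ℝ} {f g f' g' : X} (a b : ℝ) (h : IsWeakDeriv e f f')
    (h' : IsWeakDeriv e g g') : IsWeakDeriv e (a • f + b • g) (a • f' + b • g') := by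
  have hco : ∀ u v : X, (fun p => a * u p + b * v p) =ᵐ[μQ] (a • u + b • v : X) := by
    intro u v
    filter_upwards [AEEqFun.coeFn_add (a • u) (b • v), AEEqFun.coeFn_smul a u,
      AEEqFun.coeFn_smul b v] with p h1 h2 h3
    rw [h1, Pi.add_apply, h2, h3]
    simp
  have hli : ∀ u v : X, LocallyIntegrableOn u Q → LocallyIntegrableOn v Q →
      LocallyIntegrableOn (a • u + b • v : X) Q := fun u v hu hv =>
    locInt_congr (hco u v) ((hu.smul a).add (hv.smul b))
  have hint : ∀ (u v : X) (ψ : ℝ × ℝ → ℝ), LocallyIntegrableOn u Q → LocallyIntegrableOn v Q →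
      Continuous ψ → HasCompactSupport ψ → tsupport ψ ⊆ Q →
      ∫ p in Q, (a • u + b • v : X) p * ψ p
        = a * (∫ p in Q, u p * ψ p) + b * (∫ p in Q, v p * ψ p) := by
    intro u v ψ hu hv hψ hc hs
    rw [← integral_const_mul, ← integral_const_mul,
      ← integral_add ((integrable_test hu hψ hc hs).const_mul a)
        ((integrable_test hv hψ hc hs).const_mul b)]
    apply integral_congr_ae
    filter_upwards [hco u v] with p hp
    rw [← hp]
    ring
  refine ⟨hli _ _ h.1 h'.1, hli _ _ h.2.1 h'.2.1, fun φ hφ hc hs => ?_⟩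
  have hd : Continuous fun p => fderiv ℝ φ p e :=
    (hφ.continuous_fderiv (by simp)).clm_apply continuous_const
  have hdc : HasCompactSupport fun p => fderiv ℝ φ p e := hc.fderiv_apply ℝ e
  have hds : tsupport (fun p => fderiv ℝ φ p e) ⊆ Q :=
    (tsupport_fderiv_apply_subset ℝ e).trans hs
  rw [hint f g _ h.1 h'.1 hd hdc hds, hint f' g' _ h.2.1 h'.2.1 hφ.continuous hc hs,
    h.2.2 φ hφ hc hs, h'.2.2 φ hφ hc hs]
  ring

theorem wDeriv_comb {e : ℝ × ℝ} {f g : X} (a b : ℝ) (h : HasWeakDeriv e f)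
    (h' : HasWeakDeriv e g) :
    wDeriv e (a • f + b • g) = a • wDeriv e f + b • wDeriv e g :=
  (h.spec.comb a b h'.spec).eq

theorem mulX_comb (m u v : X) (a b : ℝ) :
    m * (a • u + b • v) = a • (m * u) + b • (m * v) := by
  apply AEEqFun.ext
  filter_upwards [AEEqFun.coeFn_mul m (a • u + b • v), AEEqFun.coeFn_add (a • u) (b • v),
    AEEqFun.coeFn_smul a u, AEEqFun.coeFn_smul b v, AEEqFun.coeFn_add (a • (m * u)) (b • (m * v)),
    AEEqFun.coeFn_smul a (m * u), AEEqFun.coeFn_smul b (m * v), AEEqFun.coeFn_mul m u,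
    AEEqFun.coeFn_mul m v] with p h1 h2 h3 h4 h5 h6 h7 h8 h9
  simp only [h1, h2, h3, h4, h5, h6, h7, h8, h9, Pi.mul_apply, Pi.add_apply, Pi.smul_apply,
    smul_eq_mul]
  ring

theorem mulX_zero (m : X) : m * 0 = 0 := by
  have h := mulX_comb m 0 0 0 0
  simpa only [zero_smul, add_zero] using h

theorem D_comb {k : ℕ} {f g : X} (a b : ℝ) (hf : HasDerivs k f) (hg : HasDerivs k g) :
    ∀ i j, i + j ≤ k → D i j (a • f + b • g) = a • D i j f + b • D i j g := by
  have h0 : ∀ j, j ≤ k → D 0 j (a • f + b • g) = a • D 0 j f + b • D 0 j g := by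
    intro j
    induction j with
    | zero => intro _; rfl
    | succ j ih =>
      intro hj
      have hs : ∀ u : X, D 0 (j + 1) u = Dy (D 0 j u) := fun u => by
        simp only [D, Function.iterate_succ_apply', Function.iterate_zero, id]
      rw [hs, hs, hs, ih (by omega), Dy, wDeriv_comb a b (hf.1 j (by omega)) (hg.1 j (by omega)),
        mulX_comb]
      rfl
  intro i
  induction i with
  | zero => intro j hj; exact h0 j (by omega)
  | succ i ih =>
    intro j hj
    have hs : ∀ u : X, D (i + 1) j u = Dθ (D i j u) := fun u => by
      simp only [D, Function.iterate_succ_apply']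
    rw [hs, hs, hs, ih j (by omega), Dθ, wDeriv_comb a b (hf.2 i j (by omega))
      (hg.2 i j (by omega)), mulX_comb]
    rfl

theorem memHk_comb {α : ℝ} {k : ℕ} {f g : X} (a b : ℝ) (hf : MemHk α k f) (hg : MemHk α k g) :
    MemHk α k (a • f + b • g) := by
  have hD := D_comb a b hf.1 hg.1
  have hL : ∀ (u v : X) (ρ : ℝ × ℝ → ℝ), MemLp (fun p => u p * ρ p) 2 μQ →
      MemLp (fun p => v p * ρ p) 2 μQ → MemLp (fun p => (a • u + b • v : X) p * ρ p) 2 μQ := by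
    intro u v ρ hu hv
    refine ((hu.const_mul a).add (hv.const_mul b)).ae_eq ?_
    filter_upwards [AEEqFun.coeFn_add (a • u) (b • v), AEEqFun.coeFn_smul a u,
      AEEqFun.coeFn_smul b v] with p h1 h2 h3
    simp only [h1, h2, h3, Pi.add_apply, Pi.smul_apply, smul_eq_mul]
    ring
  refine ⟨⟨fun j hj => ?_, fun i j hij => ?_⟩, fun j hj => ?_, fun i j hi hij => ?_⟩
  · rw [hD 0 j (by omega)]
    exact ⟨_, (hf.1.1 j hj).spec.comb a b (hg.1.1 j hj).spec⟩
  · rw [hD i j (by omega)]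
    exact ⟨_, (hf.1.2 i j hij).spec.comb a b (hg.1.2 i j hij).spec⟩
  · rw [hD 0 j (by omega)]
    exact hL _ _ _ (hf.2.1 j hj) (hg.2.1 j hj)
  · rw [hD i j hij]
    exact hL _ _ _ (hf.2.2 i j hi hij) (hg.2.2 i j hi hij)

theorem isWeakDeriv_zero (e : ℝ × ℝ) : IsWeakDeriv e 0 0 := by
  have h0 : (0 : ℝ × ℝ → ℝ) =ᵐ[μQ] (0 : X) := AEEqFun.coeFn_zero.symm
  have hl : LocallyIntegrableOn (0 : X) Q := locInt_congr h0 locallyIntegrableOn_zero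
  have hz : ∀ ψ : ℝ × ℝ → ℝ, ∫ p in Q, (0 : X) p * ψ p = 0 := by
    intro ψ
    rw [integral_congr_ae (g := fun _ => (0 : ℝ))]
    · simp
    · filter_upwards [h0] with p hp
      rw [← hp]
      simp
  refine ⟨hl, hl, fun φ _ _ _ => ?_⟩
  rw [hz, hz, neg_zero]

theorem D_zero (i j : ℕ) : D i j 0 = 0 := by
  have hy : Dy 0 = 0 := by rw [Dy, (isWeakDeriv_zero ey).eq, mulX_zero]
  have hθ : Dθ 0 = 0 := by rw [Dθ, (isWeakDeriv_zero eθ).eq, mulX_zero]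
  rw [D, Function.iterate_fixed hy, Function.iterate_fixed hθ]

theorem memHk_zero (α : ℝ) (k : ℕ) : MemHk α k 0 := by
  have hL : ∀ ρ : ℝ × ℝ → ℝ, MemLp (fun p => (0 : X) p * ρ p) 2 μQ := by
    intro ρ
    refine (MemLp.zero (ε := ℝ)).ae_eq ?_
    filter_upwards [AEEqFun.coeFn_zero (α := ℝ × ℝ) (β := ℝ) (μ := μQ)] with p hp
    rw [hp]
    simp
  refine ⟨⟨fun j _ => ?_, fun i j _ => ?_⟩, fun j _ => ?_, fun i j _ _ => ?_⟩
  · rw [D_zero]; exact ⟨0, isWeakDeriv_zero _⟩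
  · rw [D_zero]; exact ⟨0, isWeakDeriv_zero _⟩
  · rw [D_zero]; exact hL _
  · rw [D_zero]; exact hL _

/-- The space `𝓗^k`. -/
def Hk (α : ℝ) (k : ℕ) : Submodule ℝ X where
  carrier := {f | MemHk α k f}
  add_mem' := fun {f g} hf hg => by
    have h := memHk_comb 1 1 hf hg
    rwa [one_smul, one_smul] at h
  zero_mem' := memHk_zero α k
  smul_mem' := fun c f hf => by
    have h := memHk_comb c 0 hf hf
    rwa [zero_smul, add_zero] at h

/-! The operators. -/

/-- `Γ(θ) = (sin θ cos² θ)^(α/3)` -/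
def Γ (α θ : ℝ) : ℝ := (Real.sin θ * Real.cos θ ^ 2) ^ (α / 3)

/-- `K(θ) = 3 sin θ cos² θ` -/
def K (θ : ℝ) : ℝ := 3 * Real.sin θ * Real.cos θ ^ 2

/-- The normalization constant of `Γ`. -/
def c (α : ℝ) : ℝ := ∫ θ in Ioo 0 (Real.pi / 2), Γ α θ * K θ

/-- `L₁₂(f)(z)` -/
def L12 (f : ℝ × ℝ → ℝ) (z : ℝ) : ℝ :=
  ∫ r in Ioi z, 3 * ∫ θ in Ioo 0 (Real.pi / 2),
    f (r, θ) * Real.sin θ * Real.cos θ ^ 2 / r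

/-- `𝓛_{F_*} f`, as a function on the half-strip. -/
def LF (α : ℝ) (f : X) (p : ℝ × ℝ) : ℝ :=
  f p + Dy f p - 2 * (f p / (1 + p.1))
    - 2 * p.1 * Γ α p.2 / (c α * (1 + p.1) ^ 2) * L12 f p.1

/-- `3/(1+y) · sin (2θ) ∂_θ f` -/
def transport (f : X) (p : ℝ × ℝ) : ℝ := 3 / (1 + p.1) * Dθ f p

/-- `𝓛^T_{F_*} f`, as a function on the half-strip, with the sign `s = 1` or `s = -1` in front of
the transport term and its correction (both sign conventions are in use). -/
def LT (α s : ℝ) (f : X) (p : ℝ × ℝ) : ℝ :=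
  LF α f p + s * (transport f p
    - Γ α p.2 / c α * (2 * p.1 ^ 2 / (1 + p.1) ^ 3) * L12 (transport f) 0)

end EulerLin

end

/-! In the coordinates t = log y, s = log tan θ the half-strip becomes the plane, D_y becomes ∂_t
and D_θ becomes 2∂_s. With q = 1/(1+y) the equation reads G = u + ∂_t u − 2q u + 6σq ∂_s u −
(nonlocal terms), σ = ±1, or σ = 0 for the operator without transport. The squared weights become ½
p(t) cosh(s)^κ, with κ = −1/100 for purely radial derivatives and κ = α/10 for the others.

Since p' = (1 − 4q)p, integration by parts gives ∫ u ∂_t u p = ∫ (−½ + 2q) u² p. The term 2q cancels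
the potential −2q exactly, and the local part has the coercivity constant ½. Transport costs at most
3|κ| ≤ 3/100, because the field ∂_t + 6σq ∂_s is divergence-free and the logarithmic derivative of
cosh^κ is at most |κ|. `energy_transport` is this identity for weak derivatives: a shear straightens
the field to ∂_t, and on almost every line the function is the primitive of its derivative. The
weights give enough integrability to avoid all cutoffs.

The nonlocal terms have the angular profile Γ. In the rows with i ≥ 1 the profile is D_θ^i Γ, of
norm O(√α) (`Γd_bound`), hence small. In the rows with i = 0 it is not small, but the term is
controlled by F = L₁₂(f) and by D_θ f. The function F has an estimate of its own: Γ/c has angular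
moment 1, so the moment of the equation, integrated in t, is closed up to transport
(`hardy_moment_eq`): F_G = F + F' − 2qF + σ·(terms in D_θ f). The same cancellation gives ½‖F‖² −
C‖F‖‖D_θ f‖ (`exists_row_moment`).

A form on all of 𝓗^k cannot use F itself, which lies in the weighted space only if L₁₂(f)(0) = 0. It
uses `hardy`, which is bounded on the weighted L² space without restriction and equals F when the
mean vanishes.

The form is ⟨F_G, F⟩ + A⟨D_θ G, D_θ f⟩ + Σ a_j Σ_i ⟨D_θ^i D_y^j G, D_θ^i D_y^j f⟩. The first two
terms are coercive for A large and then α small (`exists_base`). They do not involve k, so α₀ does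
not depend on k. They dominate all remainders at radial order 0. A further ∂_t produces only
commutators of smaller radial order, possibly with one more D_θ (`exists_remainder`, `IsRem.bound`),
so the weights a_j can be chosen one after another, each small against the coercivity already
obtained (`exists_coercive`). -/

noncomputable section

namespace LogPlane

open Filter Topology

/-! ### Weighted measures -/

section Weighted

variable {E : Type*} [MeasurableSpace E]

/-- The measure with the real density `ρ`. -/
def wmeas (μ : Measure E) (ρ : E → ℝ) : Measure E :=
  μ.withDensity fun x => ENNReal.ofReal (ρ x)

/-- The `L²` seminorm. -/
def nrm (ν : Measure E) (u : E → ℝ) : ℝ := (eLpNorm u 2 ν).toReal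

theorem nrm_nonneg (ν : Measure E) (u : E → ℝ) : 0 ≤ nrm ν u := ENNReal.toReal_nonneg

theorem integrable_wmeas {μ : Measure E} {ρ : E → ℝ} (hm : Measurable ρ) (hρ : ∀ x, 0 < ρ x)
    {u : E → ℝ} : Integrable u (wmeas μ ρ) ↔ Integrable (fun x => u x * ρ x) μ := by
  rw [wmeas, integrable_withDensity_iff hm.ennreal_ofReal (by simp)]
  simp only [ENNReal.toReal_ofReal (hρ _).le]

theorem integral_wmeas {μ : Measure E} {ρ : E → ℝ} (hm : Measurable ρ) (hρ : ∀ x, 0 < ρ x)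
    (u : E → ℝ) : ∫ x, u x ∂(wmeas μ ρ) = ∫ x, u x * ρ x ∂μ := by
  rw [wmeas, integral_withDensity_eq_integral_toReal_smul hm.ennreal_ofReal (by simp)]
  simp only [ENNReal.toReal_ofReal (hρ _).le, smul_eq_mul, mul_comm]

theorem wmeas_ac (μ : Measure E) (ρ : E → ℝ) : wmeas μ ρ ≪ μ := withDensity_absolutelyContinuous _ _

theorem ac_wmeas {μ : Measure E} {ρ : E → ℝ} (hm : Measurable ρ) (hρ : ∀ x, 0 < ρ x) :
    μ ≪ wmeas μ ρ :=
  withDensity_absolutelyContinuous' hm.ennreal_ofReal.aemeasurable (by simp [hρ])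

theorem memLp_wmeas {μ : Measure E} {ρ : E → ℝ} (hm : Measurable ρ) (hρ : ∀ x, 0 < ρ x)
    {u : E → ℝ} : MemLp u 2 (wmeas μ ρ) ↔
      AEStronglyMeasurable u μ ∧ Integrable (fun x => u x ^ 2 * ρ x) μ := by
  constructor
  · intro h
    exact ⟨h.1.mono_ac (ac_wmeas hm hρ),
      (integrable_wmeas hm hρ).1 ((memLp_two_iff_integrable_sq h.1).1 h)⟩
  · rintro ⟨h1, h2⟩
    exact (memLp_two_iff_integrable_sq (h1.mono_ac (wmeas_ac μ ρ))).2 ((integrable_wmeas hm hρ).2 h2)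

variable {ν : Measure E}

theorem integral_sq {u : E → ℝ} (hu : MemLp u 2 ν) : ∫ x, u x ^ 2 ∂ν = nrm ν u ^ 2 := by
  have := hu.eLpNorm_eq_integral_rpow_norm (by simp) (by simp)
  rw [nrm, this, ENNReal.toReal_ofReal (by positivity)]
  simp only [ENNReal.toReal_ofNat, Real.rpow_ofNat, Real.norm_eq_abs, sq_abs]
  rw [← Real.rpow_natCast, ← Real.rpow_mul (integral_nonneg fun x => sq_nonneg _)]
  norm_num

theorem abs_integral_mul_le {u v : E → ℝ} (hu : MemLp u 2 ν) (hv : MemLp v 2 ν) :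
    |∫ x, u x * v x ∂ν| ≤ nrm ν u * nrm ν v := by
  have h1 := norm_integral_le_integral_norm (μ := ν) (fun x => u x * v x)
  have h2 := integral_mul_norm_le_Lp_mul_Lq (μ := ν) (f := u) (g := v)
    Real.HolderConjugate.two_two (by simpa using hu) (by simpa using hv)
  have e : ∀ {u : E → ℝ}, MemLp u 2 ν → (∫ x, ‖u x‖ ^ (2 : ℝ) ∂ν) ^ ((1 : ℝ) / 2) = nrm ν u := by
    intro u hu
    have := hu.eLpNorm_eq_integral_rpow_norm (by simp) (by simp)
    rw [nrm, this, ENNReal.toReal_ofReal (by positivity)]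
    simp
  rw [e hu, e hv] at h2
  simp only [Real.norm_eq_abs, abs_mul] at h1 h2
  exact h1.trans h2

theorem integrable_mul {u v : E → ℝ} (hu : MemLp u 2 ν) (hv : MemLp v 2 ν) :
    Integrable (fun x => u x * v x) ν := hu.integrable_mul hv

theorem nrm_add_le {u v : E → ℝ} (hu : MemLp u 2 ν) (hv : MemLp v 2 ν) :
    nrm ν (fun x => u x + v x) ≤ nrm ν u + nrm ν v := by
  have h := eLpNorm_add_le hu.1 hv.1 (p := 2) (by norm_num)
  rw [nrm, nrm, nrm, ← ENNReal.toReal_add hu.2.ne hv.2.ne]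
  exact ENNReal.toReal_mono (by simp [hu.2.ne, hv.2.ne]) h

theorem memLp_of_bound {u v : E → ℝ} {C : ℝ} (hu : MemLp u 2 ν) (hv : AEStronglyMeasurable v ν)
    (h : ∀ x, |v x| ≤ C * |u x|) : MemLp v 2 ν :=
  MemLp.of_le_mul hu hv (Eventually.of_forall h)

theorem nrm_le_of_bound {u v : E → ℝ} {C : ℝ} (hC : 0 ≤ C) (hu : MemLp u 2 ν)
    (h : ∀ x, |v x| ≤ C * |u x|) : nrm ν v ≤ C * nrm ν u := by
  have := eLpNorm_le_mul_eLpNorm_of_ae_le_mul (p := 2) (Eventually.of_forall h : ∀ᵐ x ∂ν, ‖v x‖ ≤ C * ‖u x‖)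
  have h2 := ENNReal.toReal_mono (by finiteness [hu.2.ne]) this
  rwa [ENNReal.toReal_mul, ENNReal.toReal_ofReal hC] at h2

theorem nrm_const_mul (a : ℝ) (u : E → ℝ) : nrm ν (fun x => a * u x) = |a| * nrm ν u := by
  have := eLpNorm_const_smul a u 2 ν
  rw [nrm, show (fun x => a * u x) = a • u from rfl, this, ENNReal.toReal_mul]
  simp [nrm]

end Weighted

/-! ### Absolutely continuous functions on the line -/

theorem ac_of_primitive {v : ℝ → ℝ} (hv : Integrable v) (a b : ℝ) :
    AbsolutelyContinuousOnInterval (fun t => ∫ r in Iic t, v r) a b := by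
  have h : (fun t => ∫ r in Iic t, v r) = fun t => (∫ r in a..t, v r) + ∫ r in Iic a, v r := by
    ext t
    rw [intervalIntegral.integral_Iic_sub_Iic hv.integrableOn hv.integrableOn |>.symm]
    ring
  rw [h]
  refine AbsolutelyContinuousOnInterval.add
    (hv.intervalIntegrable.absolutelyContinuousOnInterval_intervalIntegral left_mem_uIcc) ?_
  exact (contDiff_const (n := 1)).contDiffOn.absolutelyContinuousOnInterval

theorem ae_hasDerivAt_primitive {v : ℝ → ℝ} (hv : Integrable v) :
    ∀ᵐ t, HasDerivAt (fun t => ∫ r in Iic t, v r) (v t) t := by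
  have h : (fun t => ∫ r in Iic t, v r) = fun t => (∫ r in (0 : ℝ)..t, v r) + ∫ r in Iic 0, v r := by
    ext t
    rw [intervalIntegral.integral_Iic_sub_Iic hv.integrableOn hv.integrableOn |>.symm]
    ring
  rw [h]
  filter_upwards [_root_.LocallyIntegrable.ae_hasDerivAt_integral hv.locallyIntegrable] with t ht
  exact (ht 0).add_const _

/-- Integrability of `m` gives `P` a limit at either end, and integrability of `P` forces both
limits to be 0. This takes the place of cutoff functions in all integrations by parts. -/
theorem eq_integral_Iic_of_ac {P m : ℝ → ℝ} (hP : ∀ a b, AbsolutelyContinuousOnInterval P a b)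
    (hd : ∀ᵐ t, HasDerivAt P (m t) t) (hPi : Integrable P) (hm : Integrable m) :
    (∀ t, P t = ∫ r in Iic t, m r) ∧ ∫ r, m r = 0 := by
  have hab : ∀ a b, ∫ r in a..b, m r = P b - P a := fun a b => by
    rw [← (hP a b).integral_deriv_eq_sub]
    apply intervalIntegral.integral_congr_ae
    filter_upwards [hd] with t ht _ using ht.deriv.symm
  have h1 : ∀ t, P t = ∫ r in Iic t, m r := by
    intro t
    have h := intervalIntegral_tendsto_integral_Iic t hm.integrableOn tendsto_id
    simp only [hab, id] at h
    have h' : Tendsto P atBot (𝓝 (P t - ∫ r in Iic t, m r)) := by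
      have := (tendsto_const_nhds (x := P t)).sub h
      simpa using this
    have := (hPi.integrableAtFilter atBot).eq_zero_of_tendsto (fun s hs => by
      obtain ⟨b, hb⟩ := mem_atBot_sets.1 hs
      exact top_unique (by rw [← Real.volume_Iic (a := b)]; exact measure_mono hb)) h'
    linarith
  refine ⟨h1, ?_⟩
  have h := intervalIntegral_tendsto_integral_Ioi 0 hm.integrableOn tendsto_id
  simp only [hab, id] at h
  have h' : Tendsto P atTop (𝓝 (P 0 + ∫ r in Ioi 0, m r)) := by
    have := (tendsto_const_nhds (x := P 0)).add h
    simpa using this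
  have h3 := (hPi.integrableAtFilter atTop).eq_zero_of_tendsto (fun s hs => by
      obtain ⟨b, hb⟩ := mem_atTop_sets.1 hs
      exact top_unique (by rw [← Real.volume_Ici (a := b)]; exact measure_mono hb)) h'
  rw [← intervalIntegral.integral_Iic_add_Ioi (b := 0) hm.integrableOn hm.integrableOn, ← h1, h3]

theorem ac_of_contDiff {a : ℝ → ℝ} (ha : ContDiff ℝ 1 a) (x y : ℝ) :
    AbsolutelyContinuousOnInterval a x y := ha.contDiffOn.absolutelyContinuousOnInterval

/-- The integrand is the derivative of U²ρ, where U is the primitive of `v`; integrability of both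
suffices, and no decay has to be verified. -/
theorem energy_line {v ρ : ℝ → ℝ} (hv : Integrable v) (hρ : ContDiff ℝ 1 ρ)
    (h1 : Integrable fun t => (∫ r in Iic t, v r) ^ 2 * ρ t)
    (h2 : Integrable fun t => 2 * (∫ r in Iic t, v r) * v t * ρ t
      + (∫ r in Iic t, v r) ^ 2 * deriv ρ t) :
    ∫ t, (2 * (∫ r in Iic t, v r) * v t * ρ t + (∫ r in Iic t, v r) ^ 2 * deriv ρ t) = 0 := by
  refine (eq_integral_Iic_of_ac (P := fun t => (∫ r in Iic t, v r) ^ 2 * ρ t) ?_ ?_ h1 h2).2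
  · intro a b
    have h := ac_of_primitive hv a b
    simp only [pow_two]
    exact (h.fun_mul h).fun_mul (ac_of_contDiff hρ a b)
  · filter_upwards [ae_hasDerivAt_primitive hv] with t ht
    have := (ht.pow 2).mul ((hρ.differentiable (by simp)) t).hasDerivAt
    convert! this using 1
    simp

theorem product_line {v a : ℝ → ℝ} (hv : Integrable v) (ha : ContDiff ℝ 1 a)
    (h1 : Integrable fun t => a t * ∫ r in Iic t, v r)
    (h2 : Integrable fun t => deriv a t * (∫ r in Iic t, v r) + a t * v t) :
    (∀ t, a t * (∫ r in Iic t, v r) = ∫ x in Iic t, (deriv a x * (∫ r in Iic x, v r) + a x * v x)) ∧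
    ∫ t, (deriv a t * (∫ r in Iic t, v r) + a t * v t) = 0 := by
  refine eq_integral_Iic_of_ac (P := fun t => a t * ∫ r in Iic t, v r) ?_ ?_ h1 h2
  · exact fun x y => (ac_of_contDiff ha x y).fun_mul (ac_of_primitive hv x y)
  · filter_upwards [ae_hasDerivAt_primitive hv] with t ht
    exact ((ha.differentiable (by simp)) t).hasDerivAt.mul ht

theorem integral_exp_neg_abs {a : ℝ} (ha : 0 < a) :
    Integrable (fun t : ℝ => Real.exp (-a * |t|)) ∧ ∫ t : ℝ, Real.exp (-a * |t|) = 2 / a := by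
  have h1 : IntegrableOn (fun t : ℝ => Real.exp (-a * |t|)) (Ioi 0) :=
    (integrableOn_exp_mul_Ioi (a := -a) (by linarith) 0).congr_fun
      (fun t (ht : 0 < t) => by simp only [abs_of_pos ht]) measurableSet_Ioi
  have h2 : IntegrableOn (fun t : ℝ => Real.exp (-a * |t|)) (Iic 0) :=
    (integrableOn_exp_mul_Iic (a := a) (by linarith) 0).congr_fun
      (fun t (ht : t ≤ 0) => by simp only [abs_of_nonpos ht]; ring_nf) measurableSet_Iic
  constructor
  · have := h2.union h1
    rwa [Iic_union_Ioi, integrableOn_univ] at this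
  · rw [integral_comp_abs (f := fun x => Real.exp (-a * x)),
      integral_exp_mul_Ioi (by linarith)]
    simp
    ring

/-! ### The radial weight in the variable `t = log y` -/

/-- This is 1/(1+y) at y = e^t. -/
def q (t : ℝ) : ℝ := 1 / (1 + Real.exp t)

/-- This is w(y)² y at y = e^t; the extra factor y comes from dy = y dt. -/
def p (t : ℝ) : ℝ := (1 + Real.exp t) ^ 4 * Real.exp (-3 * t)

theorem q_pos (t : ℝ) : 0 < q t := by unfold q; positivity

theorem q_lt_one (t : ℝ) : q t < 1 := by
  unfold q
  rw [div_lt_one (by positivity)]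
  linarith [Real.exp_pos t]

theorem one_sub_q (t : ℝ) : 1 - q t = Real.exp t / (1 + Real.exp t) := by
  unfold q
  field_simp
  ring

theorem p_pos (t : ℝ) : 0 < p t := by unfold p; positivity

theorem hasDerivAt_q (t : ℝ) : HasDerivAt q (-(q t * (1 - q t))) t := by
  have h : HasDerivAt (fun t => 1 + Real.exp t) (Real.exp t) t := (Real.hasDerivAt_exp t).const_add 1
  have := h.inv (by positivity)
  unfold q
  simp only [one_div]
  convert! this using 1
  field_simp
  ring

/-- The coefficient 1 − 4q is the source of coercivity: −½(1 − 4q) contains the 2q that cancels the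
potential of the operator. -/
theorem hasDerivAt_p (t : ℝ) : HasDerivAt p (p t * (1 - 4 * q t)) t := by
  have h : HasDerivAt (fun t => 1 + Real.exp t) (Real.exp t) t := (Real.hasDerivAt_exp t).const_add 1
  have h2 : HasDerivAt (fun t : ℝ => -3 * t) (-3) t := by
    simpa using (hasDerivAt_id t).const_mul (-3)
  have := (h.pow 4).mul h2.exp
  convert! this using 1
  simp only [Pi.pow_apply]
  unfold p q
  field_simp
  push_cast
  ring

theorem contDiff_q : ContDiff ℝ ∞ q := by
  unfold q
  exact contDiff_const.div (contDiff_const.add Real.contDiff_exp) fun t => by positivity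

theorem contDiff_p : ContDiff ℝ ∞ p := by
  unfold p
  fun_prop

theorem deriv_p (t : ℝ) : deriv p t = p t * (1 - 4 * q t) := (hasDerivAt_p t).deriv

theorem continuous_q : Continuous q := contDiff_q.continuous

theorem continuous_p : Continuous p := contDiff_p.continuous

theorem measurable_p : Measurable p := continuous_p.measurable

/-- The weight grows like e^{−3t} at −∞ and like e^t at +∞. Hence 1/p is integrable, L²(p) is
contained in L¹, and there is room for the small angular loss caused by the shear. -/
theorem exp_abs_le_p (t : ℝ) : Real.exp |t| ≤ p t := by
  have h0 := Real.exp_pos t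
  unfold p
  rcases le_total 0 t with h | h
  · rw [abs_of_nonneg h]
    have e : Real.exp t = Real.exp t ^ 4 * Real.exp (-3 * t) := by
      rw [← Real.exp_nat_mul, ← Real.exp_add]; congr 1; push_cast; ring
    calc Real.exp t = Real.exp t ^ 4 * Real.exp (-3 * t) := e
      _ ≤ _ := by gcongr; linarith
  · rw [abs_of_nonpos h]
    calc Real.exp (-t) ≤ Real.exp (-3 * t) := Real.exp_le_exp.2 (by linarith)
      _ = 1 ^ 4 * Real.exp (-3 * t) := by ring
      _ ≤ _ := by gcongr; linarith

theorem integrable_inv_p : Integrable fun t => (p t)⁻¹ := by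
  have h := (integral_exp_neg_abs (a := 1) one_pos).1
  refine h.mono' (continuous_p.inv₀ fun t => (p_pos t).ne').aestronglyMeasurable
    (Eventually.of_forall fun t => ?_)
  rw [Real.norm_eq_abs, abs_of_pos (inv_pos.2 (p_pos t)), show -1 * |t| = -|t| by ring, Real.exp_neg]
  exact inv_anti₀ (Real.exp_pos _) (exp_abs_le_p t)

abbrev νp : Measure ℝ := wmeas volume p

/-- Pointwise |u| ≤ u² r + 1/r. -/
theorem integrable_of_sq_mul {E : Type*} [MeasurableSpace E] {μ : Measure E} {u r : E → ℝ}
    (hr : ∀ x, 0 < r x) (hi : Integrable (fun x => (r x)⁻¹) μ) (hm : AEStronglyMeasurable u μ)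
    (hu : Integrable (fun x => u x ^ 2 * r x) μ) : Integrable u μ := by
  refine (hu.add hi).mono' hm (Eventually.of_forall fun x => ?_)
  have h := hr x
  simp only [Real.norm_eq_abs, Pi.add_apply]
  have h1 : 0 ≤ (|u x| * r x - 1) ^ 2 := sq_nonneg _
  have h2 : u x ^ 2 * r x + (r x)⁻¹ - |u x|
      = ((|u x| * r x - 1) ^ 2 + |u x| * r x) / r x := by
    field_simp
    rw [← sq_abs (u x)]
    ring
  have h3 : 0 ≤ u x ^ 2 * r x + (r x)⁻¹ - |u x| := by rw [h2]; positivity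
  linarith

theorem integrable_of_memLp {u : ℝ → ℝ} (hu : MemLp u 2 νp) : Integrable u :=
  have h := (memLp_wmeas measurable_p p_pos).1 hu
  integrable_of_sq_mul p_pos integrable_inv_p h.1 h.2

/-! ### The Hardy operator -/

/-- A convolution kernel that dominates `hardy` conjugated by √p; its mass 4 becomes the bound for
the operator norm. -/
def kern (t : ℝ) : ℝ := Real.exp (-(1 / 2) * |t|)

theorem continuous_kern : Continuous kern := by unfold kern; fun_prop

theorem integrable_kern : Integrable kern := (integral_exp_neg_abs (a := 1 / 2) (by norm_num)).1

theorem lintegral_kern : ∫⁻ t, ENNReal.ofReal (kern t) = 4 := by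
  rw [← ofReal_integral_eq_lintegral_ofReal integrable_kern
    (Eventually.of_forall fun t => (Real.exp_pos _).le)]
  unfold kern
  rw [(integral_exp_neg_abs (a := 1 / 2) (by norm_num)).2]
  norm_num

/-- Cauchy–Schwarz for the measure k dμ. -/
theorem lintegral_sq_mul_le {E : Type*} [MeasurableSpace E] (μ : Measure E) {k h : E → ENNReal}
    (hk : AEMeasurable k μ) (hh : AEMeasurable h μ) :
    (∫⁻ x, k x * h x ∂μ) ^ 2 ≤ (∫⁻ x, k x ∂μ) * ∫⁻ x, k x * h x ^ 2 ∂μ := by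
  have h1 := ENNReal.lintegral_mul_le_Lp_mul_Lq μ Real.HolderConjugate.two_two
    (f := fun x => k x ^ (1 / 2 : ℝ)) (g := fun x => k x ^ (1 / 2 : ℝ) * h x)
    (hk.pow_const _) ((hk.pow_const _).mul hh)
  have e1 : ∀ x, k x ^ (1 / 2 : ℝ) * k x ^ (1 / 2 : ℝ) = k x := fun x => by
    rw [← ENNReal.rpow_add_of_nonneg _ _ (by norm_num) (by norm_num)]; norm_num
  have e2 : ∀ x, (k x ^ (1 / 2 : ℝ)) ^ (2 : ℝ) = k x := fun x => by
    rw [← ENNReal.rpow_mul]; norm_num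
  have e3 : ∀ a : ENNReal, (a ^ (1 / 2 : ℝ)) ^ 2 = a := fun a => by
    rw [← ENNReal.rpow_natCast, ← ENNReal.rpow_mul]; norm_num
  simp only [Pi.mul_apply, ← mul_assoc, e1, e2, ENNReal.mul_rpow_of_nonneg _ _ (show (0:ℝ) ≤ 2 by norm_num)] at h1
  calc _ ≤ _ := pow_le_pow_left₀ (by positivity) h1 2
    _ = _ := by
      rw [mul_pow, e3, e3]
      congr 1
      refine lintegral_congr fun x => ?_
      rw [ENNReal.rpow_ofNat]

/-- Schur's test: the kernel has mass 4 in each variable, and 16 = 4·4. -/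
theorem lintegral_conv_kern_sq_le {h : ℝ → ENNReal} (hh : AEMeasurable h) :
    ∫⁻ t, (∫⁻ r, ENNReal.ofReal (kern (t - r)) * h r) ^ 2 ≤ 16 * ∫⁻ r, h r ^ 2 := by
  have hk : Measurable fun x : ℝ × ℝ => ENNReal.ofReal (kern (x.1 - x.2)) :=
    (continuous_kern.comp (continuous_fst.sub continuous_snd)).measurable.ennreal_ofReal
  have hkt : ∀ t : ℝ, Measurable fun r : ℝ => ENNReal.ofReal (kern (t - r)) := fun t =>
    (continuous_kern.comp (continuous_const.sub continuous_id)).measurable.ennreal_ofReal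
  calc _ ≤ ∫⁻ t, 4 * ∫⁻ r, ENNReal.ofReal (kern (t - r)) * h r ^ 2 := by
        refine lintegral_mono fun t => ?_
        have h1 := lintegral_sq_mul_le volume (hkt t).aemeasurable hh
        rwa [lintegral_sub_left_eq_self (fun x => ENNReal.ofReal (kern x)) t, lintegral_kern] at h1
    _ = 4 * ∫⁻ t, ∫⁻ r, ENNReal.ofReal (kern (t - r)) * h r ^ 2 := by
        rw [lintegral_const_mul' _ _ (by norm_num)]
    _ = 4 * ∫⁻ r, ∫⁻ t, ENNReal.ofReal (kern (t - r)) * h r ^ 2 := by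
        rw [lintegral_lintegral_swap]
        exact hk.aemeasurable.mul ((hh.comp_snd (μ := volume)).pow_const 2)
    _ = 4 * ∫⁻ r, 4 * h r ^ 2 := by
        congr 1
        refine lintegral_congr fun r => ?_
        rw [lintegral_mul_const _ (by
          exact (continuous_kern.comp (continuous_id.sub continuous_const)).measurable.ennreal_ofReal),
          lintegral_sub_right_eq_self (fun x => ENNReal.ofReal (kern x)) r, lintegral_kern]
    _ = _ := by
        rw [lintegral_const_mul' _ _ (by norm_num), ← mul_assoc]; norm_num

/-- The primitive of `φ`, corrected so that it vanishes at `-∞` to second order. -/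
def hardy (φ : ℝ → ℝ) (t : ℝ) : ℝ :=
  (1 - q t) ^ 2 * (∫ r in Ioi t, φ r) - (1 - (1 - q t) ^ 2) * ∫ r in Iic t, φ r

def sp (t : ℝ) : ℝ := (1 + Real.exp t) ^ 2 * Real.exp (-(3 / 2) * t)

theorem sp_pos (t : ℝ) : 0 < sp t := by unfold sp; positivity

theorem sp_sq (t : ℝ) : sp t ^ 2 = p t := by
  unfold sp p
  rw [mul_pow, ← Real.exp_nat_mul]
  ring_nf

theorem continuous_sp : Continuous sp := by unfold sp; fun_prop

/-- The factor (1−q)² turns √p(t) into exactly e^{t/2}, and e^{r/2} ≤ √p(r). Without this factor the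
tail integral would meet the growth e^{−3t/2} of √p at −∞. -/
theorem sp_mul_le_of_lt {t r : ℝ} (h : t < r) : sp t * (1 - q t) ^ 2 ≤ kern (t - r) * sp r := by
  have h0 := Real.exp_pos r
  have e1 : sp t * (1 - q t) ^ 2 = Real.exp (t / 2) := by
    rw [one_sub_q, sp, div_pow, show t / 2 = t + t + (-(3 / 2) * t) by ring, Real.exp_add, Real.exp_add]
    field_simp
  have e2 : Real.exp (t / 2) = kern (t - r) * Real.exp (r / 2) := by
    rw [kern, abs_of_neg (by linarith), ← Real.exp_add]; ring_nf
  have e3 : Real.exp (r / 2) ≤ sp r := by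
    rw [sp, show r / 2 = r + r + (-(3 / 2) * r) by ring, Real.exp_add, Real.exp_add]
    gcongr
    nlinarith
  rw [e1, e2]
  exact mul_le_mul_of_nonneg_left e3 (Real.exp_pos _).le

/-- After multiplication by e^{t/2} the sides are e^{−t} + 2 and e^{−r} + 2 + e^r, and e^{−t} ≤
e^{−r} for r ≤ t. -/
theorem sp_mul_le_of_le {t r : ℝ} (h : r ≤ t) :
    sp t * (1 - (1 - q t) ^ 2) ≤ kern (t - r) * sp r := by
  have h0 := Real.exp_pos t
  have e1 : sp t * (1 - (1 - q t) ^ 2) = (Real.exp (-t) + 2) * Real.exp (-t / 2) := by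
    rw [one_sub_q, sp, show -t / 2 = t + (-(3 / 2) * t) by ring, Real.exp_add, Real.exp_neg t]
    field_simp
    ring
  have e2 : kern (t - r) * sp r = (Real.exp (-r) + 2 + Real.exp r) * Real.exp (-t / 2) := by
    rw [kern, sp, abs_of_nonneg (by linarith),
      show -(1 / 2) * (t - r) = -t / 2 + r / 2 by ring, Real.exp_add,
      show -(3 / 2) * r = -(r / 2) + -r by ring, Real.exp_add, Real.exp_neg (r / 2), Real.exp_neg r]
    field_simp
    ring
  rw [e1, e2]
  have e3 : Real.exp (-t) ≤ Real.exp (-r) := Real.exp_le_exp.2 (by linarith)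
  have := Real.exp_pos r
  exact mul_le_mul_of_nonneg_right (by linarith) (Real.exp_pos _).le

theorem hardy_coeff_nonneg (t : ℝ) : 0 ≤ (1 - q t) ^ 2 ∧ 0 ≤ 1 - (1 - q t) ^ 2 := by
  have := q_pos t
  have := q_lt_one t
  constructor <;> nlinarith

/-- The two integrals in `hardy` run over complementary half-lines, and on each the coefficient is
below the kernel. -/
theorem enorm_sp_hardy_le (φ : ℝ → ℝ) (t : ℝ) :
    ‖sp t * hardy φ t‖ₑ ≤ ∫⁻ r, ENNReal.ofReal (kern (t - r)) * ‖sp r * φ r‖ₑ := by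
  obtain ⟨c1, c2⟩ := hardy_coeff_nonneg t
  have hs := (sp_pos t).le
  have key : ∀ (S : Set ℝ) (a : ℝ), MeasurableSet S → 0 ≤ a →
      (∀ r ∈ S, a ≤ kern (t - r) * sp r) →
      ‖a * ∫ r in S, φ r‖ₑ ≤ ∫⁻ r in S, ENNReal.ofReal (kern (t - r)) * ‖sp r * φ r‖ₑ := by
    intro S a hS ha h
    rw [enorm_mul]
    calc _ ≤ ‖a‖ₑ * ∫⁻ r in S, ‖φ r‖ₑ := by gcongr; exact enorm_integral_le_lintegral_enorm _
      _ = ∫⁻ r in S, ‖a‖ₑ * ‖φ r‖ₑ := by rw [lintegral_const_mul' _ _ (by simp)]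
      _ ≤ _ := by
        refine setLIntegral_mono' hS fun r hr => ?_
        rw [enorm_mul, ← mul_assoc, Real.enorm_of_nonneg ha, Real.enorm_of_nonneg (sp_pos r).le,
          ← ENNReal.ofReal_mul (show 0 ≤ kern (t - r) from (Real.exp_pos _).le)]
        gcongr
        exact h r hr
  have e : sp t * hardy φ t = sp t * (1 - q t) ^ 2 * (∫ r in Ioi t, φ r)
      - sp t * (1 - (1 - q t) ^ 2) * ∫ r in Iic t, φ r := by unfold hardy; ring
  rw [e]
  calc _ ≤ _ := enorm_sub_le
    _ ≤ _ := add_le_add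
      (key (Ioi t) _ measurableSet_Ioi (by positivity) fun r hr => sp_mul_le_of_lt hr)
      (key (Iic t) _ measurableSet_Iic (by positivity) fun r hr => sp_mul_le_of_le hr)
    _ = _ := by
      rw [add_comm, ← lintegral_union measurableSet_Ioi (by
        rw [Set.disjoint_left]; intro x hx hx'; exact not_lt.2 (mem_Iic.1 hx) (mem_Ioi.1 hx')), Iic_union_Ioi,
        setLIntegral_univ]

theorem continuous_primitive {v : ℝ → ℝ} (hv : Integrable v) :
    Continuous fun t => ∫ r in Iic t, v r := by
  have h : (fun t => ∫ r in Iic t, v r) = fun t => (∫ r in (0 : ℝ)..t, v r) + ∫ r in Iic 0, v r := by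
    ext t
    rw [intervalIntegral.integral_Iic_sub_Iic hv.integrableOn hv.integrableOn |>.symm]
    ring
  rw [h]
  exact (intervalIntegral.continuous_primitive (fun a b => hv.intervalIntegrable) 0).add
    continuous_const

theorem integral_Ioi_eq_sub {v : ℝ → ℝ} (hv : Integrable v) (t : ℝ) :
    ∫ r in Ioi t, v r = (∫ r, v r) - ∫ r in Iic t, v r := by
  rw [← intervalIntegral.integral_Iic_add_Ioi (b := t) hv.integrableOn hv.integrableOn]
  ring

theorem continuous_hardy {φ : ℝ → ℝ} (hφ : Integrable φ) : Continuous (hardy φ) := by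
  have h1 := continuous_primitive hφ
  have hq := continuous_q
  unfold hardy
  simp only [integral_Ioi_eq_sub hφ]
  fun_prop

theorem eLpNorm_two_sq {E : Type*} [MeasurableSpace E] (μ : Measure E) {ρ : E → ℝ} (hm : Measurable ρ)
    {σ : E → ℝ} (hσ : ∀ x, 0 < σ x) (h : ∀ x, σ x ^ 2 = ρ x)
    (u : E → ℝ) : eLpNorm u 2 (wmeas μ ρ) = (∫⁻ x, ‖σ x * u x‖ₑ ^ 2 ∂μ) ^ (1 / 2 : ℝ) := by
  rw [eLpNorm_eq_lintegral_rpow_enorm_toReal (by simp) (by simp), wmeas,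
    lintegral_withDensity_eq_lintegral_mul_non_measurable _ hm.ennreal_ofReal (by simp)]
  simp only [ENNReal.toReal_ofNat, Pi.mul_apply, ENNReal.rpow_ofNat, enorm_mul, mul_pow, ← h,
    Real.enorm_of_nonneg (hσ _).le, ENNReal.ofReal_pow (hσ _).le]

theorem eLpNorm_hardy_le {φ : ℝ → ℝ} (hφ : AEStronglyMeasurable φ volume) :
    eLpNorm (hardy φ) 2 νp ≤ 4 * eLpNorm φ 2 νp := by
  rw [eLpNorm_two_sq volume measurable_p sp_pos sp_sq, eLpNorm_two_sq volume measurable_p sp_pos sp_sq]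
  have h : ∫⁻ t, ‖sp t * hardy φ t‖ₑ ^ 2 ≤ 16 * ∫⁻ r, ‖sp r * φ r‖ₑ ^ 2 := by
    refine (lintegral_mono fun t => pow_le_pow_left₀ (by positivity) (enorm_sp_hardy_le φ t) 2).trans
      (lintegral_conv_kern_sq_le ?_)
    exact (continuous_sp.aestronglyMeasurable.mul hφ).enorm
  calc _ ≤ _ := ENNReal.rpow_le_rpow h (by norm_num)
    _ = _ := by
      rw [ENNReal.mul_rpow_of_nonneg _ _ (by norm_num)]
      congr 1
      rw [show (16 : ENNReal) = 4 ^ (2 : ℝ) by norm_num, ← ENNReal.rpow_mul]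
      norm_num

theorem memLp_hardy {φ : ℝ → ℝ} (hφ : MemLp φ 2 νp) : MemLp (hardy φ) 2 νp :=
  ⟨(continuous_hardy (integrable_of_memLp hφ)).aestronglyMeasurable,
    (eLpNorm_hardy_le (hφ.1.mono_ac (ac_wmeas measurable_p p_pos))).trans_lt
      (ENNReal.mul_lt_top (by simp) hφ.2)⟩

theorem nrm_hardy_le {φ : ℝ → ℝ} (hφ : MemLp φ 2 νp) : nrm νp (hardy φ) ≤ 4 * nrm νp φ := by
  have := ENNReal.toReal_mono (by finiteness [hφ.2.ne])
    (eLpNorm_hardy_le (hφ.1.mono_ac (ac_wmeas measurable_p p_pos)))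
  rwa [ENNReal.toReal_mul] at this

/-- The correction is a multiple of the total integral, so it disappears on functions of mean zero.
This is where the condition L₁₂(f)(0) = 0 enters. -/
theorem hardy_of_integral_eq_zero {φ : ℝ → ℝ} (hφ : Integrable φ) (h : ∫ r, φ r = 0) (t : ℝ) :
    hardy φ t = ∫ r in Ioi t, φ r := by
  have := integral_Ioi_eq_sub hφ t
  rw [h, zero_sub] at this
  rw [hardy, this]
  ring

theorem hardy_congr {φ ψ : ℝ → ℝ} (h : φ =ᵐ[volume] ψ) : hardy φ = hardy ψ := by
  ext t
  rw [hardy, hardy, setIntegral_congr_ae measurableSet_Ioi (h.mono fun x hx _ => hx),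
    setIntegral_congr_ae measurableSet_Iic (h.mono fun x hx _ => hx)]

theorem hardy_add {φ ψ : ℝ → ℝ} (hφ : Integrable φ) (hψ : Integrable ψ) (t : ℝ) :
    hardy (fun r => φ r + ψ r) t = hardy φ t + hardy ψ t := by
  rw [hardy, hardy, hardy, integral_add hφ.integrableOn hψ.integrableOn,
    integral_add hφ.integrableOn hψ.integrableOn]
  ring

theorem hardy_const_mul (a : ℝ) (φ : ℝ → ℝ) (t : ℝ) :
    hardy (fun r => a * φ r) t = a * hardy φ t := by
  rw [hardy, hardy, integral_const_mul, integral_const_mul]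
  ring

/-! ### Weak derivatives along divergence-free fields in the plane -/

/-- The derivative of `ψ` along the field `a ∂_t + b(t) ∂_s`. -/
def vf (a : ℝ) (b : ℝ → ℝ) (ψ : ℝ × ℝ → ℝ) (x : ℝ × ℝ) : ℝ := fderiv ℝ ψ x (a, b x.1)

/-- `v` is the weak derivative of `u` along the field `a ∂_t + b(t) ∂_s`. -/
structure Weak (a : ℝ) (b : ℝ → ℝ) (u v : ℝ × ℝ → ℝ) : Prop where
  left : LocallyIntegrable u
  right : LocallyIntegrable v
  eq : ∀ ψ : ℝ × ℝ → ℝ, ContDiff ℝ ∞ ψ → HasCompactSupport ψ →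
    ∫ x, u x * vf a b ψ x = -∫ x, v x * ψ x

abbrev WeakT := Weak 1 (fun _ => 0)
abbrev WeakS := Weak 0 (fun _ => 1)

section

variable {a : ℝ} {b : ℝ → ℝ} {u v u' v' : ℝ × ℝ → ℝ}

theorem integrable_mul_test (hu : LocallyIntegrable u) {ψ : ℝ × ℝ → ℝ} (hψ : Continuous ψ)
    (hc : HasCompactSupport ψ) : Integrable fun x => u x * ψ x :=
  hu.integrable_smul_right_of_hasCompactSupport hψ hc

theorem vf_eq (a : ℝ) (b : ℝ → ℝ) (ψ : ℝ × ℝ → ℝ) (x : ℝ × ℝ) :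
    vf a b ψ x = a * vf 1 (fun _ => 0) ψ x + b x.1 * vf 0 (fun _ => 1) ψ x := by
  unfold vf
  rw [← smul_eq_mul, ← smul_eq_mul, ← map_smul, ← map_smul, ← map_add]
  simp

theorem contDiff_vf (hb : ContDiff ℝ ∞ b) {ψ : ℝ × ℝ → ℝ} (hψ : ContDiff ℝ ∞ ψ) :
    ContDiff ℝ ∞ (vf a b ψ) := by
  unfold vf
  exact (hψ.fderiv_right (m := ∞) (by simp)).clm_apply
    (contDiff_const.prodMk (hb.comp contDiff_fst))

theorem hasCompactSupport_vf {ψ : ℝ × ℝ → ℝ} (hc : HasCompactSupport ψ) :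
    HasCompactSupport (vf a b ψ) := by
  refine (hc.fderiv ℝ).mono fun x hx => ?_
  rw [Function.mem_support] at hx ⊢
  intro h
  apply hx
  rw [vf, h]
  rfl

theorem vf_mul {A ψ : ℝ × ℝ → ℝ} (hA : ContDiff ℝ ∞ A) (hψ : ContDiff ℝ ∞ ψ) (x : ℝ × ℝ) :
    vf a b (fun x => A x * ψ x) x = vf a b A x * ψ x + A x * vf a b ψ x := by
  unfold vf
  rw [fderiv_fun_mul (hA.differentiable (by simp) x) (hψ.differentiable (by simp) x)]
  simp
  ring

theorem vf_add {A ψ : ℝ × ℝ → ℝ} (hA : ContDiff ℝ ∞ A) (hψ : ContDiff ℝ ∞ ψ) (x : ℝ × ℝ) :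
    vf a b (fun x => A x + ψ x) x = vf a b A x + vf a b ψ x := by
  unfold vf
  rw [fderiv_fun_add (hA.differentiable (by simp) x) (hψ.differentiable (by simp) x)]
  simp

theorem vf_comp_fst {A : ℝ → ℝ} (hA : ContDiff ℝ ∞ A) (x : ℝ × ℝ) :
    vf a b (fun x => A x.1) x = a * deriv A x.1 := by
  have h0 : HasFDerivAt (fun x : ℝ × ℝ => x.1) (ContinuousLinearMap.fst ℝ ℝ ℝ) x := hasFDerivAt_fst
  have h := ((hA.differentiable (by simp) x.1).hasDerivAt.comp_hasFDerivAt x h0).fderiv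
  have h' : fderiv ℝ (fun x : ℝ × ℝ => A x.1) x = _ := h
  rw [vf, h']
  simp [mul_comm]

theorem vf_comp_snd {A : ℝ → ℝ} (hA : ContDiff ℝ ∞ A) (x : ℝ × ℝ) :
    vf a b (fun x => A x.2) x = b x.1 * deriv A x.2 := by
  have h0 : HasFDerivAt (fun x : ℝ × ℝ => x.2) (ContinuousLinearMap.snd ℝ ℝ ℝ) x := hasFDerivAt_snd
  have h := ((hA.differentiable (by simp) x.2).hasDerivAt.comp_hasFDerivAt x h0).fderiv
  have h' : fderiv ℝ (fun x : ℝ × ℝ => A x.2) x = _ := h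
  rw [vf, h']
  simp [mul_comm]

theorem vf_comm_const (a₁ b₁ a₂ b₂ : ℝ) {ψ : ℝ × ℝ → ℝ} (hψ : ContDiff ℝ ∞ ψ) (x : ℝ × ℝ) :
    vf a₁ (fun _ => b₁) (vf a₂ (fun _ => b₂) ψ) x
      = vf a₂ (fun _ => b₂) (vf a₁ (fun _ => b₁) ψ) x := by
  have hd : Differentiable ℝ (fderiv ℝ ψ) :=
    (hψ.fderiv_right (m := ∞) (by simp)).differentiable (by simp)
  have e : ∀ v w : ℝ × ℝ, fderiv ℝ (fun y => fderiv ℝ ψ y v) x w = fderiv ℝ (fderiv ℝ ψ) x w v := by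
    intro v w
    rw [fderiv_clm_apply (hd x) (differentiableAt_const v)]
    simp
  unfold vf
  rw [e, e]
  exact ((contDiff_infty.1 hψ 2).contDiffAt.isSymmSndFDerivAt (by simp)).eq _ _

theorem Weak.congr (h : Weak a b u v) (hu : u =ᵐ[volume] u') (hv : v =ᵐ[volume] v') :
    Weak a b u' v' := by
  refine ⟨h.left.congr hu, h.right.congr hv, fun ψ hψ hc => ?_⟩
  have := h.eq ψ hψ hc
  have e1 : ∫ x, u x * vf a b ψ x = ∫ x, u' x * vf a b ψ x :=
    integral_congr_ae (hu.mono fun x hx => by simp only [hx])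
  have e2 : ∫ x, v x * ψ x = ∫ x, v' x * ψ x :=
    integral_congr_ae (hv.mono fun x hx => by simp only [hx])
  rw [← e1, ← e2, this]

theorem Weak.congr' (h : Weak a b u v) (hu : ∀ x, u x = u' x) (hv : ∀ x, v x = v' x) :
    Weak a b u' v' := h.congr (Eventually.of_forall hu) (Eventually.of_forall hv)

theorem Weak.add (hb : ContDiff ℝ ∞ b) (h : Weak a b u v) (h' : Weak a b u' v') :
    Weak a b (fun x => u x + u' x) (fun x => v x + v' x) := by
  refine ⟨h.left.add h'.left, h.right.add h'.right, fun ψ hψ hc => ?_⟩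
  have hV := (contDiff_vf (a := a) hb hψ).continuous
  have hVc := hasCompactSupport_vf (a := a) (b := b) hc
  simp only [add_mul]
  rw [integral_add (integrable_mul_test h.left hV hVc) (integrable_mul_test h'.left hV hVc),
    integral_add (integrable_mul_test h.right hψ.continuous hc)
      (integrable_mul_test h'.right hψ.continuous hc), h.eq ψ hψ hc, h'.eq ψ hψ hc]
  ring

theorem Weak.const_mul (m : ℝ) (h : Weak a b u v) :
    Weak a b (fun x => m * u x) (fun x => m * v x) := by
  refine ⟨h.left.smul m, h.right.smul m, fun ψ hψ hc => ?_⟩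
  simp only [mul_assoc]
  rw [integral_const_mul, integral_const_mul, h.eq ψ hψ hc]
  ring

theorem locallyIntegrable_mul (hu : LocallyIntegrable u) {A : ℝ × ℝ → ℝ} (hA : Continuous A) :
    LocallyIntegrable fun x => A x * u x := by
  rw [locallyIntegrable_iff] at hu ⊢
  intro K hK
  exact (hu K hK).continuousOn_mul hA.continuousOn hK

theorem Weak.mul (hb : ContDiff ℝ ∞ b) (h : Weak a b u v) {A : ℝ × ℝ → ℝ} (hA : ContDiff ℝ ∞ A) :
    Weak a b (fun x => A x * u x) (fun x => vf a b A x * u x + A x * v x) := by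
  have hAV := contDiff_vf (a := a) hb hA
  refine ⟨locallyIntegrable_mul h.left hA.continuous,
    (locallyIntegrable_mul h.left hAV.continuous).add (locallyIntegrable_mul h.right hA.continuous),
    fun ψ hψ hc => ?_⟩
  have h1 := h.eq (fun x => A x * ψ x) (hA.mul hψ) hc.mul_left
  simp only [vf_mul hA hψ, mul_add] at h1
  have i1 : Integrable fun x => u x * (vf a b A x * ψ x) :=
    integrable_mul_test h.left (hAV.mul hψ).continuous hc.mul_left
  have i2 : Integrable fun x => u x * (A x * vf a b ψ x) :=
    integrable_mul_test h.left (hA.mul (contDiff_vf hb hψ)).continuous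
      (hasCompactSupport_vf hc).mul_left
  have i3 : Integrable fun x => v x * (A x * ψ x) :=
    integrable_mul_test h.right (hA.mul hψ).continuous hc.mul_left
  rw [integral_add i1 i2] at h1
  have e1 : ∫ x, A x * u x * vf a b ψ x = ∫ x, u x * (A x * vf a b ψ x) :=
    integral_congr_ae (Eventually.of_forall fun x => by simp only; ring)
  have e2 : ∫ x, (vf a b A x * u x + A x * v x) * ψ x
      = (∫ x, u x * (vf a b A x * ψ x)) + ∫ x, v x * (A x * ψ x) := by
    rw [← integral_add i1 i3]
    exact integral_congr_ae (Eventually.of_forall fun x => by simp only; ring)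
  rw [e1, e2]
  linarith

/-- As `b` depends on t alone, b ∂_sψ = ∂_s(bψ), and bψ is again a test function. -/
theorem Weak.field (hb : ContDiff ℝ ∞ b) (ht : WeakT u v) (hs : WeakS u v') :
    Weak 1 b u (fun x => v x + b x.1 * v' x) := by
  have hb' : ContDiff ℝ ∞ fun x : ℝ × ℝ => b x.1 := hb.comp contDiff_fst
  refine ⟨ht.left, ht.right.add (locallyIntegrable_mul hs.right hb'.continuous), fun ψ hψ hc => ?_⟩
  have h2 := hs.eq (fun x => b x.1 * ψ x) (hb'.mul hψ) hc.mul_left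
  have h1 := ht.eq ψ hψ hc
  have hbc : ContDiff ℝ ∞ fun _ : ℝ => (0 : ℝ) := contDiff_const
  have hbc1 : ContDiff ℝ ∞ fun _ : ℝ => (1 : ℝ) := contDiff_const
  have e : ∀ x, vf 1 b ψ x = vf 1 (fun _ => 0) ψ x + vf 0 (fun _ => 1) (fun x => b x.1 * ψ x) x := by
    intro x
    rw [vf_mul hb' hψ, vf_comp_fst hb, vf_eq 1 b]
    ring
  simp only [e, mul_add, add_mul]
  rw [integral_add (integrable_mul_test ht.left (contDiff_vf hbc hψ).continuous
      (hasCompactSupport_vf hc))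
    (integrable_mul_test ht.left (contDiff_vf hbc1 (hb'.mul hψ)).continuous
      (hasCompactSupport_vf hc.mul_left)), h1, h2,
    integral_add (integrable_mul_test ht.right hψ.continuous hc)]
  · rw [neg_add]
    congr 2
    exact integral_congr_ae (Eventually.of_forall fun x => by simp only; ring)
  · exact integrable_mul_test (locallyIntegrable_mul hs.right hb'.continuous) hψ.continuous hc

/-- The coefficients of the field do not depend on s, so ∂_s commutes with it; the equation is
tested on ∂_sψ. -/
theorem Weak.derivS (hb : ContDiff ℝ ∞ b) (h : Weak 1 b u v) (hu : WeakS u u') (hv : WeakS v v') :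
    Weak 1 b u' v' := by
  refine ⟨hu.right, hv.right, fun ψ hψ hc => ?_⟩
  have hbc1 : ContDiff ℝ ∞ fun _ : ℝ => (1 : ℝ) := contDiff_const
  have hψs := contDiff_vf (a := 0) hbc1 hψ
  have hV := contDiff_vf (a := 1) hb hψ
  have h1 := hu.eq _ hV (hasCompactSupport_vf hc)
  have h2 := h.eq _ hψs (hasCompactSupport_vf hc)
  have h3 := hv.eq ψ hψ hc
  have e : ∀ x, vf 0 (fun _ => 1) (vf 1 b ψ) x = vf 1 b (vf 0 (fun _ => 1) ψ) x := by
    intro x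
    have hb' : ContDiff ℝ ∞ fun x : ℝ × ℝ => b x.1 := hb.comp contDiff_fst
    have hψt := contDiff_vf (a := 1) (b := fun _ => 0) contDiff_const hψ
    have : vf 1 b ψ = fun x => vf 1 (fun _ => 0) ψ x + b x.1 * vf 0 (fun _ => 1) ψ x := by
      ext y; rw [vf_eq 1 b]; ring
    rw [this, vf_add hψt (hb'.mul hψs), vf_mul hb' hψs, vf_comp_fst hb,
      vf_eq 1 b (vf 0 (fun _ => 1) ψ), vf_comm_const 0 1 1 0 hψ]
    ring
  simp only [e] at h1
  linarith

/-- The commutator of ∂_t with ∂_t + b∂_s is b'∂_s. It accounts for the extra term, and is why `us`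
must be given. -/
theorem Weak.derivT (hb : ContDiff ℝ ∞ b) {us : ℝ × ℝ → ℝ} (h : Weak 1 b u v) (hu : WeakT u u')
    (hv : WeakT v v') (hs : WeakS u us) :
    Weak 1 b u' (fun x => v' x - deriv b x.1 * us x) := by
  have hdb : ContDiff ℝ ∞ (deriv b) := ((contDiff_infty_iff_deriv (f := b)).1 hb).2
  have hdb' : ContDiff ℝ ∞ fun x : ℝ × ℝ => deriv b x.1 := hdb.comp contDiff_fst
  have hlm := locallyIntegrable_mul hs.right hdb'.continuous
  refine ⟨hu.right, hv.right.sub hlm, fun ψ hψ hc => ?_⟩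
  have hbc0 : ContDiff ℝ ∞ fun _ : ℝ => (0 : ℝ) := contDiff_const
  have hbc1 : ContDiff ℝ ∞ fun _ : ℝ => (1 : ℝ) := contDiff_const
  have hψt := contDiff_vf (a := 1) hbc0 hψ
  have hψs := contDiff_vf (a := 0) hbc1 hψ
  have hV := contDiff_vf (a := 1) hb hψ
  have h1 := hu.eq _ hV (hasCompactSupport_vf hc)
  have h2 := h.eq _ hψt (hasCompactSupport_vf hc)
  have h3 := hv.eq ψ hψ hc
  have h4 := hs.eq (fun x => deriv b x.1 * ψ x) (hdb'.mul hψ) hc.mul_left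
  have hb' : ContDiff ℝ ∞ fun x : ℝ × ℝ => b x.1 := hb.comp contDiff_fst
  have e : ∀ x, vf 1 (fun _ => 0) (vf 1 b ψ) x = vf 1 b (vf 1 (fun _ => 0) ψ) x
      + vf 0 (fun _ => 1) (fun x => deriv b x.1 * ψ x) x := by
    intro x
    have : vf 1 b ψ = fun x => vf 1 (fun _ => 0) ψ x + b x.1 * vf 0 (fun _ => 1) ψ x := by
      ext y; rw [vf_eq 1 b]; ring
    rw [this, vf_add hψt (hb'.mul hψs), vf_mul hb' hψs, vf_comp_fst hb,
      vf_eq 1 b (vf 1 (fun _ => 0) ψ), vf_comm_const 0 1 1 0 hψ, vf_mul hdb' hψ, vf_comp_fst hdb]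
    ring
  simp only [e, mul_add] at h1
  rw [integral_add (integrable_mul_test h.left (contDiff_vf hb hψt).continuous
      (hasCompactSupport_vf (hasCompactSupport_vf hc)))
    (integrable_mul_test h.left (contDiff_vf hbc1 (hdb'.mul hψ)).continuous
      (hasCompactSupport_vf hc.mul_left)), h2, h3, h4] at h1
  simp only [sub_mul]
  rw [integral_sub (integrable_mul_test hv.right hψ.continuous hc)
    (integrable_mul_test hlm hψ.continuous hc)]
  have e3 : ∫ x, deriv b x.1 * us x * ψ x = ∫ x, us x * (deriv b x.1 * ψ x) :=
    integral_congr_ae (Eventually.of_forall fun x => by simp only; ring)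
  rw [e3]
  linarith

end

/-! ### Weak derivatives along horizontal lines -/

/-- Integrability on all horizontal strips of finite height. -/
def Strip (u : ℝ × ℝ → ℝ) : Prop := ∀ N : ℝ, IntegrableOn u (univ ×ˢ Icc (-N) N)

theorem hasDerivAt_integral_shift {w φ φ' : ℝ × ℝ → ℝ} {C : ℝ} (hw : Integrable w)
    (hφ : Continuous φ) (hφ' : Continuous φ') (hb : ∀ z, |φ z| ≤ C) (hb' : ∀ z, |φ' z| ≤ C)
    (hd : ∀ x r, HasDerivAt (fun r => φ (r, x)) (φ' (r, x)) r) (r : ℝ) :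
    HasDerivAt (fun r => ∫ z, w z * φ (z.1 + r, z.2)) (∫ z, w z * φ' (z.1 + r, z.2)) r := by
  have hm : ∀ {χ : ℝ × ℝ → ℝ}, Continuous χ → ∀ r : ℝ,
      AEStronglyMeasurable (fun z : ℝ × ℝ => w z * χ (z.1 + r, z.2)) := fun hχ r =>
    hw.1.mul (hχ.comp (by fun_prop : Continuous fun z : ℝ × ℝ => (z.1 + r, z.2))).aestronglyMeasurable
  refine (hasDerivAt_integral_of_dominated_loc_of_deriv_le (bound := fun z => C * |w z|)
    (F' := fun r z => w z * φ' (z.1 + r, z.2))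
    (s := univ) univ_mem (Eventually.of_forall fun r => hm hφ r) ?_ (hm hφ' r) ?_ ?_ ?_).2
  · refine (hw.abs.const_mul C).mono' (hm hφ r) (Eventually.of_forall fun z => ?_)
    rw [Real.norm_eq_abs, abs_mul, mul_comm]
    gcongr
    exact hb _
  · refine Eventually.of_forall fun z r _ => ?_
    rw [Real.norm_eq_abs, abs_mul, mul_comm]
    gcongr
    exact hb' _
  · exact hw.abs.const_mul C
  · refine Eventually.of_forall fun z r _ => ?_
    have := (hd z.2 (z.1 + r)).comp_const_add z.1 r
    exact this.const_mul _

theorem tendsto_integral_shift {w φ : ℝ × ℝ → ℝ} {C : ℝ} (hw : Integrable w)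
    (hφ : Continuous φ) (hb : ∀ z, |φ z| ≤ C)
    (h0 : ∀ x, ∀ᶠ r in atTop, φ (r, x) = 0) :
    Tendsto (fun r => ∫ z, w z * φ (z.1 + r, z.2)) atTop (𝓝 0) := by
  have := tendsto_integral_filter_of_dominated_convergence (μ := (volume : Measure (ℝ × ℝ)))
    (F := fun (r : ℝ) (z : ℝ × ℝ) => w z * φ (z.1 + r, z.2)) (f := fun _ => 0) (l := atTop)
    (fun z => C * |w z|) (Eventually.of_forall fun r => ?_) (Eventually.of_forall fun r =>
      Eventually.of_forall fun z => ?_) (hw.abs.const_mul C) (Eventually.of_forall fun z => ?_)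
  · simpa using this
  · exact hw.1.mul (hφ.comp (by fun_prop : Continuous fun z : ℝ × ℝ => (z.1 + r, z.2))).aestronglyMeasurable
  · rw [Real.norm_eq_abs, abs_mul, mul_comm]
    gcongr
    exact hb _
  · refine tendsto_const_nhds.congr' ?_
    have := tendsto_atTop_add_const_left atTop z.1 tendsto_id
    filter_upwards [this.eventually (h0 z.2)] with r hr
    simp only [id] at hr
    rw [hr, mul_zero]

theorem ae_swap {P : ℝ × ℝ → Prop} (h : ∀ᵐ z, P z) : ∀ᵐ x : ℝ, ∀ᵐ t : ℝ, P (t, x) := by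
  have := (Measure.measurePreserving_swap (μ := (volume : Measure ℝ)) (ν := volume)).quasiMeasurePreserving.ae h
  exact Measure.ae_ae_of_ae_prod this

theorem strip_restrict (N : ℝ) : (volume : Measure (ℝ × ℝ)).restrict (univ ×ˢ Icc (-N) N)
    = (volume : Measure ℝ).prod (volume.restrict (Icc (-N) N)) := by
  rw [Measure.volume_eq_prod, ← Measure.prod_restrict, Measure.restrict_univ]

theorem Strip.slice {w : ℝ × ℝ → ℝ} (hw : Strip w) : ∀ᵐ x : ℝ, Integrable fun t => w (t, x) := by
  have h : ∀ n : ℕ, ∀ᵐ x : ℝ, x ∈ Icc (-(n : ℝ)) n → Integrable fun t => w (t, x) := by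
    intro n
    have := hw n
    rw [IntegrableOn, strip_restrict] at this
    exact (ae_restrict_iff' measurableSet_Icc).1 this.prod_left_ae
  filter_upwards [ae_all_iff.2 h] with x hx
  obtain ⟨n, hn⟩ := exists_nat_ge |x|
  exact hx n ⟨by linarith [neg_abs_le x], by linarith [le_abs_self x]⟩

theorem integral_primitive_mul {v ψ : ℝ → ℝ} (hv : Integrable v) (hψ : Integrable ψ) :
    ∫ t, v t * ∫ r in Ioi t, ψ r = ∫ r, (∫ t in Iio r, v t) * ψ r := by
  have hi : Integrable (fun z : ℝ × ℝ => {z : ℝ × ℝ | z.1 < z.2}.indicator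
      (fun z => v z.1 * ψ z.2) z) (volume.prod volume) :=
    (hv.mul_prod hψ).indicator (measurableSet_lt measurable_fst measurable_snd)
  have h := integral_integral_swap (f := fun t r => {z : ℝ × ℝ | z.1 < z.2}.indicator
      (fun z => v z.1 * ψ z.2) (t, r)) hi
  have e1 : ∀ t, ∫ r, {z : ℝ × ℝ | z.1 < z.2}.indicator (fun z => v z.1 * ψ z.2) (t, r)
      = v t * ∫ r in Ioi t, ψ r := by
    intro t
    rw [← integral_const_mul, ← integral_indicator measurableSet_Ioi]
    rfl
  have e2 : ∀ r, ∫ t, {z : ℝ × ℝ | z.1 < z.2}.indicator (fun z => v z.1 * ψ z.2) (t, r)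
      = (∫ t in Iio r, v t) * ψ r := by
    intro r
    rw [← integral_mul_const, ← integral_indicator measurableSet_Iio]
    rfl
  simpa only [e1, e2] using h

theorem exists_box {ψ : ℝ × ℝ → ℝ} (hc : HasCompactSupport ψ) :
    ∃ N : ℝ, 0 < N ∧ ∀ z, ψ z ≠ 0 → |z.1| ≤ N ∧ |z.2| ≤ N := by
  obtain ⟨R, hR⟩ := hc.isBounded.subset_closedBall 0
  refine ⟨max R 1, by positivity, fun z hz => ?_⟩
  have h := hR (subset_tsupport ψ hz)
  rw [mem_closedBall_zero_iff] at h
  have h1 := norm_fst_le z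
  have h2 := norm_snd_le z
  rw [Real.norm_eq_abs] at h1 h2
  exact ⟨h1.trans (h.trans (le_max_left _ _)), h2.trans (h.trans (le_max_left _ _))⟩

/-- The primitive Ψ of ψ is the test function wanted, but it is not compactly supported towards −∞.
Instead both integrals are followed under the translation t ↦ t + r: the weak equation for
translates of ψ shows that their difference is constant in r, and both vanish as r → ∞ because the
supports of ψ and Ψ are bounded on the right. -/
theorem integral_test_eq {u v ψ : ℝ × ℝ → ℝ} (h : WeakT u v) (hu : Strip u) (hv : Strip v)
    (hψ : ContDiff ℝ ∞ ψ) (hc : HasCompactSupport ψ) :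
    (Integrable fun z : ℝ × ℝ => v z * ∫ r in Ioi z.1, ψ (r, z.2)) ∧
    ∫ z, u z * ψ z = ∫ z, v z * ∫ r in Ioi z.1, ψ (r, z.2) := by
  obtain ⟨N, hN0, hN⟩ := exists_box hc
  set ψt := vf 1 (fun _ => 0) ψ with hψt
  have hψts : ContDiff ℝ ∞ ψt := contDiff_vf contDiff_const hψ
  have hψtc : HasCompactSupport ψt := hasCompactSupport_vf hc
  obtain ⟨N', hN0', hN'⟩ := exists_box hψtc
  set M := max N N' with hM
  have hMN : N ≤ M := le_max_left _ _
  have hMN' : N' ≤ M := le_max_right _ _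
  have hz : ∀ z : ℝ × ℝ, (M < |z.1| ∨ M < |z.2|) → ψ z = 0 := by
    intro z h
    by_contra h0
    obtain ⟨h1, h2⟩ := hN z h0
    rcases h with h | h <;> linarith
  have hzt : ∀ z : ℝ × ℝ, (M < |z.1| ∨ M < |z.2|) → ψt z = 0 := by
    intro z h
    by_contra h0
    obtain ⟨h1, h2⟩ := hN' z h0
    rcases h with h | h <;> linarith
  obtain ⟨C₁, hC₁⟩ := hψ.continuous.bounded_above_of_compact_support hc
  obtain ⟨C₂, hC₂⟩ := hψts.continuous.bounded_above_of_compact_support hψtc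
  set Ψ : ℝ × ℝ → ℝ := fun z => ∫ r in Ioi z.1, ψ (r, z.2) with hΨ
  have hψx : ∀ x, Continuous fun r => ψ (r, x) := fun x => hψ.continuous.comp (by fun_prop)
  have hψi : ∀ x, Integrable fun r => ψ (r, x) := fun x => by
    refine (hψx x).integrable_of_hasCompactSupport ?_
    refine HasCompactSupport.intro (isCompact_Icc (a := -M) (b := M)) fun r hr => hz _ (Or.inl ?_)
    by_contra hh
    exact hr (abs_le.1 (not_lt.1 hh))
  have hΨeq : ∀ z, Ψ z = ∫ r in z.1..M + 1, ψ (r, z.2) := by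
    intro z
    have h1 := intervalIntegral.integral_Ioi_sub_Ioi' (μ := volume) (f := fun r => ψ (r, z.2)) (a := z.1) (b := M + 1)
      (hψi z.2).integrableOn (hψi z.2).integrableOn
    have h2 : ∫ r in Ioi (M + 1), ψ (r, z.2) = 0 := by
      refine setIntegral_eq_zero_of_forall_eq_zero fun r (hr : M + 1 < r) => hz _ (Or.inl ?_)
      exact lt_of_lt_of_le (by linarith) (le_abs_self r)
    simp only [hΨ]
    linarith
  have hΨc : Continuous Ψ := by
    have : Ψ = fun z : ℝ × ℝ => -∫ r in (M + 1)..z.1, ψ (r, z.2) := by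
      ext z; rw [hΨeq, intervalIntegral.integral_symm]
    rw [this]
    exact (intervalIntegral.continuous_parametric_intervalIntegral_of_continuous
      (f := fun (z : ℝ × ℝ) r => ψ (r, z.2)) (hψ.continuous.comp (by fun_prop)) continuous_fst).neg
  have hΨd : ∀ x r, HasDerivAt (fun r => Ψ (r, x)) (-ψ (r, x)) r := by
    intro x r
    have : (fun r => Ψ (r, x)) = fun r => -∫ r in (M + 1)..r, ψ (r, x) := by
      ext z; rw [hΨeq, intervalIntegral.integral_symm]
    rw [this]
    exact ((hψx x).integral_hasStrictDerivAt (M + 1) r).hasDerivAt.neg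
  have hΨb : ∀ z, |Ψ z| ≤ C₁ * (2 * M) := by
    intro z
    have e : Ψ z = ∫ r in Icc (-M) M, (Ioi z.1).indicator (fun r => ψ (r, z.2)) r := by
      simp only [hΨ]
      rw [← integral_indicator measurableSet_Ioi, ← integral_indicator measurableSet_Icc]
      congr 1
      ext r
      by_cases hr : r ∈ Icc (-M) M
      · rw [indicator_of_mem hr]
      · rw [indicator_of_notMem hr]
        have : ψ (r, z.2) = 0 := hz _ (Or.inl (by
          by_contra hh
          exact hr (abs_le.1 (not_lt.1 hh))))
        simp [indicator, this]
    rw [e]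
    have := norm_setIntegral_le_of_norm_le_const (μ := (volume : Measure ℝ)) (s := Icc (-M) M) (C := C₁)
      (f := (Ioi z.1).indicator (fun r => ψ (r, z.2))) (by simp) (fun r _ =>
        (norm_indicator_le_norm_self _ _).trans (hC₁ _))
    simpa [Real.volume_real_Icc_of_le (show -M ≤ M by linarith), ← two_mul] using this
  have hΨz : ∀ z : ℝ × ℝ, M < |z.2| → Ψ z = 0 := by
    intro z h
    simp only [hΨ]
    exact setIntegral_eq_zero_of_forall_eq_zero fun r _ => hz _ (Or.inr h)
  -- On this strip `u` and `v` are integrable, and ψ, its derivative and Ψ vanish outside it, so the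
  -- truncation changes no integral.
  set S : Set (ℝ × ℝ) := univ ×ˢ Icc (-M) M with hS
  have hSm : MeasurableSet S := MeasurableSet.univ.prod measurableSet_Icc
  have hind : ∀ (w φ : ℝ × ℝ → ℝ), (∀ z : ℝ × ℝ, M < |z.2| → φ z = 0) → ∀ r,
      (fun z : ℝ × ℝ => S.indicator w z * φ (z.1 + r, z.2)) = fun z => w z * φ (z.1 + r, z.2) := by
    intro w φ h r
    ext z
    by_cases hzS : z ∈ S
    · rw [indicator_of_mem hzS]
    · have : φ (z.1 + r, z.2) = 0 := h _ (by
        by_contra hh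
        exact hzS ⟨mem_univ _, abs_le.1 (not_lt.1 hh)⟩)
      rw [this, mul_zero, mul_zero]
  have hui : Integrable (S.indicator u) := (integrable_indicator_iff hSm).2 (hu M)
  have hvi : Integrable (S.indicator v) := (integrable_indicator_iff hSm).2 (hv M)
  set C := max (max C₁ C₂) (C₁ * (2 * M)) with hC
  have hψtd : ∀ x r, HasDerivAt (fun r => ψ (r, x)) (ψt (r, x)) r := by
    intro x r
    have h1 := (hψ.differentiable (by simp) (r, x)).hasFDerivAt
    have h2 : HasDerivAt (fun r : ℝ => (r, x)) ((1 : ℝ), (0 : ℝ)) r :=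
      (hasDerivAt_id r).prodMk (hasDerivAt_const r x)
    exact h1.comp_hasDerivAt r h2
  have hfar : ∀ {φ : ℝ × ℝ → ℝ}, (∀ z : ℝ × ℝ, M < z.1 → φ z = 0) → ∀ x, ∀ᶠ r in atTop, φ (r, x) = 0 :=
    fun h x => (eventually_gt_atTop M).mono fun r hr => h _ hr
  have d1 := hasDerivAt_integral_shift hui hψ.continuous hψts.continuous (C := C)
    (fun z => (hC₁ z).trans ((le_max_left _ _).trans (le_max_left _ _)))
    (fun z => (hC₂ z).trans ((le_max_right _ _).trans (le_max_left _ _))) hψtd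
  have d2 := hasDerivAt_integral_shift hvi hΨc (φ' := fun z => -ψ z) hψ.continuous.neg (C := C)
    (fun z => (hΨb z).trans (le_max_right _ _))
    (fun z => by rw [abs_neg]; exact (hC₁ z).trans ((le_max_left _ _).trans (le_max_left _ _))) hΨd
  have t1 := tendsto_integral_shift hui hψ.continuous (C := C)
    (fun z => (hC₁ z).trans ((le_max_left _ _).trans (le_max_left _ _)))
    (hfar fun z hz' => hz z (Or.inl (hz'.trans_le (le_abs_self _))))
  have t2 := tendsto_integral_shift hvi hΨc (C := C) (fun z => (hΨb z).trans (le_max_right _ _))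
    (hfar fun z hz' => setIntegral_eq_zero_of_forall_eq_zero fun r (hr : z.1 < r) =>
      hz _ (Or.inl ((hz'.trans hr).trans_le (le_abs_self _))))
  simp only [hind u ψ fun z h => hz z (Or.inr h), hind u ψt fun z h => hzt z (Or.inr h)] at d1 t1
  simp only [hind v Ψ hΨz, hind v (fun z => -ψ z) fun z h => by rw [hz z (Or.inr h), neg_zero]] at d2 t2
  have hshift : ∀ r, ∫ z : ℝ × ℝ, u z * ψt (z.1 + r, z.2) = ∫ z : ℝ × ℝ, v z * -ψ (z.1 + r, z.2) := by
    intro r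
    let T : ℝ × ℝ → ℝ × ℝ := fun z => z + (r, 0)
    have hTs : ContDiff ℝ ∞ T := contDiff_id.add contDiff_const
    have h1 := h.eq (ψ ∘ T) (hψ.comp hTs) (hc.comp_homeomorph (Homeomorph.addRight (r, (0 : ℝ))))
    have e : ∀ z : ℝ × ℝ, vf 1 (fun _ => 0) (ψ ∘ T) z = ψt (z.1 + r, z.2) := by
      intro z
      rw [vf, show ψ ∘ T = fun z => ψ (z + (r, 0)) from rfl, fderiv_comp_add_right]
      simp [hψt, vf, Prod.add_def]
    simp only [e] at h1
    rw [h1, ← integral_neg]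
    refine integral_congr_ae (Eventually.of_forall fun z => ?_)
    simp [T, Prod.add_def]
  have hconst : ∀ r, HasDerivAt (fun r => (∫ z : ℝ × ℝ, u z * ψ (z.1 + r, z.2))
      - ∫ z : ℝ × ℝ, v z * Ψ (z.1 + r, z.2)) 0 r := by
    intro r
    have := (d1 r).sub (d2 r)
    rwa [hshift, sub_self] at this
  have hd := is_const_of_deriv_eq_zero (fun r => (hconst r).differentiableAt)
    fun r => (hconst r).deriv
  have t3 := t1.sub t2
  rw [sub_zero] at t3
  have h0 := tendsto_nhds_unique (t3.congr fun r => hd r 0) tendsto_const_nhds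
  simp only [add_zero, Prod.mk.eta] at h0
  constructor
  · have : Integrable fun z => S.indicator v z * Ψ z := by
      refine (hvi.abs.const_mul C).mono' (hvi.1.mul hΨc.aestronglyMeasurable)
        (Eventually.of_forall fun z => ?_)
      rw [Real.norm_eq_abs, abs_mul, mul_comm]
      gcongr
      exact (hΨb z).trans (le_max_right _ _)
    have e := hind v Ψ hΨz 0
    simp only [add_zero, Prod.mk.eta] at e
    rwa [e] at this
  · linarith

theorem Strip.congr {u v : ℝ × ℝ → ℝ} (hu : Strip u) (h : u =ᵐ[volume] v) : Strip v := fun N =>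
  (hu N).congr (ae_restrict_of_ae h)

theorem Strip.locallyIntegrable {U : ℝ × ℝ → ℝ} {v : ℝ × ℝ → ℝ} (hv : Strip v)
    (hU : AEStronglyMeasurable U) (h : ∀ᵐ x : ℝ, ∀ t, |U (t, x)| ≤ ∫ r, |v (r, x)|) :
    LocallyIntegrable U := by
  rw [locallyIntegrable_iff]
  intro K hK
  obtain ⟨R, hR⟩ := hK.isBounded.subset_closedBall 0
  have hsub : K ⊆ Icc (-R) R ×ˢ Icc (-R) R := by
    intro z hz
    have h := hR hz
    rw [mem_closedBall_zero_iff] at h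
    have h1 := (norm_fst_le z).trans h
    have h2 := (norm_snd_le z).trans h
    exact ⟨abs_le.1 h1, abs_le.1 h2⟩
  refine IntegrableOn.mono_set ?_ hsub
  have hvi := hv R
  rw [IntegrableOn, strip_restrict] at hvi
  have hg := hvi.integral_norm_prod_right
  have hg2 := hg.comp_snd (volume.restrict (Icc (-R) R))
  rw [IntegrableOn, Measure.volume_eq_prod, ← Measure.prod_restrict]
  refine hg2.mono' ?_ ?_
  · rw [Measure.prod_restrict, ← Measure.volume_eq_prod]
    exact hU.restrict
  · have := (Measure.quasiMeasurePreserving_snd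
      (μ := (volume : Measure ℝ).restrict (Icc (-R) R))
      (ν := (volume : Measure ℝ).restrict (Icc (-R) R))).ae (ae_restrict_of_ae h)
    filter_upwards [this] with z hz using hz z.1

/-- By Fubini the right side of `integral_test_eq` is the integral of ψ against the primitive of
`v`, so `u` and that primitive agree as distributions. The measurable representative makes the
primitive jointly measurable. -/
theorem weak_plane {u v : ℝ × ℝ → ℝ} (h : WeakT u v) (hu : Strip u) (hv : Strip v) :
    ∃ v' : ℝ × ℝ → ℝ, v =ᵐ[volume] v' ∧ ∀ᵐ z : ℝ × ℝ, u z = ∫ r in Iic z.1, v' (r, z.2) := by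
  have hvm : AEStronglyMeasurable v := h.right.aestronglyMeasurable
  set v' := hvm.mk v with hv'
  have hvv : v =ᵐ[volume] v' := hvm.ae_eq_mk
  have hsm : StronglyMeasurable v' := hvm.stronglyMeasurable_mk
  have h' : WeakT u v' := h.congr (EventuallyEq.refl _ _) hvv
  have hs' : Strip v' := hv.congr hvv
  set U : ℝ × ℝ → ℝ := fun z => ∫ r in Iic z.1, v' (r, z.2) with hU
  have hUm : StronglyMeasurable U := by
    have e : U = fun z => ∫ r, {w : (ℝ × ℝ) × ℝ | w.2 ≤ w.1.1}.indicator
        (fun w => v' (w.2, w.1.2)) (z, r) := by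
      ext z
      simp only [hU]
      rw [← integral_indicator measurableSet_Iic]
      rfl
    rw [e]
    refine StronglyMeasurable.integral_prod_right' ?_
    exact (hsm.comp_measurable (by fun_prop)).indicator
      (measurableSet_le measurable_snd (by fun_prop))
  have hbd : ∀ᵐ x : ℝ, ∀ t, |U (t, x)| ≤ ∫ r, |v' (r, x)| := by
    filter_upwards [hs'.slice] with x hx t
    calc |U (t, x)| ≤ ∫ r in Iic t, |v' (r, x)| :=
          norm_integral_le_integral_norm (fun r => v' (r, x))
      _ ≤ _ := setIntegral_le_integral hx.abs (Eventually.of_forall fun r => abs_nonneg _)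
  have hUl : LocallyIntegrable U := hs'.locallyIntegrable hUm.aestronglyMeasurable hbd
  have key : ∀ᵐ z, u z = U z := by
    refine ae_eq_of_integral_contDiff_smul_eq h.left hUl fun ψ hψ hc => ?_
    obtain ⟨hi, he⟩ := integral_test_eq h' hu hs' hψ hc
    simp only [smul_eq_mul, mul_comm (ψ _)]
    rw [he, Measure.volume_eq_prod, integral_prod_symm _ hi,
      integral_prod_symm _ (integrable_mul_test hUl hψ.continuous hc)]
    refine integral_congr_ae ?_
    filter_upwards [hs'.slice] with x hx
    have hψx : Integrable fun r => ψ (r, x) := by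
      obtain ⟨N, hN0, hN⟩ := exists_box hc
      refine Continuous.integrable_of_hasCompactSupport (hψ.continuous.comp (by fun_prop)) ?_
      refine HasCompactSupport.intro (isCompact_Icc (a := -N) (b := N)) fun r hr => ?_
      by_contra h0
      exact hr (abs_le.1 (hN _ h0).1)
    have := integral_primitive_mul hx hψx
    simp only [← integral_Iic_eq_integral_Iio] at this
    exact this
  exact ⟨v', hvv, key⟩

theorem weak_lines {u v : ℝ × ℝ → ℝ} (h : WeakT u v) (hu : Strip u) (hv : Strip v) :
    ∀ᵐ x : ℝ, ∀ᵐ t : ℝ, u (t, x) = ∫ r in Iic t, v (r, x) := by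
  obtain ⟨v', hvv, key⟩ := weak_plane h hu hv
  filter_upwards [ae_swap key, ae_swap hvv] with x hx hx'
  filter_upwards [hx] with t ht
  rw [ht]
  exact (setIntegral_congr_ae measurableSet_Iic (hx'.mono fun r hr _ => hr)).symm

/-- The energy identity along horizontal lines. -/
theorem energy_weakT {u v ρ : ℝ × ℝ → ℝ} (h : WeakT u v) (hu : Strip u) (hv : Strip v)
    (hρ : ContDiff ℝ ∞ ρ) (h1 : Integrable fun z => u z ^ 2 * ρ z)
    (h2 : Integrable fun z => 2 * u z * v z * ρ z + u z ^ 2 * vf 1 (fun _ => 0) ρ z) :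
    ∫ z, (2 * u z * v z * ρ z + u z ^ 2 * vf 1 (fun _ => 0) ρ z) = 0 := by
  rw [Measure.volume_eq_prod, integral_prod_symm _ h2]
  refine integral_eq_zero_of_ae ?_
  filter_upwards [weak_lines h hu hv, hv.slice, h1.prod_left_ae, h2.prod_left_ae] with x hx hvx i1 i2
  have hρx : ContDiff ℝ 1 fun t => ρ (t, x) :=
    (hρ.of_le (by exact_mod_cast le_top)).comp (contDiff_id.prodMk contDiff_const)
  have hd : ∀ t, deriv (fun t => ρ (t, x)) t = vf 1 (fun _ => 0) ρ (t, x) := by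
    intro t
    have h1 := (hρ.differentiable (by simp) (t, x)).hasFDerivAt
    have h2 : HasDerivAt (fun r : ℝ => (r, x)) ((1 : ℝ), (0 : ℝ)) t :=
      (hasDerivAt_id t).prodMk (hasDerivAt_const t x)
    exact (h1.comp_hasDerivAt t h2).deriv
  have e : ∀ᵐ t, 2 * u (t, x) * v (t, x) * ρ (t, x) + u (t, x) ^ 2 * vf 1 (fun _ => 0) ρ (t, x)
      = 2 * (∫ r in Iic t, v (r, x)) * v (t, x) * ρ (t, x)
        + (∫ r in Iic t, v (r, x)) ^ 2 * deriv (fun t => ρ (t, x)) t := by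
    filter_upwards [hx] with t ht
    rw [hd, ← ht]
  have := energy_line hvx hρx (i1.congr (hx.mono fun t ht => by simp only [ht])) (i2.congr e)
  rw [integral_congr_ae e, this]
  rfl

/-! ### Straightening the field by a shear -/

/-- The shear `(t, x) ↦ (t, x + a(t))`. -/
def shear (a : ℝ → ℝ) (ha : Continuous a) : (ℝ × ℝ) ≃ₜ (ℝ × ℝ) where
  toFun z := (z.1, z.2 + a z.1)
  invFun z := (z.1, z.2 - a z.1)
  left_inv z := by simp
  right_inv z := by simp
  continuous_toFun := by fun_prop
  continuous_invFun := by fun_prop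

theorem measurePreserving_shear {a : ℝ → ℝ} (ha : Continuous a) :
    MeasurePreserving (shear a ha) := by
  have := MeasurePreserving.skew_product (μa := (volume : Measure ℝ)) (μb := volume)
    (μc := (volume : Measure ℝ)) (μd := volume)
    (MeasurePreserving.id volume) (g := fun t x => x + a t) (by
      exact (by fun_prop : Continuous fun z : ℝ × ℝ => z.2 + a z.1).measurable)
    (Eventually.of_forall fun t => (measurePreserving_add_right volume (a t)).map_eq)
  exact this

theorem vf_shear {a : ℝ → ℝ} (ha : ContDiff ℝ ∞ a) {ψ : ℝ × ℝ → ℝ} (hψ : ContDiff ℝ ∞ ψ)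
    (z : ℝ × ℝ) : vf 1 (fun _ => 0) (fun z => ψ (z.1, z.2 + a z.1)) z
      = vf 1 (deriv a) ψ (z.1, z.2 + a z.1) := by
  have h0 : HasFDerivAt (fun x : ℝ × ℝ => x.1) (ContinuousLinearMap.fst ℝ ℝ ℝ) z := hasFDerivAt_fst
  have h0' : HasFDerivAt (fun x : ℝ × ℝ => x.2) (ContinuousLinearMap.snd ℝ ℝ ℝ) z := hasFDerivAt_snd
  have h1 := (ha.differentiable (by simp) z.1).hasDerivAt.comp_hasFDerivAt z h0
  have h2 := h0.prodMk (h0'.add h1)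
  have h3 := ((hψ.differentiable (by simp) (z.1, z.2 + a z.1)).hasFDerivAt.comp z h2).fderiv
  have h3' : fderiv ℝ (fun z : ℝ × ℝ => ψ (z.1, z.2 + a z.1)) z = _ := h3
  rw [vf, h3', vf]
  simp

theorem vf_unshear {a : ℝ → ℝ} (ha : ContDiff ℝ ∞ a) {ψ : ℝ × ℝ → ℝ} (hψ : ContDiff ℝ ∞ ψ)
    (z : ℝ × ℝ) : vf 1 (deriv a) (fun z => ψ (z.1, z.2 - a z.1)) z
      = vf 1 (fun _ => 0) ψ (z.1, z.2 - a z.1) := by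
  have h0 : HasFDerivAt (fun x : ℝ × ℝ => x.1) (ContinuousLinearMap.fst ℝ ℝ ℝ) z := hasFDerivAt_fst
  have h0' : HasFDerivAt (fun x : ℝ × ℝ => x.2) (ContinuousLinearMap.snd ℝ ℝ ℝ) z := hasFDerivAt_snd
  have h1 := (ha.differentiable (by simp) z.1).hasDerivAt.comp_hasFDerivAt z h0
  have h2 := h0.prodMk (h0'.sub h1)
  have h3 := ((hψ.differentiable (by simp) (z.1, z.2 - a z.1)).hasFDerivAt.comp z h2).fderiv
  have h3' : fderiv ℝ (fun z : ℝ × ℝ => ψ (z.1, z.2 - a z.1)) z = _ := h3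
  rw [vf, h3', vf]
  simp

theorem Weak.shear {a : ℝ → ℝ} (ha : ContDiff ℝ ∞ a) {u v : ℝ × ℝ → ℝ}
    (h : Weak 1 (deriv a) u v) :
    WeakT (fun z => u (z.1, z.2 + a z.1)) (fun z => v (z.1, z.2 + a z.1)) := by
  have hc := ha.continuous
  have hmp := measurePreserving_shear hc
  have hl : ∀ {w : ℝ × ℝ → ℝ}, LocallyIntegrable w → LocallyIntegrable fun z : ℝ × ℝ => w (z.1, z.2 + a z.1) := by
    intro w hw
    rw [← hmp.map_eq] at hw
    exact (locallyIntegrable_map_homeomorph (LogPlane.shear a hc)).1 hw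
  refine ⟨hl h.left, hl h.right, fun ψ hψ hψc => ?_⟩
  have hφ : ContDiff ℝ ∞ fun z : ℝ × ℝ => ψ (z.1, z.2 - a z.1) :=
    hψ.comp (contDiff_fst.prodMk (contDiff_snd.sub (ha.comp contDiff_fst)))
  have h1 := h.eq _ hφ (hψc.comp_homeomorph (LogPlane.shear a hc).symm)
  simp only [vf_unshear ha hψ] at h1
  have hme := (LogPlane.shear a hc).measurableEmbedding
  have e : ∀ F : ℝ × ℝ → ℝ, ∫ z, F z = ∫ z : ℝ × ℝ, F (z.1, z.2 + a z.1) := fun F =>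
    (hmp.integral_comp hme F).symm
  rw [e (fun z => u z * _), e (fun z => v z * _)] at h1
  simpa only [add_sub_cancel_right] using h1

/-- The shear preserves measure and carries ∂_t to ∂_t + a'∂_s. Integrability on strips is asked of
the sheared functions because these are the ones restricted to horizontal lines. -/
theorem energy_shear {a : ℝ → ℝ} (ha : ContDiff ℝ ∞ a) {u v ρ : ℝ × ℝ → ℝ}
    (h : Weak 1 (deriv a) u v)
    (hu : Strip fun z => u (z.1, z.2 + a z.1)) (hv : Strip fun z => v (z.1, z.2 + a z.1))
    (hρ : ContDiff ℝ ∞ ρ) (h1 : Integrable fun z => u z ^ 2 * ρ z)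
    (h2 : Integrable fun z => 2 * u z * v z * ρ z + u z ^ 2 * vf 1 (deriv a) ρ z) :
    ∫ z, (2 * u z * v z * ρ z + u z ^ 2 * vf 1 (deriv a) ρ z) = 0 := by
  have hc := ha.continuous
  have hmp := measurePreserving_shear hc
  have hme := (LogPlane.shear a hc).measurableEmbedding
  have hρ' : ContDiff ℝ ∞ fun z : ℝ × ℝ => ρ (z.1, z.2 + a z.1) :=
    hρ.comp (contDiff_fst.prodMk (contDiff_snd.add (ha.comp contDiff_fst)))
  have := energy_weakT (h.shear ha) hu hv hρ' ((hmp.integrable_comp_emb hme).2 h1) (by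
    simp only [vf_shear ha hρ]
    exact (hmp.integrable_comp_emb hme).2 h2)
  simp only [vf_shear ha hρ] at this
  rw [← this]
  exact (hmp.integral_comp hme _).symm

/-! ### The weights -/

/-- The weight in the plane with angular part `cosh^κ`. -/
def wt (κ : ℝ) (z : ℝ × ℝ) : ℝ := p z.1 * Real.cosh z.2 ^ κ

abbrev νw (κ : ℝ) : Measure (ℝ × ℝ) := wmeas volume (wt κ)

theorem wt_pos (κ : ℝ) (z : ℝ × ℝ) : 0 < wt κ z :=
  mul_pos (p_pos _) (Real.rpow_pos_of_pos (Real.cosh_pos _) _)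

theorem contDiff_cosh_rpow (κ : ℝ) : ContDiff ℝ ∞ fun s : ℝ => Real.cosh s ^ κ :=
  Real.contDiff_cosh.rpow_const_of_ne fun s => (Real.cosh_pos s).ne'

theorem contDiff_wt (κ : ℝ) : ContDiff ℝ ∞ (wt κ) :=
  (contDiff_p.comp contDiff_fst).mul ((contDiff_cosh_rpow κ).comp contDiff_snd)

theorem measurable_wt (κ : ℝ) : Measurable (wt κ) := (contDiff_wt κ).continuous.measurable

theorem deriv_cosh_rpow (κ s : ℝ) :
    deriv (fun s : ℝ => Real.cosh s ^ κ) s = Real.cosh s ^ κ * (κ * Real.tanh s) := by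
  have h := (Real.hasDerivAt_cosh s).rpow_const (p := κ) (Or.inl (Real.cosh_pos s).ne')
  rw [h.deriv, Real.rpow_sub_one (Real.cosh_pos s).ne', Real.tanh_eq_sinh_div_cosh]
  ring

theorem vf_wt (b : ℝ → ℝ) (κ : ℝ) (z : ℝ × ℝ) :
    vf 1 b (wt κ) z = wt κ z * (1 - 4 * q z.1 + b z.1 * (κ * Real.tanh z.2)) := by
  have h := vf_mul (a := 1) (b := b) (A := fun z : ℝ × ℝ => p z.1)
    (ψ := fun z : ℝ × ℝ => Real.cosh z.2 ^ κ) (contDiff_p.comp contDiff_fst)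
    ((contDiff_cosh_rpow κ).comp contDiff_snd) z
  rw [vf_comp_fst contDiff_p, vf_comp_snd (contDiff_cosh_rpow κ), deriv_p, deriv_cosh_rpow] at h
  rw [show wt κ = fun z : ℝ × ℝ => p z.1 * Real.cosh z.2 ^ κ from rfl, h]
  ring

theorem exp_abs_le_two_cosh (s : ℝ) : Real.exp |s| ≤ 2 * Real.cosh s := by
  rw [← Real.cosh_abs, Real.cosh_eq]
  have := Real.exp_pos (-|s|)
  linarith

theorem cosh_le_exp_abs (s : ℝ) : Real.cosh s ≤ Real.exp |s| := by
  rw [← Real.cosh_abs, Real.cosh_eq]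
  have : Real.exp (-|s|) ≤ Real.exp |s| := Real.exp_le_exp.2 (by linarith [abs_nonneg s])
  linarith

theorem exp_le_cosh_rpow {κ : ℝ} (hκ : |κ| ≤ 1 / 100) (s : ℝ) :
    Real.exp (-(1 / 100) * |s|) ≤ Real.cosh s ^ κ := by
  have h1 : (1 : ℝ) ≤ Real.cosh s := Real.one_le_cosh s
  calc Real.exp (-(1 / 100) * |s|) = Real.exp |s| ^ (-(1 / 100) : ℝ) := by
        rw [← Real.exp_mul]; ring_nf
    _ ≤ Real.cosh s ^ (-(1 / 100) : ℝ) :=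
        Real.rpow_le_rpow_of_nonpos (by linarith) (cosh_le_exp_abs s) (by norm_num)
    _ ≤ Real.cosh s ^ κ := Real.rpow_le_rpow_of_exponent_le h1 (by linarith [neg_abs_le κ])

/-- Along the sheared line s = x + a(t) the angular factor loses at most e^{(|x| + 6|t|)/100}, while
p ≥ e^{|t|}. Since 6/100 < 1/2, the reciprocal of the weight is integrable on strips, and
`integrable_of_sq_mul` applies. -/
theorem strip_of_memLp {κ : ℝ} (hκ : |κ| ≤ 1 / 100) {a : ℝ → ℝ} (hac : Continuous a)
    (ha : ∀ t, |a t| ≤ 6 * |t|) {u : ℝ × ℝ → ℝ} (hu : MemLp u 2 (νw κ)) :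
    Strip fun z => u (z.1, z.2 + a z.1) := by
  intro N
  have hmp := measurePreserving_shear hac
  have hme := (shear a hac).measurableEmbedding
  obtain ⟨h1, h2⟩ := (memLp_wmeas (measurable_wt κ) (wt_pos κ)).1 hu
  have h3 : Integrable fun z : ℝ × ℝ => u (z.1, z.2 + a z.1) ^ 2 * wt κ (z.1, z.2 + a z.1) :=
    (hmp.integrable_comp_emb hme).2 h2
  have h4 : AEStronglyMeasurable fun z : ℝ × ℝ => u (z.1, z.2 + a z.1) :=
    h1.comp_quasiMeasurePreserving hmp.quasiMeasurePreserving
  refine integrable_of_sq_mul (r := fun z => wt κ (z.1, z.2 + a z.1)) (fun z => wt_pos κ _) ?_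
    h4.restrict h3.integrableOn
  rw [strip_restrict]
  have hk : Integrable (fun z : ℝ × ℝ => kern z.1 * Real.exp (1 / 100 * |z.2|))
      ((volume : Measure ℝ).prod (volume.restrict (Icc (-N) N))) := by
    refine integrable_kern.mul_prod (Continuous.integrableOn_Icc
      (by fun_prop : Continuous fun x : ℝ => Real.exp (1 / 100 * |x|)))
  refine hk.mono' ?_ (Eventually.of_forall fun z => ?_)
  · refine Continuous.aestronglyMeasurable (Continuous.inv₀ ?_ fun z => (wt_pos κ _).ne')
    exact (contDiff_wt κ).continuous.comp (by fun_prop)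
  · rw [Real.norm_eq_abs, abs_of_pos (inv_pos.2 (wt_pos _ _))]
    have e : kern z.1 * Real.exp (1 / 100 * |z.2|)
        = (Real.exp (1 / 2 * |z.1| - 1 / 100 * |z.2|))⁻¹ := by
      rw [kern, ← Real.exp_add, ← Real.exp_neg]; ring_nf
    rw [e]
    refine inv_anti₀ (Real.exp_pos _) ?_
    calc Real.exp (1 / 2 * |z.1| - 1 / 100 * |z.2|)
        ≤ Real.exp (|z.1| + -(1 / 100) * |z.2 + a z.1|) := by
          refine Real.exp_le_exp.2 ?_
          have := abs_add_le z.2 (a z.1)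
          have := ha z.1
          have := abs_nonneg z.1
          linarith
      _ = Real.exp |z.1| * Real.exp (-(1 / 100) * |z.2 + a z.1|) := Real.exp_add _ _
      _ ≤ _ := mul_le_mul (exp_abs_le_p _) (exp_le_cosh_rpow hκ _) (Real.exp_pos _).le (p_pos _).le

/-- The transport speed `6σ/(1+y)` in the variable `t`. -/
def spd (σ t : ℝ) : ℝ := 6 * σ * q t

/-- The primitive of the speed that vanishes at t = 0, thanks to log 2; this gives the bound 6|t|
without an additive constant. -/
def spdInt (σ t : ℝ) : ℝ := 6 * σ * (t - Real.log (1 + Real.exp t) + Real.log 2)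

theorem contDiff_spd (σ : ℝ) : ContDiff ℝ ∞ (spd σ) := contDiff_const.mul contDiff_q

theorem contDiff_spdInt (σ : ℝ) : ContDiff ℝ ∞ (spdInt σ) := by
  unfold spdInt
  refine contDiff_const.mul ((contDiff_id.sub (ContDiff.log ?_ fun t => by positivity)).add contDiff_const)
  fun_prop

theorem deriv_spdInt (σ : ℝ) : deriv (spdInt σ) = spd σ := by
  ext t
  have h : HasDerivAt (fun t => 1 + Real.exp t) (Real.exp t) t := (Real.hasDerivAt_exp t).const_add 1
  have h2 := (((hasDerivAt_id t).sub (h.log (by positivity))).add_const (Real.log 2)).const_mul (6 * σ)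
  refine Eq.trans (HasDerivAt.deriv (by exact h2)) ?_
  unfold spd q
  field_simp
  ring

theorem abs_spdInt_le {σ : ℝ} (hσ : |σ| ≤ 1) (t : ℝ) : |spdInt σ t| ≤ 6 * |t| := by
  have h0 := Real.exp_pos t
  have key : |t - Real.log (1 + Real.exp t) + Real.log 2| ≤ |t| := by
    have e : t - Real.log (1 + Real.exp t) + Real.log 2 = t - Real.log ((1 + Real.exp t) / 2) := by
      rw [Real.log_div (by positivity) (by norm_num)]; ring
    rw [e]
    rcases le_total 0 t with h | h
    · have h1 : 1 ≤ Real.exp t := Real.one_le_exp h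
      have l1 : 0 ≤ Real.log ((1 + Real.exp t) / 2) := Real.log_nonneg (by linarith)
      have l2 : Real.log ((1 + Real.exp t) / 2) ≤ t := by
        rw [Real.log_le_iff_le_exp (by positivity)]; linarith
      rw [abs_of_nonneg h, abs_of_nonneg (by linarith)]; linarith
    · have h1 : Real.exp t ≤ 1 := Real.exp_le_one_iff.2 h
      have l1 : Real.log ((1 + Real.exp t) / 2) ≤ 0 := Real.log_nonpos (by positivity) (by linarith)
      have l2 : t ≤ Real.log ((1 + Real.exp t) / 2) := by
        rw [Real.le_log_iff_exp_le (by positivity)]; linarith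
      rw [abs_of_nonpos h, abs_of_nonpos (by linarith)]; linarith
  unfold spdInt
  rw [abs_mul, abs_mul, abs_of_pos (show (0 : ℝ) < 6 by norm_num)]
  have := abs_nonneg t
  have := abs_nonneg σ
  have := abs_nonneg (t - Real.log (1 + Real.exp t) + Real.log 2)
  calc 6 * |σ| * _ ≤ 6 * 1 * |t| := by gcongr
    _ = _ := by ring

theorem abs_tanh_le (s : ℝ) : |Real.tanh s| ≤ 1 := (Real.abs_tanh_lt_one s).le

/-- The energy identity for the transport field. -/
theorem energy_transport {κ σ : ℝ} (hκ : |κ| ≤ 1 / 100) (hσ : |σ| ≤ 1) {u v : ℝ × ℝ → ℝ}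
    (h : Weak 1 (spd σ) u v) (hu : MemLp u 2 (νw κ)) (hv : MemLp v 2 (νw κ)) :
    ∫ z, u z * v z ∂(νw κ)
      = ∫ z, u z ^ 2 * (-(1 / 2) + 2 * q z.1 - 3 * σ * q z.1 * (κ * Real.tanh z.2)) ∂(νw κ) := by
  have hm := measurable_wt κ
  have hp := wt_pos κ
  obtain ⟨hu1, hu2⟩ := (memLp_wmeas hm hp).1 hu
  have huv := (integrable_wmeas hm hp).1 (integrable_mul hu hv)
  set B : ℝ × ℝ → ℝ := fun z => -(1 / 2) + 2 * q z.1 - 3 * σ * q z.1 * (κ * Real.tanh z.2) with hB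
  have hBc : Continuous B := by
    have := continuous_q
    have : Continuous Real.tanh := by
      simp only [funext Real.tanh_eq_sinh_div_cosh]
      exact Real.continuous_sinh.div Real.continuous_cosh fun s => (Real.cosh_pos s).ne'
    fun_prop
  have hBb : ∀ z, ‖B z‖ ≤ 5 := by
    intro z
    have h1 := q_pos z.1
    have h2 := q_lt_one z.1
    have h3 := abs_tanh_le z.2
    have h4 : |3 * σ * q z.1 * (κ * Real.tanh z.2)| ≤ 3 * 1 * 1 * (1 / 100 * 1) := by
      rw [abs_mul, abs_mul, abs_mul, abs_mul, abs_of_pos h1, abs_of_pos (show (0 : ℝ) < 3 by norm_num)]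
      gcongr
    rw [Real.norm_eq_abs, abs_le]
    obtain ⟨h5, h6⟩ := abs_le.1 h4
    simp only [hB]
    constructor <;> linarith
  have huB : Integrable fun z => u z ^ 2 * B z * wt κ z := by
    have := hu2.mul_bdd (c := 5) hBc.aestronglyMeasurable (Eventually.of_forall hBb)
    exact this.congr (Eventually.of_forall fun z => by simp only; ring)
  have e : ∀ z, 2 * u z * v z * wt κ z + u z ^ 2 * vf 1 (deriv (spdInt σ)) (wt κ) z
      = 2 * (u z * v z * wt κ z) - 2 * (u z ^ 2 * B z * wt κ z) := by
    intro z
    rw [vf_wt, deriv_spdInt]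
    simp only [hB, spd]
    ring
  have hsc := (contDiff_spdInt σ).continuous
  have := energy_shear (contDiff_spdInt σ) (by rw [deriv_spdInt]; exact h)
    (strip_of_memLp hκ hsc (abs_spdInt_le hσ) hu) (strip_of_memLp hκ hsc (abs_spdInt_le hσ) hv)
    (contDiff_wt κ) hu2 (by simp only [e]; exact (huv.const_mul 2).sub (huB.const_mul 2))
  simp only [e] at this
  rw [integral_sub (huv.const_mul 2) (huB.const_mul 2), integral_const_mul, integral_const_mul] at this
  rw [integral_wmeas hm hp, integral_wmeas hm hp]
  linarith

end LogPlane

namespace EulerLin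

open Filter Topology LogPlane

/-! ### Logarithmic coordinates on the half-strip -/

/-- The chart `(t, s) ↦ (y, θ) = (e^t, arctan e^s)`. -/
def E0 (z : ℝ × ℝ) : ℝ × ℝ := (Real.exp z.1, Real.arctan (Real.exp z.2))

/-- Jacobian of the chart. Its angular factor (2 cosh s)⁻¹ equals sin(2θ)/2, which is why D_θ
becomes 2∂_s. -/
def jac (z : ℝ × ℝ) : ℝ := Real.exp z.1 * (2 * Real.cosh z.2)⁻¹

theorem jac_pos (z : ℝ × ℝ) : 0 < jac z := by
  have := Real.cosh_pos z.2
  unfold jac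
  positivity

theorem hasDerivAt_arctan_exp (s : ℝ) :
    HasDerivAt (fun s => Real.arctan (Real.exp s)) (2 * Real.cosh s)⁻¹ s := by
  have := (Real.hasDerivAt_exp s).arctan
  convert! this using 1
  rw [Real.cosh_eq, Real.exp_neg]
  have := Real.exp_pos s
  field_simp
  ring

theorem tan_arctan_exp_inj {s s' : ℝ} (h : Real.arctan (Real.exp s) = Real.arctan (Real.exp s')) :
    s = s' := Real.exp_injective (Real.arctan_injective h)

theorem E0_injective : Function.Injective E0 := by
  intro z z' h
  have h1 := congrArg Prod.fst h
  have h2 := congrArg Prod.snd h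
  exact Prod.ext (Real.exp_injective h1) (tan_arctan_exp_inj h2)

theorem arctan_exp_mem (s : ℝ) : Real.arctan (Real.exp s) ∈ Ioo 0 (Real.pi / 2) :=
  ⟨Real.arctan_pos.2 (Real.exp_pos s), Real.arctan_lt_pi_div_two _⟩

theorem exists_arctan_exp {θ : ℝ} (h : θ ∈ Ioo 0 (Real.pi / 2)) :
    Real.arctan (Real.exp (Real.log (Real.tan θ))) = θ := by
  rw [Real.exp_log (Real.tan_pos_of_pos_of_lt_pi_div_two h.1 h.2),
    Real.arctan_tan (by linarith [h.1, Real.pi_pos]) h.2]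

theorem E0_mem (z : ℝ × ℝ) : E0 z ∈ Q := ⟨Real.exp_pos z.1, arctan_exp_mem z.2⟩

/-- The inverse chart. -/
def L0 (p : ℝ × ℝ) : ℝ × ℝ := (Real.log p.1, Real.log (Real.tan p.2))

theorem E0_L0 {p : ℝ × ℝ} (h : p ∈ Q) : E0 (L0 p) = p :=
  Prod.ext (Real.exp_log h.1) (exists_arctan_exp h.2)

theorem L0_E0 (z : ℝ × ℝ) : L0 (E0 z) = z := E0_injective (E0_L0 (E0_mem z))

theorem range_E0 : E0 '' univ = Q := by
  ext p
  constructor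
  · rintro ⟨z, _, rfl⟩
    exact E0_mem z
  · intro h
    exact ⟨L0 p, mem_univ _, E0_L0 h⟩

theorem image_arctan_exp : (fun s => Real.arctan (Real.exp s)) '' univ = Ioo 0 (Real.pi / 2) := by
  ext θ
  constructor
  · rintro ⟨z, _, rfl⟩
    exact arctan_exp_mem z
  · intro h
    exact ⟨_, mem_univ _, exists_arctan_exp h⟩

theorem continuous_E0 : Continuous E0 := by
  unfold E0
  exact (Real.continuous_exp.comp continuous_fst).prodMk
    (Real.continuous_arctan.comp (Real.continuous_exp.comp continuous_snd))

def E0' (z : ℝ × ℝ) : ℝ × ℝ →L[ℝ] ℝ × ℝ :=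
  (ContinuousLinearMap.toSpanSingleton ℝ (Real.exp z.1)).prodMap
    (ContinuousLinearMap.toSpanSingleton ℝ (2 * Real.cosh z.2)⁻¹)

theorem hasFDerivAt_E0 (z : ℝ × ℝ) : HasFDerivAt E0 (E0' z) z := by
  have h1 : HasFDerivAt Real.exp (ContinuousLinearMap.toSpanSingleton ℝ (Real.exp z.1)) z.1 :=
    (Real.hasDerivAt_exp z.1).hasFDerivAt
  have h2 : HasFDerivAt (fun s => Real.arctan (Real.exp s))
      (ContinuousLinearMap.toSpanSingleton ℝ (2 * Real.cosh z.2)⁻¹) z.2 :=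
    (hasDerivAt_arctan_exp z.2).hasFDerivAt
  exact HasFDerivAt.prodMap z h1 h2

theorem det_E0' (z : ℝ × ℝ) : (E0' z).det = jac z := by
  have h : ∀ a : ℝ, LinearMap.det ((ContinuousLinearMap.toSpanSingleton ℝ a : ℝ →L[ℝ] ℝ) : ℝ →ₗ[ℝ] ℝ) = a := by
    intro a
    rw [LinearMap.det_ring]
    simp
  have e : ((E0' z : ℝ × ℝ →L[ℝ] ℝ × ℝ) : ℝ × ℝ →ₗ[ℝ] ℝ × ℝ)
      = ((ContinuousLinearMap.toSpanSingleton ℝ (Real.exp z.1) : ℝ →L[ℝ] ℝ) : ℝ →ₗ[ℝ] ℝ).prodMap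
        ((ContinuousLinearMap.toSpanSingleton ℝ (2 * Real.cosh z.2)⁻¹ : ℝ →L[ℝ] ℝ) : ℝ →ₗ[ℝ] ℝ) := rfl
  rw [ContinuousLinearMap.det, e, LinearMap.det_prodMap, h, h, jac]

theorem integral_Q (h : ℝ × ℝ → ℝ) : ∫ p in Q, h p = ∫ z, h (E0 z) * jac z := by
  rw [← range_E0, integral_image_eq_integral_abs_det_fderiv_smul volume MeasurableSet.univ
    (fun z _ => (hasFDerivAt_E0 z).hasFDerivWithinAt) E0_injective.injOn, setIntegral_univ]
  simp only [det_E0', abs_of_pos (jac_pos _), smul_eq_mul, mul_comm]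

theorem integrable_Q (h : ℝ × ℝ → ℝ) :
    IntegrableOn h Q ↔ Integrable fun z => h (E0 z) * jac z := by
  rw [← range_E0, integrableOn_image_iff_integrableOn_abs_det_fderiv_smul volume MeasurableSet.univ
    (fun z _ => (hasFDerivAt_E0 z).hasFDerivWithinAt) E0_injective.injOn, integrableOn_univ]
  simp only [det_E0', abs_of_pos (jac_pos _), smul_eq_mul, mul_comm]

/-- The Jacobian is positive, so the preimage of a null set is null. This makes statements about
classes of functions survive the change of variables. -/
theorem ae_comp_E0 {P : ℝ × ℝ → Prop} (h : ∀ᵐ p ∂μQ, P p) : ∀ᵐ z, P (E0 z) := by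
  rw [ae_restrict_iff' isOpen_Q.measurableSet] at h
  set N := toMeasurable volume {p | ¬ (p ∈ Q → P p)} with hN
  have hN0 : volume N = 0 := by rw [hN, measure_toMeasurable]; exact h
  have hNm : MeasurableSet N := measurableSet_toMeasurable _ _
  have hSm : MeasurableSet (E0 ⁻¹' N) := continuous_E0.measurable hNm
  have h1 := lintegral_abs_det_fderiv_eq_addHaar_image volume hSm
    (fun z _ => (hasFDerivAt_E0 z).hasFDerivWithinAt) E0_injective.injOn
  rw [measure_mono_null (image_preimage_subset E0 N) hN0] at h1
  simp only [det_E0', abs_of_pos (jac_pos _)] at h1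
  have hjm : Measurable fun z => ENNReal.ofReal (jac z) := by
    refine (Continuous.measurable ?_).ennreal_ofReal
    have : Continuous fun z : ℝ × ℝ => (2 * Real.cosh z.2)⁻¹ :=
      Continuous.inv₀ (continuous_const.mul (Real.continuous_cosh.comp continuous_snd))
        fun z => by have := Real.cosh_pos z.2; positivity
    exact (Real.continuous_exp.comp continuous_fst).mul this
  have h2 := (lintegral_eq_zero_iff hjm).1 h1
  rw [EventuallyEq, ae_restrict_iff' hSm] at h2
  filter_upwards [h2] with z hz
  by_contra hP
  have hzN : z ∈ E0 ⁻¹' N := subset_toMeasurable _ _ fun hh => hP (hh (E0_mem z))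
  have := hz hzN
  simp only [Pi.zero_apply, ENNReal.ofReal_eq_zero] at this
  exact absurd (jac_pos z) (not_lt.2 this)

/-- A function on the half-strip in logarithmic coordinates. -/
def lift (f : X) (z : ℝ × ℝ) : ℝ := f (E0 z)

theorem stronglyMeasurable_lift (f : X) : StronglyMeasurable (lift f) :=
  (AEEqFun.stronglyMeasurable f).comp_measurable continuous_E0.measurable

/-! ### Transfer of weak derivatives -/

theorem contDiffAt_L0 {p : ℝ × ℝ} (h : p ∈ Q) : ContDiffAt ℝ ∞ L0 p := by
  have h1 : p.1 ≠ 0 := ne_of_gt h.1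
  have hc : Real.cos p.2 ≠ 0 := (Real.cos_pos_of_mem_Ioo ⟨by linarith [h.2.1, Real.pi_pos], h.2.2⟩).ne'
  have ht : Real.tan p.2 ≠ 0 := (Real.tan_pos_of_pos_of_lt_pi_div_two h.2.1 h.2.2).ne'
  refine ContDiffAt.prodMk (contDiffAt_fst.log h1) (ContDiffAt.log ?_ ht)
  exact (Real.contDiffAt_tan.2 hc).comp p contDiffAt_snd

/-- The test function on the half-strip with the expression `G` in logarithmic coordinates. -/
def push (G : ℝ × ℝ → ℝ) : ℝ × ℝ → ℝ := Q.indicator (G ∘ L0)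

theorem push_E0 (G : ℝ × ℝ → ℝ) (z : ℝ × ℝ) : push G (E0 z) = G z := by
  rw [push, indicator_of_mem (E0_mem z), Function.comp_apply, L0_E0]

theorem tsupport_push {G : ℝ × ℝ → ℝ} (hc : HasCompactSupport G) :
    tsupport (push G) ⊆ E0 '' tsupport G := by
  refine closure_minimal ?_ (hc.isCompact.image continuous_E0).isClosed
  intro p hp
  rw [Function.mem_support] at hp
  have hQ : p ∈ Q := by
    by_contra h
    exact hp (indicator_of_notMem h _)
  refine ⟨L0 p, subset_tsupport _ ?_, E0_L0 hQ⟩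
  rw [Function.mem_support]
  rwa [push, indicator_of_mem hQ] at hp

theorem tsupport_push_subset {G : ℝ × ℝ → ℝ} (hc : HasCompactSupport G) :
    tsupport (push G) ⊆ Q := (tsupport_push hc).trans (by
  rintro _ ⟨z, _, rfl⟩
  exact E0_mem z)

theorem hasCompactSupport_push {G : ℝ × ℝ → ℝ} (hc : HasCompactSupport G) :
    HasCompactSupport (push G) :=
  (hc.isCompact.image continuous_E0).of_isClosed_subset (isClosed_tsupport _) (tsupport_push hc)

theorem contDiff_push {G : ℝ × ℝ → ℝ} (hG : ContDiff ℝ ∞ G) (hc : HasCompactSupport G) :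
    ContDiff ℝ ∞ (push G) := by
  rw [contDiff_iff_contDiffAt]
  intro p
  by_cases hp : p ∈ tsupport (push G)
  swap
  · exact (contDiffAt_const (c := (0 : ℝ))).congr_of_eventuallyEq
      (notMem_tsupport_iff_eventuallyEq.1 hp)
  have hQ := tsupport_push_subset hc hp
  have h1 : ContDiffAt ℝ ∞ (G ∘ L0) p := hG.contDiffAt.comp p (contDiffAt_L0 hQ)
  refine h1.congr_of_eventuallyEq ?_
  filter_upwards [isOpen_Q.mem_nhds hQ] with x hx
  exact indicator_of_mem hx _

theorem fderiv_push {G : ℝ × ℝ → ℝ} (hG : ContDiff ℝ ∞ G) (hc : HasCompactSupport G) (z : ℝ × ℝ) :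
    Real.exp z.1 * fderiv ℝ (push G) (E0 z) ey = vf 1 (fun _ => 0) G z ∧
    (2 * Real.cosh z.2)⁻¹ * fderiv ℝ (push G) (E0 z) eθ = vf 0 (fun _ => 1) G z := by
  have h := ((contDiff_push hG hc).differentiable (by simp) (E0 z)).hasFDerivAt.comp z (hasFDerivAt_E0 z)
  have e : push G ∘ E0 = G := funext (push_E0 G)
  rw [e] at h
  unfold vf
  rw [h.fderiv]
  constructor
  · rw [ContinuousLinearMap.comp_apply, show E0' z (1, 0) = Real.exp z.1 • ey by simp [E0', ey],
      map_smul, smul_eq_mul]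
  · rw [ContinuousLinearMap.comp_apply,
      show E0' z (0, 1) = (2 * Real.cosh z.2)⁻¹ • eθ by simp [E0', eθ], map_smul, smul_eq_mul]

theorem sin_two_arctan_exp (s : ℝ) : Real.sin (2 * Real.arctan (Real.exp s)) = (Real.cosh s)⁻¹ := by
  rw [Real.sin_two_mul, Real.sin_arctan, Real.cos_arctan, Real.cosh_eq, Real.exp_neg]
  have h := Real.exp_pos s
  have h2 : Real.sqrt (1 + Real.exp s ^ 2) ^ 2 = 1 + Real.exp s ^ 2 := Real.sq_sqrt (by positivity)
  have h3 : 0 < Real.sqrt (1 + Real.exp s ^ 2) := by positivity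
  field_simp
  rw [h2]
  ring

/-- The test function carries the factor 2 cosh s, which cancels the angular part of the Jacobian
and is invisible to ∂_t. The remaining e^t turns ∂_y into ∂_t on one side and supplies the y of y∂_y
on the other. -/
theorem weakT_lift {f g : X} (h : IsWeakDeriv ey f g) (hf : LocallyIntegrable (lift f))
    (hg : LocallyIntegrable (lift (yX * g))) : WeakT (lift f) (lift (yX * g)) := by
  refine ⟨hf, hg, fun ψ hψ hc => ?_⟩
  have hA : ContDiff ℝ ∞ fun z : ℝ × ℝ => 2 * Real.cosh z.2 :=
    contDiff_const.mul (Real.contDiff_cosh.comp contDiff_snd)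
  have hG : ContDiff ℝ ∞ fun z : ℝ × ℝ => 2 * Real.cosh z.2 * ψ z := hA.mul hψ
  have hGc : HasCompactSupport fun z : ℝ × ℝ => 2 * Real.cosh z.2 * ψ z := hc.mul_left
  have h1 := h.2.2 _ (contDiff_push hG hGc) (hasCompactSupport_push hGc) (tsupport_push_subset hGc)
  rw [integral_Q, integral_Q] at h1
  have e1 : ∀ z, f (E0 z) * fderiv ℝ (push fun z => 2 * Real.cosh z.2 * ψ z) (E0 z) ey * jac z
      = lift f z * vf 1 (fun _ => 0) ψ z := by
    intro z
    have h2 := (fderiv_push hG hGc z).1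
    rw [vf_mul hA hψ, vf_comp_snd (A := fun s => 2 * Real.cosh s)
      (contDiff_const.mul Real.contDiff_cosh)] at h2
    have := (Real.cosh_pos z.2).ne'
    calc _ = lift f z * ((2 * Real.cosh z.2)⁻¹ * (Real.exp z.1 *
          fderiv ℝ (push fun z => 2 * Real.cosh z.2 * ψ z) (E0 z) ey)) := by
            unfold jac lift; ring
      _ = _ := by rw [h2]; field_simp; ring
  have e2 : ∀ᵐ z, g (E0 z) * push (fun z => 2 * Real.cosh z.2 * ψ z) (E0 z) * jac z
      = lift (yX * g) z * ψ z := by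
    filter_upwards [ae_comp_E0 (AEEqFun.coeFn_mul yX g), ae_comp_E0 (AEEqFun.coeFn_mk (μ := μQ)
      (fun p : ℝ × ℝ => p.1) (by fun_prop))] with z hz hz'
    have hz'' : yX (E0 z) = Real.exp z.1 := hz'
    have := (Real.cosh_pos z.2).ne'
    rw [lift, hz, Pi.mul_apply, hz'', push_E0, jac]
    field_simp
  simp only [e1] at h1
  rw [h1, integral_congr_ae e2]

/-- Here e^{−t} cancels the radial part of the Jacobian, and (2 cosh s)⁻¹ plays the role of
sin(2θ)/2; hence the factor ½. -/
theorem weakS_lift {f g : X} (h : IsWeakDeriv eθ f g) (hf : LocallyIntegrable (lift f))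
    (hg : LocallyIntegrable (lift (sinX * g))) :
    WeakS (lift f) (fun z => 1 / 2 * lift (sinX * g) z) := by
  refine ⟨hf, hg.smul (1 / 2 : ℝ), fun ψ hψ hc => ?_⟩
  have hA : ContDiff ℝ ∞ fun z : ℝ × ℝ => Real.exp (-z.1) := by fun_prop
  have hA' : ContDiff ℝ ∞ fun t : ℝ => Real.exp (-t) := by fun_prop
  have hG : ContDiff ℝ ∞ fun z : ℝ × ℝ => Real.exp (-z.1) * ψ z := hA.mul hψ
  have hGc : HasCompactSupport fun z : ℝ × ℝ => Real.exp (-z.1) * ψ z := hc.mul_left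
  have h1 := h.2.2 _ (contDiff_push hG hGc) (hasCompactSupport_push hGc) (tsupport_push_subset hGc)
  rw [integral_Q, integral_Q] at h1
  have e1 : ∀ z, f (E0 z) * fderiv ℝ (push fun z => Real.exp (-z.1) * ψ z) (E0 z) eθ * jac z
      = lift f z * vf 0 (fun _ => 1) ψ z := by
    intro z
    have h2 := (fderiv_push hG hGc z).2
    rw [vf_mul hA hψ, vf_comp_fst (A := fun t => Real.exp (-t)) hA'] at h2
    calc _ = lift f z * (Real.exp z.1 * ((2 * Real.cosh z.2)⁻¹ *
          fderiv ℝ (push fun z => Real.exp (-z.1) * ψ z) (E0 z) eθ)) := by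
            unfold jac lift; ring
      _ = _ := by rw [h2, Real.exp_neg]; field_simp; ring
  have e2 : ∀ᵐ z, g (E0 z) * push (fun z => Real.exp (-z.1) * ψ z) (E0 z) * jac z
      = 1 / 2 * lift (sinX * g) z * ψ z := by
    filter_upwards [ae_comp_E0 (AEEqFun.coeFn_mul sinX g), ae_comp_E0 (AEEqFun.coeFn_mk (μ := μQ)
      (fun p : ℝ × ℝ => Real.sin (2 * p.2)) (by exact Continuous.aestronglyMeasurable (by fun_prop)))]
      with z hz hz'
    have hz'' : sinX (E0 z) = (Real.cosh z.2)⁻¹ := by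
      rw [← sin_two_arctan_exp]; exact hz'
    have := (Real.cosh_pos z.2).ne'
    rw [lift, hz, Pi.mul_apply, hz'', push_E0, jac, Real.exp_neg]
    field_simp
  simp only [e1] at h1
  rw [h1, integral_congr_ae e2]

theorem locallyIntegrable_of_memLp {κ : ℝ} (hκ : |κ| ≤ 1 / 100) {u : ℝ × ℝ → ℝ}
    (hu : MemLp u 2 (νw κ)) : LocallyIntegrable u := by
  have hs : Strip u := by
    have := strip_of_memLp hκ (a := fun _ => 0) continuous_const (by simp) hu
    simpa using this
  have hm := ((memLp_wmeas (measurable_wt κ) (wt_pos κ)).1 hu).1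
  rw [locallyIntegrable_iff]
  intro K hK
  obtain ⟨R, hR⟩ := hK.isBounded.subset_closedBall 0
  refine (hs R).mono_set fun z hz => ⟨mem_univ _, ?_⟩
  have h := hR hz
  rw [mem_closedBall_zero_iff] at h
  exact abs_le.1 ((norm_snd_le z).trans h)

/-! ### Transfer of the norms -/

/-- The exponent of the angular weight: the purely radial derivatives carry another weight. -/
def kap (α : ℝ) (i : ℕ) : ℝ := if i = 0 then -(1 / 100) else α / 10

theorem abs_kap_le {α : ℝ} (h0 : 0 < α) (h1 : α ≤ 1 / 10) (i : ℕ) : |kap α i| ≤ 1 / 100 := by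
  unfold kap
  split_ifs
  · rw [abs_neg, abs_of_pos (by norm_num)]
  · rw [abs_of_pos (by positivity)]; linarith

def Wi (α : ℝ) (i : ℕ) (p : ℝ × ℝ) : ℝ := if i = 0 then W0 p else W α p

/-- The Jacobian contributes e^t to w², which gives p, and lowers the exponent of cosh by one. -/
theorem W_sq_jac (e : ℝ) (z : ℝ × ℝ) :
    (w (Real.exp z.1) / Real.sin (2 * Real.arctan (Real.exp z.2)) ^ (e / 2)) ^ 2 * jac z
      = 1 / 2 * wt (e - 1) z := by
  have hc := Real.cosh_pos z.2
  have hx := Real.exp_pos z.1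
  rw [sin_two_arctan_exp, Real.inv_rpow hc.le, div_inv_eq_mul, mul_pow, ← Real.rpow_mul_natCast hc.le,
    jac, wt, p, w, Real.rpow_sub_one hc.ne']
  have h1 : Real.exp (-3 * z.1) = (Real.exp z.1 ^ 3)⁻¹ := by
    rw [← Real.exp_nat_mul, ← Real.exp_neg]; push_cast; ring_nf
  rw [h1, show e / 2 * ((2 : ℕ) : ℝ) = e by push_cast; ring]
  field_simp

theorem Wi_sq_jac (α : ℝ) (i : ℕ) (z : ℝ × ℝ) :
    Wi α i (E0 z) ^ 2 * jac z = 1 / 2 * wt (kap α i) z := by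
  unfold Wi kap
  split_ifs
  · rw [W0, E0, W_sq_jac, show η - 1 = -(1 / 100) by unfold η; norm_num]
  · have := W_sq_jac (γ α) z
    rw [show γ α - 1 = α / 10 by unfold γ; ring] at this
    rw [← this, W, E0, mul_one_div]

theorem memLp_lift {α : ℝ} {i : ℕ} {f : X} (h : MemLp (fun p => f p * Wi α i p) 2 μQ) :
    MemLp (lift f) 2 (νw (kap α i)) := by
  rw [memLp_wmeas (measurable_wt _) (wt_pos _)]
  refine ⟨(stronglyMeasurable_lift f).aestronglyMeasurable, ?_⟩
  have h1 := (memLp_two_iff_integrable_sq h.1).1 h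
  have h2 := (integrable_Q _).1 h1
  refine (h2.const_mul 2).congr (Eventually.of_forall fun z => ?_)
  simp only [mul_pow, mul_assoc, Wi_sq_jac, lift]
  ring

theorem integral_Q_sq {α : ℝ} {i : ℕ} {f : X} (h : MemLp (fun p => f p * Wi α i p) 2 μQ) :
    ∫ p in Q, (f p * Wi α i p) ^ 2 = 1 / 2 * nrm (νw (kap α i)) (lift f) ^ 2 := by
  rw [integral_Q, ← integral_sq (memLp_lift h), integral_wmeas (measurable_wt _) (wt_pos _),
    ← integral_const_mul]
  refine integral_congr_ae (Eventually.of_forall fun z => ?_)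
  simp only [mul_pow, mul_assoc, Wi_sq_jac, lift]
  ring

/-! ### The angular moment -/

def G0 (s : ℝ) : ℝ := Real.sin (Real.arctan (Real.exp s)) * Real.cos (Real.arctan (Real.exp s)) ^ 2

theorem G0_pos (s : ℝ) : 0 < G0 s := by
  have h := arctan_exp_mem s
  have h1 := Real.sin_pos_of_pos_of_lt_pi h.1 (by linarith [h.2, Real.pi_pos])
  have h2 := Real.cos_arctan_pos (Real.exp s)
  unfold G0
  positivity

theorem G0_le_one (s : ℝ) : G0 s ≤ 1 := by
  have h2 := Real.cos_arctan_pos (Real.exp s)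
  have h3 := Real.sin_le_one (Real.arctan (Real.exp s))
  have h4 := Real.cos_le_one (Real.arctan (Real.exp s))
  have h5 : Real.cos (Real.arctan (Real.exp s)) ^ 2 ≤ 1 := by nlinarith
  have h6 : 0 ≤ Real.cos (Real.arctan (Real.exp s)) ^ 2 := by positivity
  unfold G0
  nlinarith

theorem hasDerivAt_G0 (s : ℝ) :
    HasDerivAt G0 (G0 s * (-(1 + 3 * Real.tanh s) / 2)) s := by
  have h := hasDerivAt_arctan_exp s
  have := h.sin.mul (h.cos.pow 2)
  convert! this using 1
  have h0 := Real.exp_pos s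
  have h2 : Real.sqrt (1 + Real.exp s ^ 2) ^ 2 = 1 + Real.exp s ^ 2 := Real.sq_sqrt (by positivity)
  have h3 : 0 < Real.sqrt (1 + Real.exp s ^ 2) := by positivity
  simp only [Pi.pow_apply, G0]
  rw [Real.sin_arctan, Real.cos_arctan, Real.tanh_eq_sinh_div_cosh, Real.sinh_eq, Real.cosh_eq,
    Real.exp_neg]
  set E := Real.exp s
  set r := Real.sqrt (1 + E ^ 2)
  have h4 : r ≠ 0 := h3.ne'
  have h5 : E ^ 2 = r ^ 2 - 1 := by linarith
  have h6 : E + E⁻¹ = r ^ 2 / E := by field_simp; linarith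
  have h7 : E - E⁻¹ = (r ^ 2 - 2) / E := by field_simp; linarith
  rw [h6, h7]
  field_simp
  push_cast
  have h8 : r * (1 / r) ^ 1 = 1 := by rw [pow_one, mul_one_div, div_self h4]
  linear_combination 4 * E ^ 2 * h8 + (4 : ℝ) * h5

theorem continuous_G0 : Continuous G0 :=
  continuous_iff_continuousAt.2 fun s => (hasDerivAt_G0 s).continuousAt

/-- The kernel of the angular moment in the variable `s = log tan θ`. -/
def kk (s : ℝ) : ℝ := 3 * G0 s * (2 * Real.cosh s)⁻¹

theorem kk_pos (s : ℝ) : 0 < kk s := by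
  have := G0_pos s
  have := Real.cosh_pos s
  unfold kk
  positivity

theorem kk_le (s : ℝ) : kk s ≤ 3 * Real.exp (-|s|) := by
  have h1 := G0_le_one s
  have h2 := exp_abs_le_two_cosh s
  have h3 : (2 * Real.cosh s)⁻¹ ≤ Real.exp (-|s|) := by
    rw [Real.exp_neg]
    exact inv_anti₀ (Real.exp_pos _) h2
  have := Real.cosh_pos s
  unfold kk
  gcongr
  linarith

theorem continuous_kk : Continuous kk := by
  unfold kk
  exact (continuous_const.mul continuous_G0).mul (Continuous.inv₀
    (continuous_const.mul Real.continuous_cosh) fun s => by have := Real.cosh_pos s; positivity)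

/-- The angular moment of a function in the plane. -/
def fK (u : ℝ × ℝ → ℝ) (t : ℝ) : ℝ := ∫ s, u (t, s) * kk s

theorem integral_angle (h : ℝ → ℝ) : ∫ θ in Ioo 0 (Real.pi / 2), h θ
    = ∫ s, h (Real.arctan (Real.exp s)) * (2 * Real.cosh s)⁻¹ := by
  rw [← image_arctan_exp, integral_image_eq_integral_abs_deriv_smul MeasurableSet.univ
    (fun s _ => (hasDerivAt_arctan_exp s).hasDerivWithinAt)
    (fun s _ s' _ hs => tan_arctan_exp_inj hs), setIntegral_univ]
  refine integral_congr_ae (Eventually.of_forall fun s => ?_)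
  have := Real.cosh_pos s
  simp only [smul_eq_mul]
  rw [abs_of_pos (by positivity), mul_comm]

/-- After r ↦ e^r the remaining factor e^{−r} is cancelled by the Jacobian, so L₁₂ is the plain tail
integral of the angular moment. -/
theorem L12_integrand (h : ℝ × ℝ → ℝ) (r : ℝ) :
    3 * ∫ θ in Ioo 0 (Real.pi / 2), h (Real.exp r, θ) * Real.sin θ * Real.cos θ ^ 2 / Real.exp r
      = (Real.exp r)⁻¹ * fK (fun z => h (E0 z)) r := by
  rw [integral_angle (fun θ => h (Real.exp r, θ) * Real.sin θ * Real.cos θ ^ 2 / Real.exp r), fK,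
    ← integral_const_mul, ← integral_const_mul]
  refine integral_congr_ae (Eventually.of_forall fun s => ?_)
  simp only [kk, G0, E0]
  ring

theorem L12_eq (h : ℝ × ℝ → ℝ) {S : Set ℝ} (hS : MeasurableSet S) {z : ℝ}
    (hz : Real.exp '' S = Ioi z) : L12 h z = ∫ r in S, fK (fun z => h (E0 z)) r := by
  rw [L12, ← hz, integral_image_eq_integral_abs_deriv_smul hS
    (fun s _ => (Real.hasDerivAt_exp s).hasDerivWithinAt) Real.exp_injective.injOn]
  refine integral_congr_ae (Eventually.of_forall fun s => ?_)
  have := Real.exp_pos s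
  simp only [smul_eq_mul, L12_integrand]
  rw [abs_of_pos this]
  field_simp

theorem L12_exp (h : ℝ × ℝ → ℝ) (t : ℝ) :
    L12 h (Real.exp t) = ∫ r in Ioi t, fK (fun z => h (E0 z)) r := by
  refine L12_eq h measurableSet_Ioi ?_
  ext x
  constructor
  · rintro ⟨r, hr, rfl⟩
    exact Real.exp_lt_exp.2 hr
  · intro hx
    have hx0 : 0 < x := (Real.exp_pos t).trans hx
    exact ⟨Real.log x, (Real.lt_log_iff_exp_lt hx0).2 hx, Real.exp_log hx0⟩

theorem L12_zero (h : ℝ × ℝ → ℝ) : L12 h 0 = ∫ r, fK (fun z => h (E0 z)) r := by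
  rw [L12_eq h MeasurableSet.univ, setIntegral_univ]
  rw [image_univ, Real.range_exp]

theorem fK_congr {u v : ℝ × ℝ → ℝ} (h : u =ᵐ[volume] v) : fK u =ᵐ[volume] fK v := by
  filter_upwards [Measure.ae_ae_of_ae_prod h] with t ht
  exact integral_congr_ae (ht.mono fun s hs => by simp only [hs])

/-- The square of the kernel decays like e^{−2|s|}, which absorbs the loss e^{|s|/100}. The bound 18
= 9·2 is uniform in κ, hence in α. -/
theorem integrable_kk_sq {κ : ℝ} (hκ : |κ| ≤ 1 / 100) :
    Integrable (fun s => kk s ^ 2 * (Real.cosh s ^ κ)⁻¹) ∧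
      ∫ s, kk s ^ 2 * (Real.cosh s ^ κ)⁻¹ ≤ 18 := by
  have hb : ∀ s, kk s ^ 2 * (Real.cosh s ^ κ)⁻¹ ≤ 9 * Real.exp (-1 * |s|) := by
    intro s
    have h1 := kk_le s
    have h2 := (kk_pos s).le
    have h3 := exp_le_cosh_rpow hκ s
    have h4 : (Real.cosh s ^ κ)⁻¹ ≤ (Real.exp (-(1 / 100) * |s|))⁻¹ := inv_anti₀ (Real.exp_pos _) h3
    have hc := Real.rpow_pos_of_pos (Real.cosh_pos s) κ
    calc kk s ^ 2 * (Real.cosh s ^ κ)⁻¹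
        ≤ (3 * Real.exp (-|s|)) ^ 2 * (Real.exp (-(1 / 100) * |s|))⁻¹ := by gcongr
      _ = 9 * Real.exp (-|s| + -|s| + 1 / 100 * |s|) := by
        rw [← Real.exp_neg, Real.exp_add, Real.exp_add]; ring_nf
      _ ≤ _ := by
        gcongr
        have := abs_nonneg s
        linarith
  have hpos : ∀ s, 0 ≤ kk s ^ 2 * (Real.cosh s ^ κ)⁻¹ := fun s => by
    have hc := Real.rpow_pos_of_pos (Real.cosh_pos s) κ
    positivity
  obtain ⟨i1, i2⟩ := integral_exp_neg_abs (a := 1) one_pos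
  have hi : Integrable (fun s => kk s ^ 2 * (Real.cosh s ^ κ)⁻¹) := by
    refine (i1.const_mul 9).mono' (Continuous.aestronglyMeasurable ?_)
      (Eventually.of_forall fun s => ?_)
    · exact (continuous_kk.pow 2).mul ((contDiff_cosh_rpow κ).continuous.inv₀ fun s =>
        (Real.rpow_pos_of_pos (Real.cosh_pos s) κ).ne')
    · rw [Real.norm_eq_abs, abs_of_nonneg (hpos s)]
      exact hb s
  refine ⟨hi, (integral_mono hi (i1.const_mul 9) hb).trans ?_⟩
  rw [integral_const_mul, i2]
  norm_num

/-- Cauchy–Schwarz in the weighted space, with `kk` written as (kk/ρ)·ρ. -/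
theorem fK_sq_le {κ : ℝ} (hκ : |κ| ≤ 1 / 100) {v : ℝ → ℝ} (hv : AEStronglyMeasurable v)
    (hi : Integrable fun s => v s ^ 2 * Real.cosh s ^ κ) :
    Integrable (fun s => v s * kk s) ∧
    (∫ s, v s * kk s) ^ 2 ≤ 18 * ∫ s, v s ^ 2 * Real.cosh s ^ κ := by
  set ρ : ℝ → ℝ := fun s => Real.cosh s ^ κ with hρ
  have hm : Measurable ρ := (contDiff_cosh_rpow κ).continuous.measurable
  have hp : ∀ s, 0 < ρ s := fun s => Real.rpow_pos_of_pos (Real.cosh_pos s) κ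
  have h1 : MemLp v 2 (wmeas volume ρ) := (memLp_wmeas hm hp).2 ⟨hv, hi⟩
  obtain ⟨k1, k2⟩ := integrable_kk_sq hκ
  have ek : ∀ s, (kk s * (ρ s)⁻¹) ^ 2 * ρ s = kk s ^ 2 * (Real.cosh s ^ κ)⁻¹ := fun s => by
    have := (hp s).ne'
    change _ = kk s ^ 2 * (ρ s)⁻¹
    field_simp
  have h2 : MemLp (fun s => kk s * (ρ s)⁻¹) 2 (wmeas volume ρ) := by
    refine (memLp_wmeas hm hp).2 ⟨?_, by simpa only [ek] using k1⟩
    exact (continuous_kk.mul ((contDiff_cosh_rpow κ).continuous.inv₀ fun s => (hp s).ne')).aestronglyMeasurable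
  have e : ∀ s, v s * (kk s * (ρ s)⁻¹) * ρ s = v s * kk s := fun s => by
    have := (hp s).ne'
    field_simp
  have h3 := abs_integral_mul_le h1 h2
  have h4 := (integrable_wmeas hm hp).1 (integrable_mul h1 h2)
  rw [integral_wmeas hm hp] at h3
  simp only [e] at h3 h4
  refine ⟨h4, ?_⟩
  have n1 := integral_sq h1
  have n2 := integral_sq h2
  rw [integral_wmeas hm hp] at n1 n2
  simp only [ek] at n2
  rw [← sq_abs]
  calc _ ≤ (nrm (wmeas volume ρ) v * nrm (wmeas volume ρ) fun s => kk s * (ρ s)⁻¹) ^ 2 := by gcongr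
    _ = (∫ s, kk s ^ 2 * (Real.cosh s ^ κ)⁻¹) * ∫ s, v s ^ 2 * ρ s := by rw [mul_pow, n1, n2]; ring
    _ ≤ _ := by
      gcongr

theorem integrable_fK_slice {κ : ℝ} (hκ : |κ| ≤ 1 / 100) {u : ℝ × ℝ → ℝ} (hu : MemLp u 2 (νw κ)) :
    ∀ᵐ t, Integrable (fun s => u (t, s) * kk s) ∧
      fK u t ^ 2 * p t ≤ 18 * ∫ s, u (t, s) ^ 2 * wt κ (t, s) := by
  obtain ⟨h1, h2⟩ := (memLp_wmeas (measurable_wt κ) (wt_pos κ)).1 hu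
  filter_upwards [h1.prodMk_left, h2.prod_right_ae] with t m1 i1
  have i2 : Integrable fun s => u (t, s) ^ 2 * Real.cosh s ^ κ := by
    refine (i1.const_mul (p t)⁻¹).congr (Eventually.of_forall fun s => ?_)
    have := (p_pos t).ne'
    simp only [wt]
    field_simp
  obtain ⟨i3, i4⟩ := fK_sq_le hκ m1 i2
  refine ⟨i3, ?_⟩
  have := p_pos t
  calc fK u t ^ 2 * p t ≤ (18 * ∫ s, u (t, s) ^ 2 * Real.cosh s ^ κ) * p t := by
        unfold fK; gcongr
    _ = _ := by
      rw [mul_assoc, ← integral_mul_const]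
      congr 1
      refine integral_congr_ae (Eventually.of_forall fun s => ?_)
      simp only [wt]
      ring

theorem memLp_fK {κ : ℝ} (hκ : |κ| ≤ 1 / 100) {u : ℝ × ℝ → ℝ} (hu : MemLp u 2 (νw κ)) :
    MemLp (fK u) 2 νp ∧ nrm νp (fK u) ≤ 5 * nrm (νw κ) u := by
  obtain ⟨h1, h2⟩ := (memLp_wmeas (measurable_wt κ) (wt_pos κ)).1 hu
  have hm : AEStronglyMeasurable (fK u) := by
    have : AEStronglyMeasurable (fun z : ℝ × ℝ => u z * kk z.2)
        ((volume : Measure ℝ).prod (volume : Measure ℝ)) :=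
      h1.mul (continuous_kk.comp continuous_snd).aestronglyMeasurable
    exact this.integral_prod_right'
  have hs := integrable_fK_slice hκ hu
  have h3 := h2.integral_prod_left
  have h4 : Integrable fun t => fK u t ^ 2 * p t := by
    refine (h3.const_mul 18).mono' ((hm.pow 2).mul continuous_p.aestronglyMeasurable) ?_
    filter_upwards [hs] with t ht
    have := p_pos t
    rw [Real.norm_eq_abs, abs_of_nonneg (by positivity)]
    exact ht.2
  have h5 : MemLp (fK u) 2 νp := (memLp_wmeas measurable_p p_pos).2 ⟨hm, h4⟩
  refine ⟨h5, ?_⟩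
  have h6 : nrm νp (fK u) ^ 2 ≤ 18 * nrm (νw κ) u ^ 2 := by
    rw [← integral_sq h5, ← integral_sq hu, integral_wmeas measurable_p p_pos,
      integral_wmeas (measurable_wt κ) (wt_pos κ), Measure.volume_eq_prod ℝ ℝ, integral_prod _ h2,
      ← integral_const_mul]
    exact integral_mono_ae h4 (h3.const_mul 18) (hs.mono fun t ht => ht.2)
  have := nrm_nonneg (νw κ) u
  -- 18 ≤ 5².
  refine abs_le_of_sq_le_sq' ?_ (by positivity) |>.2
  nlinarith

theorem fK_add {κ : ℝ} (hκ : |κ| ≤ 1 / 100) {u v : ℝ × ℝ → ℝ} (hu : MemLp u 2 (νw κ))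
    (hv : MemLp v 2 (νw κ)) : fK (fun z => u z + v z) =ᵐ[volume] fun t => fK u t + fK v t := by
  filter_upwards [integrable_fK_slice hκ hu, integrable_fK_slice hκ hv] with t h1 h2
  rw [fK, fK, fK, ← integral_add h1.1 h2.1]
  simp only [add_mul]

theorem fK_mul (a : ℝ → ℝ) (u : ℝ × ℝ → ℝ) (t : ℝ) : fK (fun z => a z.1 * u z) t = a t * fK u t := by
  rw [fK, fK, ← integral_const_mul]
  simp only [mul_assoc]

theorem integrable_mul_kk {κ : ℝ} (hκ : |κ| ≤ 1 / 100) {u : ℝ × ℝ → ℝ} (hu : MemLp u 2 (νw κ)) :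
    Integrable fun z : ℝ × ℝ => u z * kk z.2 := by
  obtain ⟨h1, h2⟩ := (memLp_wmeas (measurable_wt κ) (wt_pos κ)).1 hu
  have h3 := h2.add (integrable_inv_p.mul_prod (integrable_kk_sq hκ).1)
  refine h3.mono' (h1.mul (continuous_kk.comp continuous_snd).aestronglyMeasurable)
    (Eventually.of_forall fun z => ?_)
  have hp := p_pos z.1
  have hc := Real.rpow_pos_of_pos (Real.cosh_pos z.2) κ
  have hk := kk_pos z.2
  simp only [Real.norm_eq_abs, Pi.add_apply, wt]
  rw [abs_mul, abs_of_pos hk, ← sq_abs (u z)]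
  set A := p z.1 * Real.cosh z.2 ^ κ with hA
  have hA0 : 0 < A := by positivity
  have e : (p z.1)⁻¹ * (kk z.2 ^ 2 * (Real.cosh z.2 ^ κ)⁻¹) = kk z.2 ^ 2 / A := by
    rw [hA]; field_simp
  rw [e]
  have h4 : 0 ≤ (|u z| * A - kk z.2) ^ 2 := sq_nonneg _
  have h5 : |u z| ^ 2 * A + kk z.2 ^ 2 / A - |u z| * kk z.2
      = ((|u z| * A - kk z.2) ^ 2 + |u z| * kk z.2 * A) / A := by
    field_simp
    ring
  have h6 : 0 ≤ |u z| ^ 2 * A + kk z.2 ^ 2 / A - |u z| * kk z.2 := by rw [h5]; positivity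
  linarith

/-- The representation of `weak_plane` is integrated against `kk`. The moment of `v` has mean zero
because its primitive, the moment of `u`, is itself integrable. -/
theorem fK_weakT {κ : ℝ} (hκ : |κ| ≤ 1 / 100) {u v : ℝ × ℝ → ℝ} (h : WeakT u v)
    (hu : MemLp u 2 (νw κ)) (hv : MemLp v 2 (νw κ)) :
    (∀ᵐ t, fK u t = ∫ r in Iic t, fK v r) ∧ ∫ r, fK v r = 0 := by
  have hs : ∀ {w : ℝ × ℝ → ℝ}, MemLp w 2 (νw κ) → Strip w := fun hw => by
    have := strip_of_memLp hκ (a := fun _ => 0) continuous_const (by simp) hw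
    simpa using this
  obtain ⟨v', hvv, hl⟩ := weak_plane h (hs hu) (hs hv)
  have hv' : MemLp v' 2 (νw κ) := hv.ae_eq ((wmeas_ac volume (wt κ)).ae_eq hvv)
  have hvk := integrable_mul_kk hκ hv'
  have hfv := fK_congr hvv
  have hi := integrable_of_memLp (memLp_fK hκ hv).1
  have hmain : ∀ᵐ t, fK u t = ∫ r in Iic t, fK v r := by
    filter_upwards [Measure.ae_ae_of_ae_prod hl] with t ht
    have hsw := integral_integral_swap (f := fun r x => v' (r, x) * kk x)
      (μ := volume.restrict (Iic t)) (ν := volume) (by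
        have := hvk.integrableOn (s := Iic t ×ˢ univ)
        rw [IntegrableOn, Measure.volume_eq_prod, ← Measure.prod_restrict, Measure.restrict_univ] at this
        exact this)
    rw [setIntegral_congr_ae measurableSet_Iic (hfv.mono fun r hr _ => hr)]
    unfold fK
    rw [hsw]
    refine integral_congr_ae (ht.mono fun s hs => ?_)
    simp only [hs, integral_mul_const]
  refine ⟨hmain, ?_⟩
  have hd := ae_hasDerivAt_primitive hi
  exact (eq_integral_Iic_of_ac (fun a b => ac_of_primitive hi a b) hd
    ((integrable_of_memLp (memLp_fK hκ hu).1).congr hmain) hi).2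

end EulerLin

namespace LogPlane

open Filter Topology

/-! ### Functions of one variable in the plane -/

theorem locallyIntegrable_fst {n : ℝ → ℝ} (hn : LocallyIntegrable n) :
    LocallyIntegrable fun z : ℝ × ℝ => n z.1 := by
  rw [locallyIntegrable_iff]
  intro K hK
  obtain ⟨R, hR⟩ := hK.isBounded.subset_closedBall 0
  have hsub : K ⊆ Icc (-R) R ×ˢ Icc (-R) R := by
    intro z hz
    have h := hR hz
    rw [mem_closedBall_zero_iff] at h
    exact ⟨abs_le.1 ((norm_fst_le z).trans h), abs_le.1 ((norm_snd_le z).trans h)⟩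
  refine IntegrableOn.mono_set ?_ hsub
  rw [IntegrableOn, Measure.volume_eq_prod, ← Measure.prod_restrict]
  exact (hn.integrableOn_isCompact (isCompact_Icc (a := -R) (b := R))).comp_fst
    (volume.restrict (Icc (-R) R))

theorem test_slice {ψ : ℝ × ℝ → ℝ} (hψ : ContDiff ℝ ∞ ψ) (hc : HasCompactSupport ψ) :
    (∀ x, HasCompactSupport fun t => ψ (t, x)) ∧ (∀ t, HasCompactSupport fun s => ψ (t, s)) ∧
    (∀ t x, HasDerivAt (fun t => ψ (t, x)) (vf 1 (fun _ => 0) ψ (t, x)) t) ∧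
    (∀ t s, HasDerivAt (fun s => ψ (t, s)) (vf 0 (fun _ => 1) ψ (t, s)) s) := by
  obtain ⟨N, hN0, hN⟩ := exists_box hc
  refine ⟨fun x => ?_, fun t => ?_, fun t x => ?_, fun t s => ?_⟩
  · refine HasCompactSupport.intro (isCompact_Icc (a := -N) (b := N)) fun r hr => ?_
    by_contra h0
    exact hr (abs_le.1 (hN _ h0).1)
  · refine HasCompactSupport.intro (isCompact_Icc (a := -N) (b := N)) fun r hr => ?_
    by_contra h0
    exact hr (abs_le.1 (hN _ h0).2)
  · exact (hψ.differentiable (by simp) (t, x)).hasFDerivAt.comp_hasDerivAt t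
      ((hasDerivAt_id t).prodMk (hasDerivAt_const t x))
  · exact (hψ.differentiable (by simp) (t, s)).hasFDerivAt.comp_hasDerivAt s
      ((hasDerivAt_const s t).prodMk (hasDerivAt_id s))

theorem weakS_fst {n : ℝ → ℝ} (hn : LocallyIntegrable n) :
    WeakS (fun z => n z.1) (fun _ => 0) := by
  refine ⟨locallyIntegrable_fst hn, locallyIntegrable_zero, fun ψ hψ hc => ?_⟩
  have hV := contDiff_vf (a := 0) (b := fun _ => 1) contDiff_const hψ
  have hi := integrable_mul_test (locallyIntegrable_fst hn) hV.continuous (hasCompactSupport_vf hc)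
  obtain ⟨-, h2, -, h4⟩ := test_slice hψ hc
  rw [Measure.volume_eq_prod, integral_prod _ hi]
  simp only [zero_mul, integral_zero, neg_zero]
  refine integral_eq_zero_of_ae (Eventually.of_forall fun t => ?_)
  simp only [integral_const_mul, Pi.zero_apply]
  have hsc : ContDiff ℝ 1 fun s => ψ (t, s) :=
    (hψ.of_le (by exact_mod_cast le_top)).comp (contDiff_const.prodMk contDiff_id)
  have hi2 : Integrable fun s => vf 0 (fun _ => 1) ψ (t, s) :=
    (hV.continuous.comp (by fun_prop)).integrable_of_hasCompactSupport
      ((test_slice hV (hasCompactSupport_vf hc)).2.1 t)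
  rw [(eq_integral_Iic_of_ac (ac_of_contDiff hsc) (Eventually.of_forall (h4 t))
    (hsc.continuous.integrable_of_hasCompactSupport (h2 t)) hi2).2, mul_zero]

/-- Lets the moments, which are functions of t alone, enter the differentiated equations in the
plane. -/
theorem weakT_fst {n m : ℝ → ℝ} (hm : Integrable m) (h : ∀ᵐ t, n t = ∫ r in Iic t, m r) :
    WeakT (fun z => n z.1) (fun z => m z.1) := by
  set N : ℝ → ℝ := fun t => ∫ r in Iic t, m r with hN
  have hNc : Continuous N := continuous_primitive hm
  have hNl := locallyIntegrable_fst hNc.locallyIntegrable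
  have hml := locallyIntegrable_fst hm.locallyIntegrable
  have key : WeakT (fun z => N z.1) (fun z => m z.1) := by
    refine ⟨hNl, hml, fun ψ hψ hc => ?_⟩
    have hV := contDiff_vf (a := 1) (b := fun _ => 0) contDiff_const hψ
    have hVc := hasCompactSupport_vf (a := 1) (b := fun _ => 0) hc
    have i1 := integrable_mul_test hNl hV.continuous hVc
    have i2 := integrable_mul_test hml hψ.continuous hc
    rw [eq_neg_iff_add_eq_zero, ← integral_add i1 i2, Measure.volume_eq_prod,
      integral_prod_symm _ (by exact i1.add i2)]
    refine integral_eq_zero_of_ae (Eventually.of_forall fun x => ?_)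
    obtain ⟨h1, -, h3, -⟩ := test_slice hψ hc
    have hsc : ContDiff ℝ 1 fun t => ψ (t, x) :=
      (hψ.of_le (by exact_mod_cast le_top)).comp (contDiff_id.prodMk contDiff_const)
    have hVx : Continuous fun t => vf 1 (fun _ => 0) ψ (t, x) := hV.continuous.comp (by fun_prop)
    obtain ⟨C, hC⟩ := hsc.continuous.bounded_above_of_compact_support (h1 x)
    have j1 : Integrable fun t => ψ (t, x) * N t :=
      (hsc.continuous.mul hNc).integrable_of_hasCompactSupport (h1 x).mul_right
    have j2 : Integrable fun t => vf 1 (fun _ => 0) ψ (t, x) * N t :=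
      (hVx.mul hNc).integrable_of_hasCompactSupport ((test_slice hV hVc).1 x).mul_right
    have j3 : Integrable fun t => ψ (t, x) * m t :=
      hm.bdd_mul hsc.continuous.aestronglyMeasurable (Eventually.of_forall hC)
    have e : deriv (fun t => ψ (t, x)) = fun t => vf 1 (fun _ => 0) ψ (t, x) :=
      funext fun t => (h3 t x).deriv
    have := (product_line hm hsc j1 (by rw [e]; exact j2.add j3)).2
    rw [e] at this
    refine Eq.trans (integral_congr_ae (Eventually.of_forall fun t => ?_)) this
    simp only [hN]
    ring
  refine key.congr ?_ (EventuallyEq.refl _ _)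
  have := (Measure.quasiMeasurePreserving_fst (μ := (volume : Measure ℝ))
    (ν := (volume : Measure ℝ))).ae h
  filter_upwards [this] with z hz using hz.symm

theorem weak_const (m : ℝ) : WeakT (fun _ => m) (fun _ => 0) ∧ WeakS (fun _ => m) (fun _ => 0) := by
  refine ⟨⟨locallyIntegrable_const m, locallyIntegrable_zero, fun ψ hψ hc => ?_⟩,
    weakS_fst (n := fun _ => m) (locallyIntegrable_const m)⟩
  have hV := contDiff_vf (a := 1) (b := fun _ => 0) contDiff_const hψ
  have hi := integrable_mul_test (locallyIntegrable_const m) hV.continuous (hasCompactSupport_vf hc)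
  obtain ⟨h1, -, h3, -⟩ := test_slice hψ hc
  rw [Measure.volume_eq_prod, integral_prod_symm _ hi]
  simp only [zero_mul, integral_zero, neg_zero]
  refine integral_eq_zero_of_ae (Eventually.of_forall fun x => ?_)
  simp only [integral_const_mul, Pi.zero_apply]
  have hsc : ContDiff ℝ 1 fun t => ψ (t, x) :=
    (hψ.of_le (by exact_mod_cast le_top)).comp (contDiff_id.prodMk contDiff_const)
  have hi2 : Integrable fun t => vf 1 (fun _ => 0) ψ (t, x) :=
    (hV.continuous.comp (by fun_prop)).integrable_of_hasCompactSupport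
      ((test_slice hV (hasCompactSupport_vf hc)).1 x)
  rw [(eq_integral_Iic_of_ac (ac_of_contDiff hsc) (Eventually.of_forall fun t => h3 t x)
    (hsc.continuous.integrable_of_hasCompactSupport (h1 x)) hi2).2, mul_zero]

/-- The angular measure. -/
abbrev νa (κ : ℝ) : Measure ℝ := wmeas volume fun s => Real.cosh s ^ κ

theorem memLp_tensor {κ : ℝ} {n g : ℝ → ℝ} (hn : MemLp n 2 νp) (hg : MemLp g 2 (νa κ)) :
    MemLp (fun z : ℝ × ℝ => g z.2 * n z.1) 2 (νw κ) ∧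
      nrm (νw κ) (fun z : ℝ × ℝ => g z.2 * n z.1) = nrm (νa κ) g * nrm νp n := by
  have hm : Measurable fun s : ℝ => Real.cosh s ^ κ := (contDiff_cosh_rpow κ).continuous.measurable
  have hp : ∀ s : ℝ, 0 < Real.cosh s ^ κ := fun s => Real.rpow_pos_of_pos (Real.cosh_pos s) κ
  obtain ⟨n1, n2⟩ := (memLp_wmeas measurable_p p_pos).1 hn
  obtain ⟨g1, g2⟩ := (memLp_wmeas hm hp).1 hg
  have e : ∀ z : ℝ × ℝ, (g z.2 * n z.1) ^ 2 * wt κ z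
      = (n z.1 ^ 2 * p z.1) * (g z.2 ^ 2 * Real.cosh z.2 ^ κ) := fun z => by unfold wt; ring
  have h1 : MemLp (fun z : ℝ × ℝ => g z.2 * n z.1) 2 (νw κ) := by
    refine (memLp_wmeas (measurable_wt κ) (wt_pos κ)).2 ⟨?_, ?_⟩
    · exact (g1.comp_snd (μ := volume)).mul (n1.comp_fst (ν := volume))
    · simp only [e]
      exact n2.mul_prod g2
  refine ⟨h1, ?_⟩
  have h2 : nrm (νw κ) (fun z : ℝ × ℝ => g z.2 * n z.1) ^ 2 = (nrm (νa κ) g * nrm νp n) ^ 2 := by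
    rw [mul_pow, ← integral_sq h1, ← integral_sq hn, ← integral_sq hg, integral_wmeas hm hp,
      integral_wmeas measurable_p p_pos, integral_wmeas (measurable_wt κ) (wt_pos κ),
      Measure.volume_eq_prod]
    simp only [e]
    rw [integral_prod_mul (fun t => n t ^ 2 * p t) (fun s => g s ^ 2 * Real.cosh s ^ κ)]
    ring
  have a1 := nrm_nonneg (νa κ) g
  have a2 := nrm_nonneg νp n
  exact (sq_eq_sq₀ (nrm_nonneg _ _) (by positivity)).1 h2

end LogPlane

namespace EulerLin

open Filter Topology LogPlane
open Polynomial (derivative)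

/-! ### The angular profile -/

theorem contDiff_G0 : ContDiff ℝ ∞ G0 := by
  unfold G0
  have h : ContDiff ℝ ∞ fun s => Real.arctan (Real.exp s) := Real.contDiff_arctan.comp Real.contDiff_exp
  exact (Real.contDiff_sin.comp h).mul ((Real.contDiff_cos.comp h).pow 2)

theorem contDiff_tanh : ContDiff ℝ ∞ Real.tanh := by
  rw [funext Real.tanh_eq_sinh_div_cosh]
  exact Real.contDiff_sinh.div Real.contDiff_cosh fun s => (Real.cosh_pos s).ne'

theorem hasDerivAt_tanh (s : ℝ) : HasDerivAt Real.tanh (1 - Real.tanh s ^ 2) s := by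
  have h := (Real.hasDerivAt_sinh s).div (Real.hasDerivAt_cosh s) (Real.cosh_pos s).ne'
  have e : Real.tanh = Real.sinh / Real.cosh := funext Real.tanh_eq_sinh_div_cosh
  rw [e]
  convert! h using 1
  have := (Real.cosh_pos s).ne'
  simp only [Pi.div_apply]
  field_simp

theorem G0_le_exp (s : ℝ) : G0 s ≤ Real.exp (-|s|) := by
  have h1 := sin_two_arctan_exp s
  rw [Real.sin_two_mul] at h1
  have h := arctan_exp_mem s
  have h2 := Real.cos_arctan_pos (Real.exp s)
  have h4 := Real.cos_le_one (Real.arctan (Real.exp s))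
  have h3 : (2 * Real.cosh s)⁻¹ ≤ Real.exp (-|s|) := by
    rw [Real.exp_neg]
    exact inv_anti₀ (Real.exp_pos _) (exp_abs_le_two_cosh s)
  have h5 := Real.sin_pos_of_pos_of_lt_pi h.1 (by linarith [h.2, Real.pi_pos])
  rw [mul_inv, ← h1] at h3
  refine le_trans ?_ h3
  unfold G0
  have h6 := mul_pos h5 h2
  nlinarith

/-- The polynomials in `tanh` that occur in the derivatives of the profile. -/
def Rp : ℕ → ℝ × ℝ → ℝ
  | 0 => fun z => -(1 + 3 * z.2) / 3
  | i + 1 => fun z => 2 * (1 - z.2 ^ 2) * vf 0 (fun _ => 1) (Rp i) z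
      + z.1 * (-(1 + 3 * z.2) / 3) * Rp i z

theorem contDiff_Rp (i : ℕ) : ContDiff ℝ ∞ (Rp i) := by
  induction i with
  | zero => unfold Rp; fun_prop
  | succ i ih =>
    have := contDiff_vf (a := 0) (b := fun _ => 1) contDiff_const ih
    unfold Rp
    fun_prop

/-- `D_θ^i Γ` in the variable `s = log tan θ`. -/
def Γd (α : ℝ) : ℕ → ℝ → ℝ
  | 0 => fun s => G0 s ^ (α / 3)
  | i + 1 => fun s => α * Rp i (α, Real.tanh s) * G0 s ^ (α / 3)

theorem contDiff_Γd (α : ℝ) (i : ℕ) : ContDiff ℝ ∞ (Γd α i) := by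
  have h0 : ContDiff ℝ ∞ fun s => G0 s ^ (α / 3) :=
    contDiff_G0.rpow_const_of_ne fun s => (G0_pos s).ne'
  cases i with
  | zero => exact h0
  | succ i =>
    have := (contDiff_Rp i).comp (contDiff_const.prodMk contDiff_tanh : ContDiff ℝ ∞ fun s => (α, Real.tanh s))
    exact (contDiff_const.mul this).mul h0

/-- Since G0'/G0 is a polynomial in tanh, differentiating G0^{α/3} produces a factor α and keeps the
form "polynomial in α and tanh s, times Γ". The ½ reflects D_θ = 2∂_s. -/
theorem deriv_Γd (α : ℝ) (i : ℕ) (s : ℝ) : deriv (Γd α i) s = 1 / 2 * Γd α (i + 1) s := by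
  have h0 : HasDerivAt (fun s => G0 s ^ (α / 3))
      (1 / 2 * (α * (-(1 + 3 * Real.tanh s) / 3) * G0 s ^ (α / 3))) s := by
    have h := (hasDerivAt_G0 s).rpow_const (p := α / 3) (Or.inl (G0_pos s).ne')
    convert! h using 1
    rw [Real.rpow_sub_one (G0_pos s).ne']
    have := (G0_pos s).ne'
    field_simp
  cases i with
  | zero =>
    refine Eq.trans h0.deriv ?_
    simp only [Γd, Rp]
  | succ i =>
    have h1 : HasDerivAt (fun s => Rp i (α, Real.tanh s))
        ((1 - Real.tanh s ^ 2) * vf 0 (fun _ => 1) (Rp i) (α, Real.tanh s)) s := by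
      have := ((contDiff_Rp i).differentiable (by simp) (α, Real.tanh s)).hasFDerivAt.comp_hasDerivAt s
        ((hasDerivAt_const s α).prodMk (hasDerivAt_tanh s))
      convert! this using 1
      rw [vf, ← smul_eq_mul, ← map_smul]
      simp
    refine Eq.trans ((h1.const_mul α).mul h0).deriv ?_
    simp only [Γd, Rp]
    ring

theorem Rp_bound (i : ℕ) : ∃ C : ℝ, 0 ≤ C ∧ ∀ α ∈ Icc (0 : ℝ) 1, ∀ s, |Rp i (α, Real.tanh s)| ≤ C := by
  obtain ⟨C, hC⟩ := ((isCompact_Icc (a := (0 : ℝ)) (b := 1)).prod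
    (isCompact_Icc (a := (-1 : ℝ)) (b := 1))).exists_bound_of_continuousOn (contDiff_Rp i).continuous.continuousOn
  refine ⟨max C 0, le_max_right _ _, fun α hα s => ?_⟩
  exact (hC (α, Real.tanh s) ⟨hα, abs_le.1 (abs_tanh_le s)⟩).trans (le_max_left _ _)

/-- The size of `D_θ^i Γ`. -/
def gsz (α : ℝ) (i : ℕ) : ℝ := if i = 0 then 1 else Real.sqrt α

theorem Γt_le {α : ℝ} (hα : 0 < α) (s : ℝ) : G0 s ^ (α / 3) ≤ Real.exp (-(α / 3) * |s|) := by
  calc G0 s ^ (α / 3) ≤ Real.exp (-|s|) ^ (α / 3) :=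
        Real.rpow_le_rpow (G0_pos s).le (G0_le_exp s) (by positivity)
    _ = _ := by rw [← Real.exp_mul]; ring_nf

/-- The source of all smallness in α. For i ≥ 1, |D_θ^i Γ| ≤ αB e^{−α|s|/3}; against cosh^{α/10} its
square is integrable with integral at most α²B²·4/α, so the norm is at most 2B√α. For i = 0 nothing
is small, but the weight cosh^{−1/100} alone is integrable. -/
theorem Γd_bound (i : ℕ) : ∃ C : ℝ, 0 ≤ C ∧ ∀ α : ℝ, 0 < α → α ≤ 1 / 10 →
    MemLp (Γd α i) 2 (νa (kap α i)) ∧ nrm (νa (kap α i)) (Γd α i) ≤ C * gsz α i := by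
  have main : ∀ (κ a B : ℝ), 0 < a → ∀ g : ℝ → ℝ, Continuous g →
      (∀ s, g s ^ 2 * Real.cosh s ^ κ ≤ B * Real.exp (-a * |s|)) →
      MemLp g 2 (νa κ) ∧ nrm (νa κ) g ^ 2 ≤ B * (2 / a) := by
    intro κ a B ha g hg hb
    have hm : Measurable fun s : ℝ => Real.cosh s ^ κ := (contDiff_cosh_rpow κ).continuous.measurable
    have hp : ∀ s : ℝ, 0 < Real.cosh s ^ κ := fun s => Real.rpow_pos_of_pos (Real.cosh_pos s) κ
    obtain ⟨i1, i2⟩ := integral_exp_neg_abs ha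
    have hi : Integrable fun s => g s ^ 2 * Real.cosh s ^ κ := by
      refine (i1.const_mul B).mono' ((hg.pow 2).mul (contDiff_cosh_rpow κ).continuous).aestronglyMeasurable
        (Eventually.of_forall fun s => ?_)
      rw [Real.norm_eq_abs, abs_of_nonneg (mul_nonneg (sq_nonneg _) (hp s).le)]
      exact hb s
    have h1 : MemLp g 2 (νa κ) := (memLp_wmeas hm hp).2 ⟨hg.aestronglyMeasurable, hi⟩
    refine ⟨h1, ?_⟩
    rw [← integral_sq h1, integral_wmeas hm hp, ← i2, ← integral_const_mul]
    exact integral_mono hi (i1.const_mul B) hb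
  cases i with
  | zero =>
    -- 20² = 400 = 2·(2/(1/100)), the value that `main` gives.
    refine ⟨20, by norm_num, fun α h0 h1 => ?_⟩
    obtain ⟨m1, m2⟩ := main (-(1 / 100)) (1 / 100) 2 (by norm_num) (Γd α 0)
      (contDiff_Γd α 0).continuous (fun s => by
        have e1 : Γd α 0 s ≤ 1 := Real.rpow_le_one (G0_pos s).le (G0_le_one s) (by positivity)
        have e2 : 0 < Γd α 0 s := Real.rpow_pos_of_pos (G0_pos s) _
        have e3 : Real.cosh s ^ (-(1 / 100) : ℝ) ≤ (Real.exp |s| / 2) ^ (-(1 / 100) : ℝ) :=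
          Real.rpow_le_rpow_of_nonpos (by positivity) (by linarith [exp_abs_le_two_cosh s]) (by norm_num)
        have e4 : (Real.exp |s| / 2) ^ (-(1 / 100) : ℝ) = 2 ^ (1 / 100 : ℝ) * Real.exp (-(1 / 100) * |s|) := by
          rw [Real.div_rpow (Real.exp_pos _).le (by norm_num), ← Real.exp_mul, Real.rpow_neg (by norm_num),
            div_inv_eq_mul]
          ring_nf
        have e5 : (2 : ℝ) ^ (1 / 100 : ℝ) ≤ 2 := by
          calc (2 : ℝ) ^ (1 / 100 : ℝ) ≤ 2 ^ (1 : ℝ) :=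
                Real.rpow_le_rpow_of_exponent_le (by norm_num) (by norm_num)
            _ = 2 := Real.rpow_one 2
        have e6 := Real.rpow_pos_of_pos (Real.cosh_pos s) (-(1 / 100))
        calc Γd α 0 s ^ 2 * Real.cosh s ^ (-(1 / 100) : ℝ) ≤ 1 ^ 2 * Real.cosh s ^ (-(1 / 100) : ℝ) := by gcongr
          _ ≤ _ := by
            rw [one_pow, one_mul]
            refine e3.trans (e4.le.trans ?_)
            gcongr)
    have hk : kap α 0 = -(1 / 100) := by simp [kap]
    rw [hk]
    refine ⟨m1, ?_⟩
    simp only [gsz, if_true, mul_one]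
    exact (abs_le_of_sq_le_sq' (by linarith) (by norm_num)).2
  | succ i =>
    obtain ⟨B, hB0, hB⟩ := Rp_bound i
    refine ⟨2 * B, by positivity, fun α h0 h1 => ?_⟩
    -- The rate is admissible because −2α/3 + α/10 ≤ −α/2.
    obtain ⟨m1, m2⟩ := main (α / 10) (α / 2) (α ^ 2 * B ^ 2) (by positivity) (Γd α (i + 1))
      (contDiff_Γd α (i + 1)).continuous (fun s => by
        have e1 := Γt_le h0 s
        have e2 : 0 < G0 s ^ (α / 3) := Real.rpow_pos_of_pos (G0_pos s) _
        have e3 := hB α ⟨h0.le, by linarith⟩ s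
        have e4 : Real.cosh s ^ (α / 10) ≤ Real.exp (α / 10 * |s|) := by
          calc Real.cosh s ^ (α / 10) ≤ Real.exp |s| ^ (α / 10) :=
                Real.rpow_le_rpow (Real.cosh_pos s).le (cosh_le_exp_abs s) (by positivity)
            _ = _ := by rw [← Real.exp_mul]; ring_nf
        have e5 := Real.rpow_pos_of_pos (Real.cosh_pos s) (α / 10)
        have e6 : |Γd α (i + 1) s| ≤ α * B * Real.exp (-(α / 3) * |s|) := by
          simp only [Γd]
          rw [abs_mul, abs_mul, abs_of_pos h0, abs_of_pos e2]
          gcongr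
        calc Γd α (i + 1) s ^ 2 * Real.cosh s ^ (α / 10)
            = |Γd α (i + 1) s| ^ 2 * Real.cosh s ^ (α / 10) := by rw [sq_abs]
          _ ≤ (α * B * Real.exp (-(α / 3) * |s|)) ^ 2 * Real.exp (α / 10 * |s|) := by gcongr
          _ = α ^ 2 * B ^ 2 * Real.exp (-(α / 3) * |s| + -(α / 3) * |s| + α / 10 * |s|) := by
            rw [Real.exp_add, Real.exp_add]; ring
          _ ≤ _ := by
            gcongr
            have := mul_nonneg h0.le (abs_nonneg s)
            nlinarith)
    have hk : kap α (i + 1) = α / 10 := by simp [kap]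
    rw [hk]
    refine ⟨m1, ?_⟩
    have hg : gsz α (i + 1) = Real.sqrt α := by simp [gsz]
    rw [hg]
    refine (abs_le_of_sq_le_sq' ?_ (by positivity)).2
    rw [mul_pow, Real.sq_sqrt h0.le]
    refine m2.trans (le_of_eq ?_)
    field_simp

theorem integrable_G0_kk (β : ℝ) (hβ : 0 ≤ β) : Integrable fun s => G0 s ^ β * kk s := by
  have hk : Integrable kk := by
    refine ((integral_exp_neg_abs (a := 1) one_pos).1.const_mul 3).mono'
      continuous_kk.aestronglyMeasurable (Eventually.of_forall fun s => ?_)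
    rw [Real.norm_eq_abs, abs_of_pos (kk_pos s)]
    simpa using kk_le s
  refine hk.bdd_mul (c := 1) ?_ (Eventually.of_forall fun s => ?_)
  · exact (contDiff_G0.rpow_const_of_ne fun s => (G0_pos s).ne' : ContDiff ℝ ∞ fun s => G0 s ^ β).continuous.aestronglyMeasurable
  · rw [Real.norm_eq_abs, abs_of_pos (Real.rpow_pos_of_pos (G0_pos s) _)]
    exact Real.rpow_le_one (G0_pos s).le (G0_le_one s) hβ

theorem c_eq (α : ℝ) : c α = ∫ s, Γd α 0 s * kk s := by
  rw [c, integral_angle]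
  refine integral_congr_ae (Eventually.of_forall fun s => ?_)
  simp only [Γ, K, Γd, kk, G0]
  ring

/-- A lower bound for the normalization constant. -/
def c₀ : ℝ := ∫ s, G0 s * kk s

theorem c₀_pos : 0 < c₀ := by
  have hi := integrable_G0_kk 1 zero_le_one
  simp only [Real.rpow_one] at hi
  refine (integral_pos_iff_support_of_nonneg (fun s => (mul_pos (G0_pos s) (kk_pos s)).le) hi).2 ?_
  have : Function.support (fun s => G0 s * kk s) = univ := by
    ext s
    simp [(G0_pos s).ne', (kk_pos s).ne']
  rw [this]
  simp

/-- G0 ≤ 1 and α/3 ≤ 1 give G0 ≤ G0^{α/3}. Thus 1/c is bounded uniformly in α. -/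
theorem c₀_le_c {α : ℝ} (h0 : 0 < α) (h1 : α ≤ 1 / 10) : c₀ ≤ c α := by
  rw [c_eq]
  have hi := integrable_G0_kk 1 zero_le_one
  simp only [Real.rpow_one] at hi
  refine integral_mono hi (integrable_G0_kk (α / 3) (by positivity)) fun s => ?_
  have hk := kk_pos s
  have : G0 s ≤ G0 s ^ (α / 3) := by
    calc G0 s = G0 s ^ (1 : ℝ) := (Real.rpow_one _).symm
      _ ≤ _ := Real.rpow_le_rpow_of_exponent_ge (G0_pos s) (G0_le_one s) (by linarith)
  exact mul_le_mul_of_nonneg_right this hk.le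

/-! ### The differentiated equations and their remainders -/

/-- Families of functions on the plane with the relations of `D_θ^i D_y^j f`. -/
structure Fam (α : ℝ) (k : ℕ) (u : ℕ → ℕ → ℝ × ℝ → ℝ) : Prop where
  memLp : ∀ i j, i + j ≤ k → MemLp (u i j) 2 (νw (kap α i))
  weakT : ∀ j, j < k → WeakT (u 0 j) (u 0 (j + 1))
  weakS : ∀ i j, i + j < k → WeakS (u i j) (fun z => 1 / 2 * u (i + 1) j z)

/-- D_θ^i D_y^j applies D_y first, so a family knows ∂_t only at i = 0. The mixed remainders also
need it at i = 1, which follows by applying 2∂_s. -/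
theorem Fam.weakT_one {α : ℝ} {k : ℕ} {u : ℕ → ℕ → ℝ × ℝ → ℝ} (h : Fam α k u) {j : ℕ}
    (hj : j + 1 < k) : WeakT (u 1 j) (u 1 (j + 1)) := by
  have h1 := Weak.derivS contDiff_const (h.weakT j (by omega)) (h.weakS 0 j (by omega))
    (h.weakS 0 (j + 1) (by omega))
  exact (h1.const_mul 2).congr' (fun z => by ring) (fun z => by ring)

/-- The repeated integrals and derivatives of the angular moment. -/
def mom (u : ℕ → ℕ → ℝ × ℝ → ℝ) : ℕ → ℝ → ℝ
  | 0 => fun t => ∫ r in Ioi t, fK (u 0 0) r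
  | l + 1 => fun t => -fK (u 0 l) t

/-- The value of `L₁₂` of the transport term at the origin. -/
def trMom (u : ℕ → ℕ → ℝ × ℝ → ℝ) : ℝ := ∫ t, 3 * q t * fK (u 1 0) t

/-- Lower order remainders of the `j`-th radial derivative of the equation. -/
inductive IsRem (j : ℕ) : (ℝ → ℝ → (ℕ → ℕ → ℝ × ℝ → ℝ) → ℕ → ℝ × ℝ → ℝ) → Prop
  | add {T T'} : IsRem j T → IsRem j T' → IsRem j fun α σ u i z => T α σ u i z + T' α σ u i z
  | radial (P : Polynomial ℝ) {l : ℕ} : l < j → IsRem j fun _ _ u i z => P.eval (q z.1) * u i l z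
  | mixed (P : Polynomial ℝ) {l : ℕ} : l < j →
      IsRem j fun _ σ u i z => P.eval (q z.1) * (σ * u (i + 1) l z)
  | moment (P : Polynomial ℝ) {l : ℕ} : l ≤ j →
      IsRem j fun α _ u i z => P.eval (q z.1) * (Γd α i z.2 * ((c α)⁻¹ * mom u l z.1))
  | origin (P : Polynomial ℝ) : IsRem j fun α σ u i z =>
      (Polynomial.X * (1 - Polynomial.X) ^ 2 * P).eval (q z.1) * (Γd α i z.2 * ((c α)⁻¹ * (σ * trMom u)))

/-- The derivation `d/dt` on polynomials in `q`. -/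
def dq (P : Polynomial ℝ) : Polynomial ℝ := -(Polynomial.X * (1 - Polynomial.X)) * derivative P

theorem contDiff_eval_q (P : Polynomial ℝ) : ContDiff ℝ ∞ fun t => P.eval (q t) := by
  simp only [Polynomial.eval_eq_sum_range]
  exact ContDiff.sum fun i _ => contDiff_const.mul (contDiff_q.pow i)

theorem deriv_eval_q (P : Polynomial ℝ) (t : ℝ) :
    deriv (fun t => P.eval (q t)) t = (dq P).eval (q t) := by
  have := (P.hasDerivAt (q t)).comp t (hasDerivAt_q t)
  refine this.deriv.trans ?_
  simp only [dq, Polynomial.eval_mul, Polynomial.eval_neg, Polynomial.eval_X, Polynomial.eval_sub,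
    Polynomial.eval_one]
  ring

theorem eval_q_bound (P : Polynomial ℝ) : ∃ C : ℝ, 0 ≤ C ∧ ∀ t, |P.eval (q t)| ≤ C := by
  obtain ⟨C, hC⟩ := (isCompact_Icc (a := (0 : ℝ)) (b := 1)).exists_bound_of_continuousOn
    P.continuous.continuousOn
  refine ⟨max C 0, le_max_right _ _, fun t => ?_⟩
  exact (hC (q t) ⟨(q_pos t).le, (q_lt_one t).le⟩).trans (le_max_left _ _)

theorem weakT_coeff (P : Polynomial ℝ) {u v : ℝ × ℝ → ℝ} (h : WeakT u v) :
    WeakT (fun z => P.eval (q z.1) * u z)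
      (fun z => (dq P).eval (q z.1) * u z + P.eval (q z.1) * v z) := by
  refine (h.mul contDiff_const ((contDiff_eval_q P).comp contDiff_fst)).congr' (fun _ => rfl)
    fun z => ?_
  have := vf_comp_fst (a := 1) (b := fun _ => 0) (contDiff_eval_q P) z
  simp only [Function.comp_def, this, deriv_eval_q, one_mul]

theorem weakS_coeff (P : Polynomial ℝ) {u v : ℝ × ℝ → ℝ} (h : WeakS u v) :
    WeakS (fun z => P.eval (q z.1) * u z) (fun z => P.eval (q z.1) * v z) := by
  refine (h.mul contDiff_const ((contDiff_eval_q P).comp contDiff_fst)).congr' (fun _ => rfl)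
    fun z => ?_
  have := vf_comp_fst (a := 0) (b := fun _ => 1) (contDiff_eval_q P) z
  simp only [Function.comp_def, this, zero_mul, zero_add]

theorem weakT_angle {g : ℝ → ℝ} (hg : ContDiff ℝ ∞ g) {u v : ℝ × ℝ → ℝ} (h : WeakT u v) :
    WeakT (fun z => g z.2 * u z) (fun z => g z.2 * v z) := by
  refine (h.mul contDiff_const (hg.comp contDiff_snd)).congr' (fun _ => rfl) fun z => ?_
  have := vf_comp_snd (a := 1) (b := fun _ => 0) hg z
  simp only [Function.comp_def, this, zero_mul, zero_add]

theorem weakS_Γd (α : ℝ) (i : ℕ) {u : ℝ × ℝ → ℝ} (h : WeakS u (fun _ => 0)) :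
    WeakS (fun z => Γd α i z.2 * u z) (fun z => 1 / 2 * (Γd α (i + 1) z.2 * u z)) := by
  refine (h.mul contDiff_const ((contDiff_Γd α i).comp contDiff_snd)).congr' (fun _ => rfl)
    fun z => ?_
  have := vf_comp_snd (a := 0) (b := fun _ => 1) (contDiff_Γd α i) z
  simp only [Function.comp_def, this, deriv_Γd]
  ring

/-- The hypotheses on the solution that the remainders need. -/
structure Sol (α σ : ℝ) (k : ℕ) (u : ℕ → ℕ → ℝ × ℝ → ℝ) : Prop where
  pos : 0 < α
  le : α ≤ 1 / 10
  abs_le : |σ| ≤ 1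
  one_le : 1 ≤ k
  fam : Fam α k u
  int : ∫ t, fK (u 0 0) t = 0

section

variable {α σ : ℝ} {k : ℕ} {u : ℕ → ℕ → ℝ × ℝ → ℝ}

theorem Sol.kap (h : Sol α σ k u) (i : ℕ) : |kap α i| ≤ 1 / 100 := abs_kap_le h.pos h.le i

theorem Sol.memLp_moment (h : Sol α σ k u) {l : ℕ} (hl : l ≤ k) : MemLp (fK (u 0 l)) 2 νp :=
  (memLp_fK (h.kap 0) (h.fam.memLp 0 l (by omega))).1

theorem Sol.mom_zero_eq_hardy (h : Sol α σ k u) : mom u 0 = hardy (fK (u 0 0)) :=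
  funext fun t => (hardy_of_integral_eq_zero
    (integrable_of_memLp (h.memLp_moment (Nat.zero_le k))) h.int t).symm

theorem Sol.mom_zero_eq (h : Sol α σ k u) (t : ℝ) : mom u 0 t = -∫ r in Iic t, fK (u 0 0) r := by
  rw [show mom u 0 t = ∫ r in Ioi t, fK (u 0 0) r from rfl, integral_Ioi_eq_sub (integrable_of_memLp (h.memLp_moment (Nat.zero_le k))), h.int,
    zero_sub]

theorem Sol.memLp_mom (h : Sol α σ k u) {l : ℕ} (hl : l ≤ k + 1) : MemLp (mom u l) 2 νp := by
  cases l with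
  | zero =>
    rw [h.mom_zero_eq_hardy]
    exact memLp_hardy (h.memLp_moment (Nat.zero_le k))
  | succ l => exact (h.memLp_moment (by omega)).neg

theorem Sol.weakT_mom (h : Sol α σ k u) {l : ℕ} (hl : l ≤ k) :
    WeakT (fun z => mom u l z.1) (fun z => mom u (l + 1) z.1) := by
  refine weakT_fst (integrable_of_memLp (h.memLp_mom (by omega))) (Eventually.mono (?_ : ∀ᵐ t, _) fun t ht => ht)
  cases l with
  | zero =>
    refine Eventually.of_forall fun t => ?_
    rw [h.mom_zero_eq]
    simp only [mom, integral_neg]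
  | succ l =>
    have := (fK_weakT (h.kap 0) (h.fam.weakT l (by omega)) (h.fam.memLp 0 l (by omega))
      (h.fam.memLp 0 (l + 1) (by omega))).1
    filter_upwards [this] with t ht
    simp only [mom, integral_neg, ht]

theorem Sol.weakS_mom (h : Sol α σ k u) {l : ℕ} (hl : l ≤ k + 1) :
    WeakS (fun z => mom u l z.1) (fun _ => 0) :=
  weakS_fst (integrable_of_memLp (h.memLp_mom hl)).locallyIntegrable

end

/-- The coefficients and the moments depend on t alone, so 2∂_s merely raises the index i, including
that of D_θ^i Γ. -/
theorem IsRem.weakS {j : ℕ} {T} (hT : IsRem j T) {α σ : ℝ} {k : ℕ} {u : ℕ → ℕ → ℝ × ℝ → ℝ}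
    (h : Sol α σ k u) {i : ℕ} (hi : i + j < k) :
    WeakS (T α σ u i) (fun z => 1 / 2 * T α σ u (i + 1) z) := by
  induction hT with
  | add _ _ h1 h2 => exact (h1.add contDiff_const h2).congr' (fun z => rfl) (fun z => by ring)
  | radial P hl =>
    exact (weakS_coeff P (h.fam.weakS i _ (by omega))).congr' (fun z => rfl) (fun z => by ring)
  | mixed P hl =>
    exact (weakS_coeff P ((h.fam.weakS (i + 1) _ (by omega)).const_mul σ)).congr' (fun z => rfl)
      (fun z => by ring)
  | moment P hl =>
    refine (weakS_coeff P (weakS_Γd α i (u := fun z => (c α)⁻¹ * mom u _ z.1) ?_)).congr'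
      (fun z => rfl) (fun z => by ring)
    exact ((h.weakS_mom (by omega)).const_mul (c α)⁻¹).congr' (fun z => rfl) (fun z => by ring)
  | origin P =>
    exact (weakS_coeff _ (weakS_Γd α i (weak_const ((c α)⁻¹ * (σ * trMom u))).2)).congr'
      (fun z => rfl) (fun z => by ring)

/-- The class is closed under ∂_t: d/dt maps polynomials in q to polynomials in q, and the other
factors move up one radial order. `T'` is found before α, σ, k and `u`, which keeps later constants
uniform. -/
theorem IsRem.weakT {j : ℕ} {T} (hT : IsRem j T) : ∃ T', IsRem (j + 1) T' ∧
    ∀ {α σ : ℝ} {k : ℕ} {u : ℕ → ℕ → ℝ × ℝ → ℝ}, Sol α σ k u → j < k →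
      WeakT (T α σ u 0) (T' α σ u 0) := by
  induction hT with
  | add _ _ h1 h2 =>
    obtain ⟨T1, a1, b1⟩ := h1
    obtain ⟨T2, a2, b2⟩ := h2
    exact ⟨_, a1.add a2, fun h hj => (b1 h hj).add contDiff_const (b2 h hj)⟩
  | radial P hl =>
    exact ⟨_, (IsRem.radial (dq P) (by omega)).add (IsRem.radial P (Nat.succ_lt_succ hl)),
      fun h hj => weakT_coeff P (h.fam.weakT _ (by omega))⟩
  | mixed P hl =>
    exact ⟨_, (IsRem.mixed (dq P) (by omega)).add (IsRem.mixed P (Nat.succ_lt_succ hl)),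
      fun h hj => weakT_coeff P ((h.fam.weakT_one (by omega)).const_mul _)⟩
  | moment P hl =>
    exact ⟨_, (IsRem.moment (dq P) (by omega)).add (IsRem.moment P (Nat.succ_le_succ hl)),
      fun {α σ k u} h hj => weakT_coeff P (weakT_angle (contDiff_Γd α 0)
        ((h.weakT_mom (by omega)).const_mul _))⟩
  | origin P =>
    -- The factor X(1−X)² must survive differentiation, because a bounded multiple of a constant
    -- need not lie in L²(p). It does survive, since `dq` of a multiple of it is again a multiple.
    refine ⟨_, IsRem.origin (-((1 - Polynomial.X) * P - 2 * Polynomial.X * P + Polynomial.X * (1 - Polynomial.X) * derivative P)),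
      fun {α σ k u} h hj => (weakT_coeff (Polynomial.X * (1 - Polynomial.X) ^ 2 * P) (weakT_angle (contDiff_Γd α 0)
        (weak_const ((c α)⁻¹ * (σ * trMom u))).1)).congr' (fun z => rfl) fun z => ?_⟩
    have : dq (Polynomial.X * (1 - Polynomial.X) ^ 2 * P)
        = Polynomial.X * (1 - Polynomial.X) ^ 2 * (-((1 - Polynomial.X) * P - 2 * Polynomial.X * P + Polynomial.X * (1 - Polynomial.X) * derivative P)) := by
      simp only [dq, Polynomial.derivative_mul, Polynomial.derivative_pow, Polynomial.derivative_sub,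
        Polynomial.derivative_one, Polynomial.derivative_X]
      simp only [Nat.cast_ofNat, map_ofNat]
      ring
    rw [this]
    ring

/-- The equation `𝓛 f = g` in the plane. -/
structure Sys (α σ : ℝ) (k : ℕ) (u G : ℕ → ℕ → ℝ × ℝ → ℝ) : Prop extends Sol α σ k u where
  famG : Fam α k G
  eq : ∀ᵐ z, G 0 0 z = u 0 0 z + u 0 1 z - 2 * q z.1 * u 0 0 z
    - Γd α 0 z.2 * (c α)⁻¹ * (2 * q z.1 * (1 - q z.1)) * mom u 0 z.1
    + σ * (3 * q z.1 * u 1 0 z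
      - Γd α 0 z.2 * (c α)⁻¹ * (2 * q z.1 * (1 - q z.1) ^ 2) * trMom u)

/-- Angular derivatives commute with the field and with 2q, so they create no new remainder. -/
theorem IsRem.weak_succ {j : ℕ} {T} (hT : IsRem j T) {α σ : ℝ} {k : ℕ}
    {u G : ℕ → ℕ → ℝ × ℝ → ℝ} (h : Sys α σ k u G)
    (h0 : Weak 1 (spd σ) (u 0 j)
      (fun z => G 0 j z - u 0 j z + 2 * q z.1 * u 0 j z - T α σ u 0 z)) (i : ℕ) (hi : i + j ≤ k) :
    Weak 1 (spd σ) (u i j)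
      (fun z => G i j z - u i j z + 2 * q z.1 * u i j z - T α σ u i z) := by
  induction i with
  | zero => exact h0
  | succ i ih =>
    have hu := h.fam.weakS i j (by omega)
    have hq := weakS_coeff (2 * Polynomial.X) hu
    have hv := (((h.famG.weakS i j (by omega)).add contDiff_const (hu.const_mul (-1))).add
      contDiff_const hq).add contDiff_const ((hT.weakS h.toSol (i := i) (by omega)).const_mul (-1))
    have := Weak.derivS (contDiff_spd σ) (ih (by omega)) hu (hv.congr'
      (fun z => by simp only [Polynomial.eval_mul, Polynomial.eval_X, Polynomial.eval_ofNat]; ring)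
      (fun z => rfl))
    refine (this.const_mul 2).congr' (fun z => by ring) (fun z => ?_)
    simp only [Polynomial.eval_mul, Polynomial.eval_X, Polynomial.eval_ofNat]
    ring

/-- At j = 0 the remainder consists of the two nonlocal terms. Each ∂_t adds the commutators with 2q
and with the speed 6σq; both have smaller radial order, the second with one more angular derivative.
-/
theorem exists_remainder (j : ℕ) : ∃ T, IsRem j T ∧
    ∀ {α σ : ℝ} {k : ℕ} {u G : ℕ → ℕ → ℝ × ℝ → ℝ}, Sys α σ k u G → ∀ i, i + j ≤ k →
      Weak 1 (spd σ) (u i j) (fun z => G i j z - u i j z + 2 * q z.1 * u i j z - T α σ u i z) := by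
  induction j with
  | zero =>
    refine ⟨_, (IsRem.moment (-(2 * Polynomial.X * (1 - Polynomial.X))) le_rfl).add (IsRem.origin (-2)), fun {α σ k u G} h => ?_⟩
    refine ((IsRem.moment (-(2 * Polynomial.X * (1 - Polynomial.X))) le_rfl).add
      (IsRem.origin (-2))).weak_succ h ?_
    have hk := h.one_le
    refine (Weak.field (contDiff_spd σ) (h.fam.weakT 0 (by omega)) (h.fam.weakS 0 0 (by omega))).congr
      (EventuallyEq.refl _ _) ?_
    filter_upwards [h.eq] with z hz
    simp only [hz, spd, Polynomial.eval_mul, Polynomial.eval_X, Polynomial.eval_ofNat,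
      Polynomial.eval_neg, Polynomial.eval_sub, Polynomial.eval_one, Polynomial.eval_pow]
    ring
  | succ j ih =>
    obtain ⟨T, hT, hw⟩ := ih
    obtain ⟨T', hT', hd⟩ := hT.weakT
    -- 2q(1−q) is −∂_t(2q). In the mixed term 3q(1−q) is half of −∂_t(6q), because ∂_s is half of
    -- D_θ.
    refine ⟨_, (hT'.add (IsRem.radial (2 * Polynomial.X * (1 - Polynomial.X)) (Nat.lt_succ_self j))).add
      (IsRem.mixed (-(3 * Polynomial.X * (1 - Polynomial.X))) (Nat.lt_succ_self j)), fun {α σ k u G} h i hi => ?_⟩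
    refine ((hT'.add (IsRem.radial (2 * Polynomial.X * (1 - Polynomial.X)) (Nat.lt_succ_self j))).add
      (IsRem.mixed (-(3 * Polynomial.X * (1 - Polynomial.X))) (Nat.lt_succ_self j))).weak_succ h ?_ i hi
    have hu := h.fam.weakT j (by omega)
    have hv := (((h.famG.weakT j (by omega)).add contDiff_const (hu.const_mul (-1))).add
      contDiff_const (weakT_coeff (2 * Polynomial.X) hu)).add contDiff_const
      ((hd h.toSol (by omega)).const_mul (-1))
    have := Weak.derivT (contDiff_spd σ) (hw h 0 (by omega)) hu (hv.congr'
      (fun z => by simp only [Polynomial.eval_mul, Polynomial.eval_X, Polynomial.eval_ofNat]; ring)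
      (fun z => rfl)) (h.fam.weakS 0 j (by omega))
    refine this.congr' (fun z => rfl) fun z => ?_
    have e : deriv (spd σ) z.1 = 6 * σ * (-(q z.1 * (1 - q z.1))) :=
      ((hasDerivAt_q z.1).const_mul (6 * σ)).deriv
    simp only [e, dq, Polynomial.eval_mul, Polynomial.eval_X, Polynomial.eval_ofNat,
      Polynomial.eval_neg, Polynomial.eval_sub, Polynomial.eval_one, Polynomial.derivative_mul,
      Polynomial.derivative_X, Polynomial.derivative_ofNat, zero_mul, zero_add, mul_one]
    ring

/-! ### Bounds for the remainders, uniform in α -/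

theorem memLp_mono {κ κ' : ℝ} (h : κ ≤ κ') {u : ℝ × ℝ → ℝ} (hu : MemLp u 2 (νw κ')) :
    MemLp u 2 (νw κ) ∧ nrm (νw κ) u ≤ nrm (νw κ') u := by
  have hle : ∀ z, wt κ z ≤ wt κ' z := fun z =>
    mul_le_mul_of_nonneg_left (Real.rpow_le_rpow_of_exponent_le (Real.one_le_cosh _) h) (p_pos _).le
  have hν : νw κ ≤ νw κ' :=
    withDensity_mono (Eventually.of_forall fun z => ENNReal.ofReal_le_ofReal (hle z))
  exact ⟨hu.mono_measure hν, ENNReal.toReal_mono hu.2.ne (eLpNorm_mono_measure u hν)⟩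

/-- Lets a term with one more D_θ be measured in the weaker weight of the row where it appears as a
commutator. -/
theorem kap_le_succ {α : ℝ} (h : 0 < α) (i : ℕ) : kap α i ≤ kap α (i + 1) := by
  unfold kap
  split_ifs <;> simp_all
  linarith

/-- The norm of the `(i, j)` member of a family. -/
def sz (α : ℝ) (u : ℕ → ℕ → ℝ × ℝ → ℝ) (i j : ℕ) : ℝ := nrm (νw (kap α i)) (u i j)

/-- The norm of the integrated angular moment. -/
def szF (u : ℕ → ℕ → ℝ × ℝ → ℝ) : ℝ := nrm νp (mom u 0)

theorem sz_nonneg (α : ℝ) (u : ℕ → ℕ → ℝ × ℝ → ℝ) (i j : ℕ) : 0 ≤ sz α u i j := nrm_nonneg _ _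

theorem szF_nonneg (u : ℕ → ℕ → ℝ × ℝ → ℝ) : 0 ≤ szF u := nrm_nonneg _ _

theorem gsz_nonneg (α : ℝ) (i : ℕ) : 0 ≤ gsz α i := by
  unfold gsz
  split_ifs
  · exact zero_le_one
  · exact Real.sqrt_nonneg _

/-- The quantity that controls remainders. -/
def low (α : ℝ) (u : ℕ → ℕ → ℝ × ℝ → ℝ) (i j : ℕ) : ℝ :=
  ∑ l ∈ Finset.range j, (sz α u i l + sz α u (i + 1) l)
    + gsz α i * (szF u + ∑ l ∈ Finset.range j, sz α u 0 l + sz α u 1 0)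

theorem sz_le_low (α : ℝ) (u : ℕ → ℕ → ℝ × ℝ → ℝ) (i : ℕ) {j l : ℕ} (hl : l < j) :
    sz α u i l + sz α u (i + 1) l ≤ low α u i j := by
  have h1 : sz α u i l + sz α u (i + 1) l
      ≤ ∑ l ∈ Finset.range j, (sz α u i l + sz α u (i + 1) l) :=
    Finset.single_le_sum (f := fun l => sz α u i l + sz α u (i + 1) l)
      (fun _ _ => add_nonneg (sz_nonneg ..) (sz_nonneg ..)) (Finset.mem_range.2 hl)
  have h2 := mul_nonneg (gsz_nonneg α i) (add_nonneg (add_nonneg (szF_nonneg u)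
      (Finset.sum_nonneg fun l (_ : l ∈ Finset.range j) => sz_nonneg α u 0 l)) (sz_nonneg α u 1 0))
  unfold low
  linarith

theorem gsz_mul_le_low (α : ℝ) (u : ℕ → ℕ → ℝ × ℝ → ℝ) (i j : ℕ) :
    gsz α i * (szF u + ∑ l ∈ Finset.range j, sz α u 0 l + sz α u 1 0) ≤ low α u i j := by
  have : 0 ≤ ∑ l ∈ Finset.range j, (sz α u i l + sz α u (i + 1) l) :=
    Finset.sum_nonneg fun _ _ => add_nonneg (sz_nonneg ..) (sz_nonneg ..)
  unfold low
  linarith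

theorem memLp_coeff {E : Type*} [MeasurableSpace E] {ν : Measure E} {g u : E → ℝ} {C : ℝ}
    (hg : AEStronglyMeasurable g ν) (hC : 0 ≤ C) (h : ∀ x, |g x| ≤ C) (hu : MemLp u 2 ν) :
    MemLp (fun x => g x * u x) 2 ν ∧ nrm ν (fun x => g x * u x) ≤ C * nrm ν u := by
  have hb : ∀ x, |g x * u x| ≤ C * |u x| := fun x => by
    rw [abs_mul]
    exact mul_le_mul_of_nonneg_right (h x) (abs_nonneg _)
  exact ⟨memLp_of_bound hu (hg.mul hu.1) hb, nrm_le_of_bound hC hu hb⟩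

theorem memLp_poly {κ : ℝ} (P : Polynomial ℝ) {C : ℝ} (hC : 0 ≤ C) (h : ∀ t, |P.eval (q t)| ≤ C)
    {u : ℝ × ℝ → ℝ} (hu : MemLp u 2 (νw κ)) :
    MemLp (fun z => P.eval (q z.1) * u z) 2 (νw κ) ∧
      nrm (νw κ) (fun z => P.eval (q z.1) * u z) ≤ C * nrm (νw κ) u :=
  memLp_coeff ((contDiff_eval_q P).continuous.comp continuous_fst).aestronglyMeasurable hC
    (fun z => h z.1) hu

theorem q_mul_one_sub_le (t : ℝ) : q t * (1 - q t) ≤ Real.exp (-1 * |t|) := by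
  have h0 := Real.exp_pos t
  have e : q t * (1 - q t) = Real.exp t / (1 + Real.exp t) ^ 2 := by
    rw [one_sub_q, q]
    field_simp
  rw [e, neg_one_mul]
  rcases le_total 0 t with h | h
  · rw [abs_of_nonneg h, Real.exp_neg, div_le_iff₀ (by positivity), ← div_eq_inv_mul,
      le_div_iff₀ h0]
    nlinarith
  · rw [abs_of_nonpos h, neg_neg, div_le_iff₀ (by positivity)]
    nlinarith [mul_pos h0 h0, mul_pos h0 (mul_pos h0 h0)]

/-- The radial profile of the correction at the origin. -/
def prof (t : ℝ) : ℝ := q t * (1 - q t) ^ 2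

/-- prof² p equals q(1−q), which decays at both ends. -/
theorem memLp_prof : MemLp prof 2 νp := by
  have hc : Continuous prof := by have := continuous_q; unfold prof; fun_prop
  refine (memLp_wmeas measurable_p p_pos).2 ⟨hc.aestronglyMeasurable, ?_⟩
  refine (integral_exp_neg_abs (a := 1) one_pos).1.mono'
    ((hc.pow 2).mul continuous_p).aestronglyMeasurable (Eventually.of_forall fun t => ?_)
  rw [Real.norm_eq_abs, abs_of_nonneg (mul_nonneg (sq_nonneg _) (p_pos t).le)]
  refine le_trans (le_of_eq ?_) (q_mul_one_sub_le t)
  have h0 := Real.exp_pos t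
  have e3 : Real.exp (-3 * t) = (Real.exp t ^ 3)⁻¹ := by
    rw [← Real.exp_nat_mul, ← Real.exp_neg]
    push_cast
    ring_nf
  rw [prof, one_sub_q, q, p, e3]
  field_simp

theorem memLp_inv_p : MemLp (fun t => (p t)⁻¹) 2 νp := by
  have hc : Continuous fun t => (p t)⁻¹ := continuous_p.inv₀ fun t => (p_pos t).ne'
  refine (memLp_wmeas measurable_p p_pos).2 ⟨hc.aestronglyMeasurable, ?_⟩
  refine integrable_inv_p.congr (Eventually.of_forall fun t => ?_)
  have := (p_pos t).ne'
  simp only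
  field_simp

theorem abs_integral_le_nrm {n : ℝ → ℝ} (hn : MemLp n 2 νp) :
    |∫ t, n t| ≤ nrm νp (fun t => (p t)⁻¹) * nrm νp n := by
  have := abs_integral_mul_le memLp_inv_p hn
  rw [integral_wmeas measurable_p p_pos] at this
  convert! this using 3
  ext t
  have := (p_pos t).ne'
  field_simp

theorem memLp_q_mul {n : ℝ → ℝ} (hn : MemLp n 2 νp) :
    MemLp (fun t => 3 * q t * n t) 2 νp ∧ nrm νp (fun t => 3 * q t * n t) ≤ 3 * nrm νp n :=
  memLp_coeff (continuous_const.mul continuous_q).aestronglyMeasurable (by norm_num) (fun t => by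
    have h1 := q_pos t
    have h2 := q_lt_one t
    rw [abs_of_pos (by positivity)]
    linarith) hn

theorem exists_trMom_le : ∃ C : ℝ, 0 ≤ C ∧ ∀ {α σ : ℝ} {k : ℕ} {u : ℕ → ℕ → ℝ × ℝ → ℝ},
    Sol α σ k u → |trMom u| ≤ C * sz α u 1 0 := by
  refine ⟨nrm νp (fun t => (p t)⁻¹) * 15, mul_nonneg (nrm_nonneg _ _) (by norm_num),
    fun {α σ k u} h => ?_⟩
  have hk := h.one_le
  obtain ⟨h1, h2⟩ := memLp_fK (h.kap 1) (h.fam.memLp 1 0 (by omega))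
  obtain ⟨h3, h4⟩ := memLp_q_mul h1
  refine (abs_integral_le_nrm h3).trans ?_
  rw [mul_assoc]
  refine mul_le_mul_of_nonneg_left ?_ (nrm_nonneg _ _)
  unfold sz
  linarith

theorem Sol.inv_c {α σ : ℝ} {k : ℕ} {u : ℕ → ℕ → ℝ × ℝ → ℝ} (h : Sol α σ k u) :
    0 < (c α)⁻¹ ∧ (c α)⁻¹ ≤ c₀⁻¹ := by
  have := c₀_le_c h.pos h.le
  have h0 := c₀_pos
  exact ⟨inv_pos.2 (by linarith), inv_anti₀ h0 this⟩

/-- Radial and mixed terms are bounded by lower radial orders. Moment and origin terms carry D_θ^i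
Γ, hence the factor `gsz`; the moment of index l + 1 ≤ j involves only D_y^l f with l < j. -/
theorem IsRem.bound {j : ℕ} {T} (hT : IsRem j T) (i : ℕ) : ∃ C : ℝ, 0 ≤ C ∧
    ∀ {α σ : ℝ} {k : ℕ} {u : ℕ → ℕ → ℝ × ℝ → ℝ}, Sol α σ k u → i + j ≤ k →
      MemLp (T α σ u i) 2 (νw (kap α i)) ∧ nrm (νw (kap α i)) (T α σ u i) ≤ C * low α u i j := by
  induction hT with
  | add _ _ h1 h2 =>
    obtain ⟨C1, p1, b1⟩ := h1
    obtain ⟨C2, p2, b2⟩ := h2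
    refine ⟨C1 + C2, add_nonneg p1 p2, fun h hj => ?_⟩
    obtain ⟨m1, n1⟩ := b1 h hj
    obtain ⟨m2, n2⟩ := b2 h hj
    refine ⟨m1.add m2, (nrm_add_le m1 m2).trans ?_⟩
    rw [add_mul]
    exact add_le_add n1 n2
  | radial P hl =>
    rename_i l
    obtain ⟨C, hC, hP⟩ := eval_q_bound P
    refine ⟨C, hC, fun {α σ k u} h hj => ?_⟩
    obtain ⟨m1, n1⟩ := memLp_poly P hC hP (h.fam.memLp i l (by omega))
    refine ⟨m1, n1.trans (mul_le_mul_of_nonneg_left ?_ hC)⟩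
    have := sz_le_low α u i hl
    exact (le_add_of_nonneg_right (sz_nonneg ..)).trans this
  | mixed P hl =>
    rename_i l
    obtain ⟨C, hC, hP⟩ := eval_q_bound P
    refine ⟨C, hC, fun {α σ k u} h hj => ?_⟩
    obtain ⟨m0, n0⟩ := memLp_mono (kap_le_succ h.pos i) (h.fam.memLp (i + 1) l (by omega))
    obtain ⟨m1, n1⟩ := memLp_poly P hC hP (m0.const_mul σ)
    refine ⟨m1, n1.trans (mul_le_mul_of_nonneg_left ?_ hC)⟩
    have := sz_le_low α u i hl
    rw [nrm_const_mul]
    have h2 := mul_le_mul h.abs_le n0 (nrm_nonneg _ _) zero_le_one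
    have h3 := sz_nonneg α u i l
    unfold sz at *
    linarith
  | moment P hl =>
    rename_i l
    obtain ⟨C, hC, hP⟩ := eval_q_bound P
    obtain ⟨B, hB, hΓ⟩ := Γd_bound i
    refine ⟨C * (B * (c₀⁻¹ * 5)), by have := c₀_pos; positivity, fun {α σ k u} h hj => ?_⟩
    obtain ⟨g1, g2⟩ := hΓ α h.pos h.le
    obtain ⟨c1, c2⟩ := h.inv_c
    have hm := h.memLp_mom (l := l) (by omega)
    obtain ⟨m0, n0⟩ := memLp_tensor (hm.const_mul (c α)⁻¹) g1
    obtain ⟨m1, n1⟩ := memLp_poly P hC hP m0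
    refine ⟨m1, n1.trans ?_⟩
    rw [n0, nrm_const_mul, abs_of_pos c1, mul_assoc, mul_assoc, mul_assoc]
    refine mul_le_mul_of_nonneg_left ?_ hC
    have hS : nrm νp (mom u l) ≤ 5 * (szF u + ∑ l ∈ Finset.range j, sz α u 0 l + sz α u 1 0) := by
      have hs : ∀ j, 0 ≤ ∑ l ∈ Finset.range j, sz α u 0 l := fun j =>
        Finset.sum_nonneg fun _ _ => sz_nonneg ..
      cases l with
      | zero =>
        have := szF_nonneg u
        have h1 := sz_nonneg α u 1 0
        have := hs j
        change szF u ≤ _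
        linarith
      | succ l =>
        have h1 := (memLp_fK (h.kap 0) (h.fam.memLp 0 l (by omega))).2
        have h2 : nrm νp (mom u (l + 1)) = nrm νp (fK (u 0 l)) := by
          have := nrm_const_mul (ν := νp) (-1) (fK (u 0 l))
          simpa [mom] using this
        have h3 : sz α u 0 l ≤ ∑ l ∈ Finset.range j, sz α u 0 l :=
          Finset.single_le_sum (f := fun l => sz α u 0 l) (fun _ _ => sz_nonneg ..)
            (Finset.mem_range.2 hl)
        have := szF_nonneg u
        have h4 := sz_nonneg α u 1 0
        unfold sz at h1 h3 h4 ⊢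
        linarith
    calc nrm (νa (kap α i)) (Γd α i) * ((c α)⁻¹ * nrm νp (mom u l))
        ≤ (B * gsz α i) * (c₀⁻¹ * (5 * (szF u + ∑ l ∈ Finset.range j, sz α u 0 l + sz α u 1 0))) := by
          gcongr
          · exact mul_nonneg c1.le (nrm_nonneg _ _)
          · exact mul_nonneg hB (gsz_nonneg _ _)
          · exact nrm_nonneg _ _
          · exact inv_nonneg.2 c₀_pos.le
      _ = B * (c₀⁻¹ * (5 * (gsz α i * (szF u + ∑ l ∈ Finset.range j, sz α u 0 l + sz α u 1 0)))) := by ring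
      _ ≤ _ := by
          have := c₀_pos
          gcongr
          exact gsz_mul_le_low α u i j
  | origin P =>
    obtain ⟨C, hC, hP⟩ := eval_q_bound P
    obtain ⟨B, hB, hΓ⟩ := Γd_bound i
    obtain ⟨Z, hZ, hz⟩ := exists_trMom_le
    refine ⟨C * (B * (c₀⁻¹ * Z * nrm νp prof)), by
      have := c₀_pos; have := nrm_nonneg νp prof; positivity, fun {α σ k u} h hj => ?_⟩
    obtain ⟨g1, g2⟩ := hΓ α h.pos h.le
    obtain ⟨c1, c2⟩ := h.inv_c
    obtain ⟨m0, n0⟩ := memLp_tensor (memLp_prof.const_mul ((c α)⁻¹ * (σ * trMom u))) g1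
    obtain ⟨m1, n1⟩ := memLp_poly P hC hP m0
    have e : (fun z : ℝ × ℝ => (Polynomial.X * (1 - Polynomial.X) ^ 2 * P).eval (q z.1)
        * (Γd α i z.2 * ((c α)⁻¹ * (σ * trMom u)))) = fun z => P.eval (q z.1)
        * (Γd α i z.2 * ((c α)⁻¹ * (σ * trMom u) * prof z.1)) := by
      ext z
      simp only [Polynomial.eval_mul, Polynomial.eval_X, Polynomial.eval_pow, Polynomial.eval_sub,
        Polynomial.eval_one, prof]
      ring
    beta_reduce
    rw [e]
    refine ⟨m1, n1.trans ?_⟩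
    rw [n0, nrm_const_mul, mul_assoc]
    refine mul_le_mul_of_nonneg_left ?_ hC
    have h1 : |(c α)⁻¹ * (σ * trMom u)| ≤ c₀⁻¹ * (1 * (Z * sz α u 1 0)) := by
      rw [abs_mul, abs_mul, abs_of_pos c1]
      have := c₀_pos
      have := h.abs_le
      have := hz h
      gcongr
    have h2 : gsz α i * sz α u 1 0 ≤ low α u i j := by
      refine le_trans ?_ (gsz_mul_le_low α u i j)
      refine mul_le_mul_of_nonneg_left ?_ (gsz_nonneg _ _)
      have := szF_nonneg u
      have hs : 0 ≤ ∑ l ∈ Finset.range j, sz α u 0 l := Finset.sum_nonneg fun _ _ => sz_nonneg ..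
      linarith
    have hp := nrm_nonneg νp prof
    calc nrm (νa (kap α i)) (Γd α i) * (|(c α)⁻¹ * (σ * trMom u)| * nrm νp prof)
        ≤ (B * gsz α i) * (c₀⁻¹ * (1 * (Z * sz α u 1 0)) * nrm νp prof) := by
          gcongr
          exact mul_nonneg hB (gsz_nonneg _ _)
      _ = B * (c₀⁻¹ * Z * nrm νp prof) * (gsz α i * sz α u 1 0) := by ring
      _ ≤ _ := by
          have := c₀_pos
          rw [← mul_assoc B, ← mul_assoc B]
          gcongr

/-! ### Energy estimates for single rows -/

/-- The pairing of the `(i, j)` members of two families. -/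
def pair (α : ℝ) (G u : ℕ → ℕ → ℝ × ℝ → ℝ) (i j : ℕ) : ℝ :=
  ∫ z, G i j z * u i j z ∂(νw (kap α i))

/-- The pairing of the transformed angular moments. -/
def pairF (G u : ℕ → ℕ → ℝ × ℝ → ℝ) : ℝ :=
  ∫ t, hardy (fK (G 0 0)) t * hardy (fK (u 0 0)) t ∂νp

/-- In `energy_transport` the two integrals with 2q cancel. What remains is ½, minus 3/100 for the
transport acting on the angular weight, and ½ − 3/100 ≥ 2/5. -/
theorem Sys.weak_lower {α σ : ℝ} {k : ℕ} {u G : ℕ → ℕ → ℝ × ℝ → ℝ} (h : Sys α σ k u G)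
    {i j : ℕ} (hij : i + j ≤ k) {R : ℝ × ℝ → ℝ} (hR : MemLp R 2 (νw (kap α i)))
    (hw : Weak 1 (spd σ) (u i j) (fun z => G i j z - u i j z + 2 * q z.1 * u i j z - R z)) :
    2 / 5 * sz α u i j ^ 2 - sz α u i j * nrm (νw (kap α i)) R ≤ pair α G u i j := by
  have hu := h.fam.memLp i j hij
  have hG := h.famG.memLp i j hij
  have hq : MemLp (fun z => 2 * q z.1 * u i j z) 2 (νw (kap α i)) :=
    (memLp_coeff (g := fun z : ℝ × ℝ => 2 * q z.1) (C := 2)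
      (continuous_const.mul (continuous_q.comp continuous_fst)).aestronglyMeasurable (by norm_num)
      (fun z => by
        have h1 := q_pos z.1
        have h2 := q_lt_one z.1
        rw [abs_of_pos (by positivity)]
        linarith) hu).1
  have hv := ((hG.sub hu).add hq).sub hR
  have key := energy_transport (h.kap i) h.abs_le hw hu hv
  have iG := integrable_mul hG hu
  have iu := hu.integrable_sq
  have iR := integrable_mul hu hR
  have iq := integrable_mul hu hq
  have hκ := h.kap i
  have hpt : ∀ z : ℝ × ℝ, |3 * σ * q z.1 * (kap α i * Real.tanh z.2)| ≤ 3 / 100 := by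
    intro z
    have h1 := q_pos z.1
    have h2 := q_lt_one z.1
    have h3 := h.abs_le
    have h4 := abs_tanh_le z.2
    rw [abs_mul, abs_mul, abs_mul, abs_mul, abs_of_pos h1, abs_of_pos (by norm_num : (0 : ℝ) < 3)]
    calc 3 * |σ| * q z.1 * (|kap α i| * |Real.tanh z.2|) ≤ 3 * 1 * 1 * (1 / 100 * 1) := by gcongr
      _ = _ := by norm_num
  have it : Integrable (fun z => u i j z ^ 2 * (3 * σ * q z.1 * (kap α i * Real.tanh z.2)))
      (νw (kap α i)) := by
    refine iu.mul_bdd (c := 3 / 100) ?_ (Eventually.of_forall hpt)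
    have := continuous_q
    have := contDiff_tanh.continuous
    exact (by fun_prop : Continuous fun z : ℝ × ℝ =>
      3 * σ * q z.1 * (kap α i * Real.tanh z.2)).aestronglyMeasurable
  have e : ∫ z, u i j z * (G i j z - u i j z + 2 * q z.1 * u i j z - R z) ∂(νw (kap α i))
      = pair α G u i j - sz α u i j ^ 2 + (∫ z, u i j z * (2 * q z.1 * u i j z) ∂(νw (kap α i)))
        - ∫ z, u i j z * R z ∂(νw (kap α i)) := by
    have i1 : Integrable (fun z => G i j z * u i j z - u i j z ^ 2) (νw (kap α i)) := iG.sub iu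
    have i2 : Integrable (fun z => G i j z * u i j z - u i j z ^ 2
        + u i j z * (2 * q z.1 * u i j z)) (νw (kap α i)) := i1.add iq
    rw [pair, sz, ← integral_sq hu, ← integral_sub iG iu, ← integral_add i1 iq,
      ← integral_sub i2 iR]
    refine integral_congr_ae (Eventually.of_forall fun z => ?_)
    simp only
    ring
  have e2 : ∫ z, u i j z ^ 2 * (-(1 / 2) + 2 * q z.1 - 3 * σ * q z.1 * (kap α i * Real.tanh z.2))
        ∂(νw (kap α i)) = -(1 / 2) * sz α u i j ^ 2
        + (∫ z, u i j z * (2 * q z.1 * u i j z) ∂(νw (kap α i)))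
        - ∫ z, u i j z ^ 2 * (3 * σ * q z.1 * (kap α i * Real.tanh z.2)) ∂(νw (kap α i)) := by
    have i2 : Integrable (fun z => -(1 / 2) * u i j z ^ 2 + u i j z * (2 * q z.1 * u i j z))
        (νw (kap α i)) := (iu.const_mul _).add iq
    rw [sz, ← integral_sq hu, ← integral_const_mul, ← integral_add (iu.const_mul _) iq,
      ← integral_sub i2 it]
    refine integral_congr_ae (Eventually.of_forall fun z => ?_)
    simp only
    ring
  have b1 : ∫ z, u i j z ^ 2 * (3 * σ * q z.1 * (kap α i * Real.tanh z.2)) ∂(νw (kap α i))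
      ≤ 3 / 100 * sz α u i j ^ 2 := by
    rw [sz, ← integral_sq hu, ← integral_const_mul]
    refine integral_mono it (iu.const_mul _) fun z => ?_
    have := (abs_le.1 (hpt z)).2
    simp only
    nlinarith [sq_nonneg (u i j z)]
  have b2 := (abs_le.1 (abs_integral_mul_le hu hR)).1
  rw [e, e2] at key
  have := sq_nonneg (sz α u i j)
  unfold sz at *
  linarith

theorem exists_row (i j : ℕ) : ∃ C : ℝ, 0 ≤ C ∧
    ∀ {α σ : ℝ} {k : ℕ} {u G : ℕ → ℕ → ℝ × ℝ → ℝ}, Sys α σ k u G → i + j ≤ k →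
      2 / 5 * sz α u i j ^ 2 - sz α u i j * (C * low α u i j) ≤ pair α G u i j := by
  obtain ⟨T, hT, hw⟩ := exists_remainder j
  obtain ⟨C, hC, hb⟩ := hT.bound i
  refine ⟨C, hC, fun {α σ k u G} h hij => ?_⟩
  obtain ⟨h1, h2⟩ := hb h.toSol hij
  have := h.weak_lower hij h1 (hw h i hij)
  have := mul_le_mul_of_nonneg_left h2 (sz_nonneg α u i j)
  linarith

/-- Let φ be the angular moment of `u` and F its tail integral, so F' = −φ. Since Γ/c has moment 1,
the nonlocal and potential terms of the moment equation combine to −2qφ − 2q(1−q)F = (2qF)', and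
tail integration gives a local equation for F. The transport part keeps `hardy`, so its mean need
not be computed. -/
theorem hardy_moment_eq {α σ : ℝ} {k : ℕ} {u G : ℕ → ℕ → ℝ × ℝ → ℝ} (h : Sys α σ k u G) :
    ∀ᵐ t, hardy (fK (G 0 0)) t = mom u 0 t - fK (u 0 0) t - 2 * q t * mom u 0 t
      + σ * hardy (fun t => 3 * q t * fK (u 1 0) t - 2 * trMom u * prof t) t := by
  have hk := h.one_le
  have hα := h.pos
  obtain ⟨c1, -⟩ := h.inv_c
  have m0 := h.fam.memLp 0 0 (by omega)
  have m1 := h.fam.memLp 0 1 (by omega)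
  have m10 := h.fam.memLp 1 0 (by omega)
  have hφ := h.memLp_moment (l := 0) (by omega)
  have hφ1 := h.memLp_moment (l := 1) (by omega)
  have hφ10 := (memLp_fK (h.kap 1) m10).1
  have hF := h.memLp_mom (l := 0) (by omega)
  have iφ := integrable_of_memLp hφ
  have iφ1 := integrable_of_memLp hφ1
  set ψ : ℝ → ℝ := fun t => 3 * q t * fK (u 1 0) t - 2 * trMom u * prof t with hψd
  have hψ : MemLp ψ 2 νp := (memLp_q_mul hφ10).1.sub (memLp_prof.const_mul _)
  have iψ := integrable_of_memLp hψ
  set a : ℝ → ℝ := fun t => 2 * q t with ha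
  have ha' : ∀ t, deriv a t = -(2 * (q t * (1 - q t))) := fun t => by
    rw [((hasDerivAt_q t).const_mul 2).deriv]
    ring
  set V : ℝ → ℝ := fun t => ∫ r in Iic t, fK (u 0 0) r with hV
  have hVF : ∀ t, mom u 0 t = -V t := h.mom_zero_eq
  have hbd : ∀ {b n : ℝ → ℝ}, Continuous b → (∀ t, |b t| ≤ 2) → MemLp n 2 νp →
      Integrable fun t => b t * n t := fun hb h2 hn =>
    (integrable_of_memLp hn).bdd_mul hb.aestronglyMeasurable (Eventually.of_forall h2)
  have hqc := continuous_q
  have q1 : ∀ t, |a t| ≤ 2 := fun t => by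
    have h1 := q_pos t
    have h2 := q_lt_one t
    rw [ha, abs_of_pos (by positivity)]
    linarith
  have q2 : ∀ t, |2 * (q t * (1 - q t))| ≤ 2 := fun t => by
    have h1 := q_pos t
    have h2 := q_lt_one t
    have h3 : 0 < 1 - q t := by linarith
    rw [abs_of_pos (by positivity)]
    nlinarith
  have iaF := hbd (by fun_prop : Continuous a) q1 hF
  have iaφ := hbd (by fun_prop : Continuous a) q1 hφ
  have ia'F := hbd (by fun_prop : Continuous fun t => 2 * (q t * (1 - q t))) q2 hF
  have hline := product_line iφ (a := a) (contDiff_const.mul (contDiff_q.of_le (by simp)))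
    (iaF.neg.congr (Eventually.of_forall fun t => by simp only [Pi.neg_apply, hVF]; ring))
    ((ia'F.add iaφ).congr (Eventually.of_forall fun t => by
      simp only [Pi.add_apply, hVF, ha']; ring))
  -- This is −(2qF)', with F = −V.
  set om : ℝ → ℝ := fun t => deriv a t * V t + a t * fK (u 0 0) t with hom
  have iom : Integrable om := (ia'F.add iaφ).congr (Eventually.of_forall fun t => by
      simp only [Pi.add_apply, hVF, ha', hom]; ring)
  have hmom : fK (G 0 0) =ᵐ[volume]
      fun t => fK (u 0 0) t + (fK (u 0 1) t + (-1 * om t + σ * ψ t)) := by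
    have hsl := fK_congr h.eq
    have hΓ : ∫ s, Γd α 0 s * kk s = c α := (c_eq α).symm
    have iΓ : Integrable fun s => Γd α 0 s * kk s := integrable_G0_kk (α / 3) (by positivity)
    filter_upwards [hsl, integrable_fK_slice (h.kap 0) m0, integrable_fK_slice (h.kap 0) m1,
      integrable_fK_slice (h.kap 1) m10] with t ht s0 s1 s10
    rw [ht]
    set b : ℝ := (c α)⁻¹ * (2 * q t * (1 - q t)) * mom u 0 t
      + σ * ((c α)⁻¹ * (2 * q t * (1 - q t) ^ 2) * trMom u) with hb
    have i1 : Integrable fun s => (1 - 2 * q t) * (u 0 0 (t, s) * kk s) + u 0 1 (t, s) * kk s :=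
      (s0.1.const_mul _).add s1.1
    have i2 : Integrable fun s => (1 - 2 * q t) * (u 0 0 (t, s) * kk s) + u 0 1 (t, s) * kk s
        + σ * (3 * q t) * (u 1 0 (t, s) * kk s) := i1.add (s10.1.const_mul _)
    have e : fK (fun z => u 0 0 z + u 0 1 z - 2 * q z.1 * u 0 0 z
        - Γd α 0 z.2 * (c α)⁻¹ * (2 * q z.1 * (1 - q z.1)) * mom u 0 z.1
        + σ * (3 * q z.1 * u 1 0 z
          - Γd α 0 z.2 * (c α)⁻¹ * (2 * q z.1 * (1 - q z.1) ^ 2) * trMom u)) t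
        = (1 - 2 * q t) * fK (u 0 0) t + fK (u 0 1) t + σ * (3 * q t) * fK (u 1 0) t
          - b * ∫ s, Γd α 0 s * kk s := by
      simp only [fK]
      rw [← integral_const_mul, ← integral_const_mul, ← integral_const_mul,
        ← integral_add (s0.1.const_mul _) s1.1, ← integral_add i1 (s10.1.const_mul _),
        ← integral_sub i2 (iΓ.const_mul _)]
      refine integral_congr_ae (Eventually.of_forall fun s => ?_)
      simp only [hb]
      ring
    rw [e, hΓ]
    have hcc : c α ≠ 0 := (inv_pos.1 c1).ne'
    have ho : om t = -(2 * (q t * (1 - q t))) * V t + 2 * q t * fK (u 0 0) t := by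
      simp only [hom, ha']
      rfl
    simp only [ho, hψd, hb, hVF, prof]
    field_simp
    ring
  rw [hardy_congr hmom]
  obtain ⟨f1, f2⟩ := fK_weakT (h.kap 0) (h.fam.weakT 0 (by omega)) m0 m1
  filter_upwards [f1] with t ht
  have i1 : Integrable fun t => -1 * om t + σ * ψ t := (iom.const_mul (-1)).add (iψ.const_mul σ)
  have i2 : Integrable fun t => fK (u 0 1) t + (-1 * om t + σ * ψ t) := iφ1.add i1
  rw [hardy_add iφ i2, hardy_add iφ1 i1, hardy_add (iom.const_mul (-1)) (iψ.const_mul σ), hardy_const_mul, hardy_const_mul,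
    hardy_of_integral_eq_zero iφ h.int, hardy_of_integral_eq_zero iφ1 f2,
    hardy_of_integral_eq_zero iom hline.2, integral_Ioi_eq_sub iφ1, integral_Ioi_eq_sub iom, f2,
    hline.2, ← ht, ← hline.1 t]
  change mom u 0 t + _ = _
  rw [hVF]
  simp only [ha]
  ring

/-- The equation of `hardy_moment_eq` is paired with F. By p' = (1 − 4q)p the terms in q cancel as
in the plane and ½‖F‖² remains; the transport part is bounded through D_θ f. -/
theorem exists_row_moment : ∃ C : ℝ, 0 ≤ C ∧
    ∀ {α σ : ℝ} {k : ℕ} {u G : ℕ → ℕ → ℝ × ℝ → ℝ}, Sys α σ k u G →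
      1 / 2 * szF u ^ 2 - C * szF u * sz α u 1 0 ≤ pairF G u := by
  obtain ⟨Z, hZ0, hZ⟩ := exists_trMom_le
  -- 4 bounds `hardy`, 15 = 3·5 bounds 3q times an angular moment, and the last term bounds the
  -- correction at the origin.
  refine ⟨4 * (15 + 2 * Z * nrm νp prof), by have := nrm_nonneg νp prof; positivity,
    fun {α σ k u G} h => ?_⟩
  have hk := h.one_le
  have m10 := h.fam.memLp 1 0 (by omega)
  obtain ⟨hφ10, n10⟩ := memLp_fK (h.kap 1) m10
  have hφ := h.memLp_moment (l := 0) (by omega)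
  have iφ := integrable_of_memLp hφ
  have hF := h.memLp_mom (l := 0) (by omega)
  set ψ : ℝ → ℝ := fun t => 3 * q t * fK (u 1 0) t - 2 * trMom u * prof t with hψd
  obtain ⟨q1, q2⟩ := memLp_q_mul hφ10
  have hψ : MemLp ψ 2 νp := q1.sub (memLp_prof.const_mul _)
  have nψ : nrm νp ψ ≤ (15 + 2 * Z * nrm νp prof) * sz α u 1 0 := by
    have e : ψ = fun t => 3 * q t * fK (u 1 0) t + (-(2 * trMom u)) * prof t := by
      ext t; simp only [hψd]; ring
    have h1 := nrm_add_le q1 (memLp_prof.const_mul (-(2 * trMom u)))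
    rw [← e, nrm_const_mul, abs_neg, abs_mul, abs_of_pos (by norm_num : (0 : ℝ) < 2)] at h1
    have h2 := mul_le_mul_of_nonneg_right (hZ h.toSol) (nrm_nonneg νp prof)
    unfold sz at *
    linarith
  have hHψ := memLp_hardy hψ
  have nHψ := nrm_hardy_le hψ
  have hv : ∀ t, mom u 0 t = -∫ r in Iic t, fK (u 0 0) r := h.mom_zero_eq
  have ip := integral_wmeas (μ := volume) measurable_p p_pos
  have e1 : pairF G u = ∫ t, (mom u 0 t ^ 2 * (1 - 2 * q t) * p t - fK (u 0 0) t * mom u 0 t * p t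
      + σ * (hardy ψ t * mom u 0 t) * p t) := by
    rw [pairF, ← h.mom_zero_eq_hardy, ip]
    refine integral_congr_ae ?_
    filter_upwards [hardy_moment_eq h] with t ht
    rw [ht]
    ring
  have iFF := (integrable_wmeas (μ := volume) measurable_p p_pos).1 (hF.integrable_sq)
  have iφF := (integrable_wmeas (μ := volume) measurable_p p_pos).1 (integrable_mul hφ hF)
  have iψF := (integrable_wmeas (μ := volume) measurable_p p_pos).1 (integrable_mul hHψ hF)
  have iqF : Integrable fun t => q t * (mom u 0 t ^ 2 * p t) :=
    iFF.bdd_mul (c := 1) continuous_q.aestronglyMeasurable (Eventually.of_forall fun t => by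
      rw [Real.norm_eq_abs, abs_of_pos (q_pos t)]; exact (q_lt_one t).le)
  have ien : Integrable fun t => 2 * (∫ r in Iic t, fK (u 0 0) r) * fK (u 0 0) t * p t
      + (∫ r in Iic t, fK (u 0 0) r) ^ 2 * deriv p t :=
    ((iφF.const_mul (-2)).add (iFF.sub (iqF.const_mul 4))).congr (Eventually.of_forall fun t => by
      simp only [Pi.add_apply, Pi.sub_apply, hv, deriv_p]; ring)
  have en := energy_line iφ (contDiff_p.of_le (by simp))
    (iFF.congr (Eventually.of_forall fun t => by simp only [hv]; ring)) ien
  have e2 : pairF G u = 1 / 2 * szF u ^ 2 + σ * ∫ t, hardy ψ t * mom u 0 t ∂νp := by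
    have i1 : Integrable fun t => 1 / 2 * (mom u 0 t ^ 2 * p t) + σ * (hardy ψ t * mom u 0 t * p t) :=
      (iFF.const_mul _).add (iψF.const_mul _)
    have hsum : pairF G u = (∫ t, (1 / 2 * (mom u 0 t ^ 2 * p t)
        + σ * (hardy ψ t * mom u 0 t * p t))) + 1 / 2 * ∫ t, (2 * (∫ r in Iic t, fK (u 0 0) r)
          * fK (u 0 0) t * p t + (∫ r in Iic t, fK (u 0 0) r) ^ 2 * deriv p t) := by
      rw [← integral_const_mul, ← integral_add i1 (ien.const_mul _), e1]
      refine integral_congr_ae (Eventually.of_forall fun t => ?_)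
      simp only [hv, deriv_p]
      ring
    rw [hsum, en, szF, ← integral_sq hF, ip, ip, ← integral_const_mul, ← integral_const_mul,
      ← integral_add (iFF.const_mul _) (iψF.const_mul _)]
    ring
  rw [e2]
  have hb := abs_integral_mul_le hHψ hF
  have hσ := h.abs_le
  have h1 : |σ * ∫ t, hardy ψ t * mom u 0 t ∂νp| ≤ 1 * (nrm νp (hardy ψ) * nrm νp (mom u 0)) := by
    rw [abs_mul]
    gcongr
  have h2 := (abs_le.1 h1).1
  have h3 : nrm νp (hardy ψ) * nrm νp (mom u 0)
      ≤ 4 * ((15 + 2 * Z * nrm νp prof) * sz α u 1 0) * nrm νp (mom u 0) := by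
    refine mul_le_mul_of_nonneg_right ?_ (nrm_nonneg _ _)
    linarith
  unfold szF
  linarith

/-! ### Combination of the rows into a coercive form -/

/-- The pair (F, D_θ f) closes on itself: the first row costs C‖F‖‖D_θ f‖, absorbed by large A, and
the second costs a multiple of √α, absorbed by small α. No k occurs, so α₀ and A serve all orders.
-/
theorem exists_base : ∃ α₀ A δ : ℝ, 0 < α₀ ∧ α₀ ≤ 1 / 10 ∧ 0 < A ∧ 0 < δ ∧
    ∀ {α σ : ℝ} {k : ℕ} {u G : ℕ → ℕ → ℝ × ℝ → ℝ}, Sys α σ k u G → α < α₀ →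
      δ * (szF u ^ 2 + sz α u 1 0 ^ 2) ≤ pairF G u + A * pair α G u 1 0 := by
  obtain ⟨C, hC, hF⟩ := exists_row_moment
  obtain ⟨B, hB, hR⟩ := exists_row 1 0
  -- Large enough that A(2/5 − 1/10) exceeds C² + ½ + 1/8.
  set A : ℝ := 10 * (C ^ 2 + 1) with hA
  have hA0 : 0 < A := by positivity
  -- The bound wanted for B√α: it ensures e ≤ 1/10 and Ae ≤ ½.
  set e : ℝ := 1 / (10 + 2 * A) with he
  have he0 : 0 < e := by positivity
  have he1 : e ≤ 1 / 10 := by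
    rw [he]; exact one_div_le_one_div_of_le (by norm_num) (by linarith)
  have he2 : A * e ≤ 1 / 2 := by
    rw [he, mul_one_div, div_le_iff₀ (by positivity)]; linarith
  refine ⟨min (1 / 10) ((e / (B + 1)) ^ 2), A, 1 / 8, lt_min (by norm_num) (by positivity),
    min_le_left _ _, hA0, by norm_num, fun {α σ k u G} h hα => ?_⟩
  have hk := h.one_le
  have r1 := hF h
  have r2 := hR h (by omega)
  have hsq : B * Real.sqrt α ≤ e := by
    have h1 : Real.sqrt α ≤ e / (B + 1) :=
      (Real.sqrt_le_sqrt (hα.trans_le (min_le_right _ _)).le).trans_eq (Real.sqrt_sq (by positivity))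
    calc B * Real.sqrt α ≤ (B + 1) * (e / (B + 1)) := by
          have := Real.sqrt_nonneg α
          gcongr
          linarith
      _ = e := by field_simp
  set x := szF u with hx
  set y := sz α u 1 0 with hy
  have hx0 : 0 ≤ x := szF_nonneg u
  have hy0 : 0 ≤ y := sz_nonneg ..
  have hlow : low α u 1 0 = Real.sqrt α * (x + y) := by
    simp [low, gsz, hx, hy]
  rw [hlow] at r2
  have r3 : 2 / 5 * y ^ 2 - y * (e * (x + y)) ≤ pair α G u 1 0 := by
    refine le_trans ?_ r2
    have := mul_le_mul_of_nonneg_left (mul_le_mul_of_nonneg_right hsq (add_nonneg hx0 hy0)) hy0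
    linarith
  have r4 := mul_le_mul_of_nonneg_left r3 hA0.le
  have b1 : C * x * y ≤ 1 / 4 * x ^ 2 + C ^ 2 * y ^ 2 := by nlinarith [sq_nonneg (x / 2 - C * y)]
  have b2 : A * (y * (e * (x + y))) ≤ 1 / 8 * x ^ 2 + 1 / 2 * y ^ 2 + A / 10 * y ^ 2 := by
    have h1 : A * e * (y * x) ≤ 1 / 2 * (y * x) := mul_le_mul_of_nonneg_right he2 (by positivity)
    have h2 : A * (e * y ^ 2) ≤ A * (1 / 10 * y ^ 2) := by gcongr
    nlinarith [sq_nonneg (x / 2 - y)]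
  have hA' : A * y ^ 2 = 10 * C ^ 2 * y ^ 2 + 10 * y ^ 2 := by rw [hA]; ring
  nlinarith [sq_nonneg y, mul_nonneg (sq_nonneg C) (sq_nonneg y)]

/-- The contribution of the `j`-th radial derivatives to the norm. -/
def lev (α : ℝ) (k : ℕ) (u : ℕ → ℕ → ℝ × ℝ → ℝ) (j : ℕ) : ℝ :=
  ∑ i ∈ Finset.range (k + 1 - j), sz α u i j ^ 2

/-- The contribution of the `j`-th radial derivatives to the form. -/
def levPair (α : ℝ) (k : ℕ) (G u : ℕ → ℕ → ℝ × ℝ → ℝ) (j : ℕ) : ℝ :=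
  ∑ i ∈ Finset.range (k + 1 - j), pair α G u i j

theorem lev_nonneg (α : ℝ) (k : ℕ) (u : ℕ → ℕ → ℝ × ℝ → ℝ) (j : ℕ) : 0 ≤ lev α k u j :=
  Finset.sum_nonneg fun _ _ => sq_nonneg _

/-- The norm of the first `n` levels. -/
def tot (α : ℝ) (k : ℕ) (u : ℕ → ℕ → ℝ × ℝ → ℝ) (n : ℕ) : ℝ :=
  szF u ^ 2 + sz α u 1 0 ^ 2 + ∑ j ∈ Finset.range n, lev α k u j

theorem tot_nonneg (α : ℝ) (k : ℕ) (u : ℕ → ℕ → ℝ × ℝ → ℝ) (n : ℕ) : 0 ≤ tot α k u n :=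
  add_nonneg (by positivity) (Finset.sum_nonneg fun _ _ => lev_nonneg ..)

theorem sz_le_sqrt_tot (α : ℝ) {k : ℕ} (u : ℕ → ℕ → ℝ × ℝ → ℝ) {n i j : ℕ} (hj : j < n)
    (hi : i + j ≤ k) : sz α u i j ≤ Real.sqrt (tot α k u n) := by
  refine Real.le_sqrt_of_sq_le ?_
  have h1 : sz α u i j ^ 2 ≤ lev α k u j :=
    Finset.single_le_sum (f := fun i => sz α u i j ^ 2) (fun _ _ => sq_nonneg _)
      (Finset.mem_range.2 (by omega))
  have h2 : lev α k u j ≤ ∑ j ∈ Finset.range n, lev α k u j :=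
    Finset.single_le_sum (f := fun j => lev α k u j) (fun _ _ => lev_nonneg ..)
      (Finset.mem_range.2 hj)
  unfold tot
  nlinarith [sq_nonneg (szF u), sq_nonneg (sz α u 1 0)]

/-- A mixed term with indices (i + 1, l) has l < n, so i + 1 + l ≤ k and it is counted in an earlier
level. -/
theorem low_le {α : ℝ} (h0 : α ≤ 1 / 10) {k : ℕ} (u : ℕ → ℕ → ℝ × ℝ → ℝ) {n i : ℕ}
    (hi : i + n ≤ k) : low α u i n ≤ (3 * n + 2) * Real.sqrt (tot α k u n) := by
  set r := Real.sqrt (tot α k u n)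
  have s0 : 0 ≤ ∑ j ∈ Finset.range n, lev α k u j := Finset.sum_nonneg fun _ _ => lev_nonneg ..
  have h1 : ∑ l ∈ Finset.range n, (sz α u i l + sz α u (i + 1) l) ≤ n * (2 * r) := by
    have := Finset.sum_le_card_nsmul (Finset.range n) (fun l => sz α u i l + sz α u (i + 1) l)
      (2 * r) fun l hl => by
        have := Finset.mem_range.1 hl
        have h1 := sz_le_sqrt_tot α (k := k) u (i := i) this (by omega)
        have h2 := sz_le_sqrt_tot α (k := k) u (i := i + 1) this (by omega)
        linarith
    simpa using this
  have h2 : ∑ l ∈ Finset.range n, sz α u 0 l ≤ n * r := by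
    have := Finset.sum_le_card_nsmul (Finset.range n) (fun l => sz α u 0 l) r fun l hl => by
      have := Finset.mem_range.1 hl
      exact sz_le_sqrt_tot α (k := k) u this (by omega)
    simpa using this
  have h3 : szF u ≤ r := Real.le_sqrt_of_sq_le (by
    unfold tot; nlinarith [sq_nonneg (sz α u 1 0)])
  have h4 : sz α u 1 0 ≤ r := Real.le_sqrt_of_sq_le (by
    unfold tot; nlinarith [sq_nonneg (szF u)])
  have h5 : gsz α i ≤ 1 := by
    unfold gsz
    split_ifs
    · exact le_rfl
    · exact Real.sqrt_le_one.2 (by linarith)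
  have h6 : 0 ≤ szF u + ∑ l ∈ Finset.range n, sz α u 0 l + sz α u 1 0 :=
    add_nonneg (add_nonneg (szF_nonneg u) (Finset.sum_nonneg fun _ _ => sz_nonneg ..))
      (sz_nonneg ..)
  have h7 := mul_le_mul_of_nonneg_right h5 h6
  unfold low
  linarith

/-- Young's inequality spends 1/10 of the coercivity 2/5 and leaves all remainders in the levels
below n and the base. -/
theorem exists_level (k n : ℕ) : ∃ C : ℝ, 0 ≤ C ∧
    ∀ {α σ : ℝ} {u G : ℕ → ℕ → ℝ × ℝ → ℝ}, Sys α σ k u G → n ≤ k →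
      3 / 10 * lev α k u n - C * tot α k u n ≤ levPair α k G u n := by
  choose C hC hR using fun i => exists_row i n
  refine ⟨∑ i ∈ Finset.range (k + 1 - n), 5 / 2 * (C i * (3 * n + 2)) ^ 2,
    Finset.sum_nonneg fun _ _ => by positivity, fun {α σ u G} h hn => ?_⟩
  rw [lev, levPair, Finset.mul_sum, Finset.sum_mul, ← Finset.sum_sub_distrib]
  refine Finset.sum_le_sum fun i hi => ?_
  have hi := Finset.mem_range.1 hi
  refine le_trans ?_ (hR i h (by omega))
  have hl := low_le h.le (k := k) u (n := n) (i := i) (by omega)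
  set r := Real.sqrt (tot α k u n) with hr
  have hrr : tot α k u n = r ^ 2 := (Real.sq_sqrt (tot_nonneg ..)).symm
  rw [hrr]
  have hx := sz_nonneg α u i n
  have h1 := mul_le_mul_of_nonneg_left (mul_le_mul_of_nonneg_left hl (hC i)) hx
  -- With x the norm in this row and K = C i (3n + 2), the difference is (x − 5Kr)²/10.
  nlinarith [sq_nonneg (sz α u i n - 5 * (C i * (3 * n + 2)) * r)]

/-- The bilinear form on families. -/
def form (α A : ℝ) (k : ℕ) (a : ℕ → ℝ) (n : ℕ) (G u : ℕ → ℕ → ℝ × ℝ → ℝ) : ℝ :=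
  pairF G u + A * pair α G u 1 0 + ∑ j ∈ Finset.range n, a j * levPair α k G u j

/-- Induction on the number of levels: a new level enters with a weight so small that its remainder
costs at most half of the coercivity already present. -/
theorem exists_coercive : ∃ α₀ A : ℝ, 0 < α₀ ∧ α₀ ≤ 1 / 10 ∧ 0 < A ∧ ∀ k n : ℕ, n ≤ k + 1 →
    ∃ (a : ℕ → ℝ) (δ : ℝ), (∀ j, 0 < a j) ∧ 0 < δ ∧
    ∀ {α σ : ℝ} {u G : ℕ → ℕ → ℝ × ℝ → ℝ}, Sys α σ k u G → α < α₀ →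
      δ * tot α k u n ≤ form α A k a n G u := by
  obtain ⟨α₀, A, δ₀, h1, h2, h3, h4, h5⟩ := exists_base
  refine ⟨α₀, A, h1, h2, h3, fun k n => ?_⟩
  induction n with
  | zero =>
    refine fun _ => ⟨fun _ => 1, δ₀, fun _ => one_pos, h4, fun h hα => ?_⟩
    have := h5 h hα
    simpa [tot, form] using this
  | succ n ih =>
    intro hn
    obtain ⟨a, δ, ha, hδ, hc⟩ := ih (by omega)
    obtain ⟨C, hC, hl⟩ := exists_level k n
    -- Chosen so that εC ≤ δ/2.
    set ε : ℝ := δ / (2 * C + 1) with hε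
    have hε0 : 0 < ε := by positivity
    refine ⟨fun j => if j < n then a j else ε, min (δ / 2) (3 / 10 * ε),
      fun j => by beta_reduce; split_ifs; exacts [ha j, hε0], lt_min (by positivity) (by positivity),
      fun {α σ u G} h hα => ?_⟩
    have e : form α A k (fun j => if j < n then a j else ε) (n + 1) G u
        = form α A k a n G u + ε * levPair α k G u n := by
      rw [form, form, Finset.sum_range_succ, if_neg (lt_irrefl n), ← add_assoc]
      congr 2
      exact Finset.sum_congr rfl fun j hj => by rw [if_pos (Finset.mem_range.1 hj)]
    have e2 : tot α k u (n + 1) = tot α k u n + lev α k u n := by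
      rw [tot, tot, Finset.sum_range_succ, ← add_assoc]
    rw [e, e2]
    have r1 := hc h hα
    have r2 := mul_le_mul_of_nonneg_left (hl h (by omega)) hε0.le
    have t0 := tot_nonneg α k u n
    have l0 := lev_nonneg α k u n
    have hεC : ε * C ≤ δ / 2 := by
      rw [hε, div_mul_eq_mul_div, div_le_iff₀ (by positivity)]
      nlinarith
    have r3 := mul_le_mul_of_nonneg_right hεC t0
    have r4 := mul_le_mul_of_nonneg_right (min_le_left (δ / 2) (3 / 10 * ε)) t0
    have r5 := mul_le_mul_of_nonneg_right (min_le_right (δ / 2) (3 / 10 * ε)) l0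
    nlinarith

/-! ### The form as an inner product equivalent to the norm -/

theorem pair_comm (α : ℝ) (G u : ℕ → ℕ → ℝ × ℝ → ℝ) (i j : ℕ) :
    pair α G u i j = pair α u G i j := by
  unfold pair
  simp only [mul_comm]

theorem form_comm (α A : ℝ) (k : ℕ) (a : ℕ → ℝ) (n : ℕ) (G u : ℕ → ℕ → ℝ × ℝ → ℝ) :
    form α A k a n G u = form α A k a n u G := by
  have : pairF G u = pairF u G := by unfold pairF; simp only [mul_comm]
  simp only [form, levPair, pair_comm α G u, this]

section

variable {α : ℝ} {k : ℕ} (h0 : 0 < α) (h1 : α ≤ 1 / 10) {u G G' H : ℕ → ℕ → ℝ × ℝ → ℝ}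

include h0 h1

theorem memLp_moment_fam (hu : Fam α k u) : MemLp (fK (u 0 0)) 2 νp ∧
    nrm νp (fK (u 0 0)) ≤ 5 * sz α u 0 0 :=
  memLp_fK (abs_kap_le h0 h1 0) (hu.memLp 0 0 (by omega))

/-- Linear combinations are required only almost everywhere, because lifts of classes add only up to
null sets. -/
theorem form_comb (hu : Fam α k u) (hG : Fam α k G) (hG' : Fam α k G') (hk : 1 ≤ k) {x y : ℝ}
    (hH : ∀ i j, i + j ≤ k → H i j =ᵐ[volume] fun z => x * G i j z + y * G' i j z)
    (A : ℝ) (a : ℕ → ℝ) :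
    form α A k a (k + 1) H u = x * form α A k a (k + 1) G u + y * form α A k a (k + 1) G' u := by
  have hp : ∀ i j, i + j ≤ k → pair α H u i j = x * pair α G u i j + y * pair α G' u i j := by
    intro i j hij
    have hui := hu.memLp i j hij
    rw [pair, pair, pair, ← integral_const_mul, ← integral_const_mul,
      ← integral_add ((integrable_mul (hG.memLp i j hij) hui).const_mul x)
        ((integrable_mul (hG'.memLp i j hij) hui).const_mul y)]
    refine integral_congr_ae ?_
    filter_upwards [(wmeas_ac volume (wt (kap α i))).ae_eq (hH i j hij)] with z hz
    rw [hz]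
    ring
  have hl : ∀ j ∈ Finset.range (k + 1), a j * levPair α k H u j
      = x * (a j * levPair α k G u j) + y * (a j * levPair α k G' u j) := by
    intro j hj
    have : levPair α k H u j = x * levPair α k G u j + y * levPair α k G' u j := by
      rw [levPair, levPair, levPair, Finset.mul_sum, Finset.mul_sum, ← Finset.sum_add_distrib]
      exact Finset.sum_congr rfl fun i hi => hp i j (by
        have := Finset.mem_range.1 hi
        have := Finset.mem_range.1 hj
        omega)
    rw [this]
    ring
  have hF : pairF H u = x * pairF G u + y * pairF G' u := by
    have mG := (memLp_moment_fam h0 h1 hG).1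
    have mG' := (memLp_moment_fam h0 h1 hG').1
    have mu := (memLp_moment_fam h0 h1 hu).1
    have hκ := abs_kap_le h0 h1 0
    have e1 : fK (H 0 0) =ᵐ[volume] fun t => x * fK (G 0 0) t + y * fK (G' 0 0) t := by
      filter_upwards [fK_congr (hH 0 0 (by omega)), fK_add hκ ((hG.memLp 0 0 (by omega)).const_mul x)
        ((hG'.memLp 0 0 (by omega)).const_mul y)] with t e2 e3
      rw [e2, e3, fK_mul (fun _ => x), fK_mul (fun _ => y)]
    have e2 : ∀ t, hardy (fK (H 0 0)) t = x * hardy (fK (G 0 0)) t + y * hardy (fK (G' 0 0)) t := by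
      intro t
      rw [hardy_congr e1, hardy_add ((integrable_of_memLp mG).const_mul x)
        ((integrable_of_memLp mG').const_mul y), hardy_const_mul, hardy_const_mul]
    have hmu := memLp_hardy mu
    rw [pairF, pairF, pairF, ← integral_const_mul, ← integral_const_mul,
      ← integral_add ((integrable_mul (memLp_hardy mG) hmu).const_mul x)
        ((integrable_mul (memLp_hardy mG') hmu).const_mul y)]
    refine integral_congr_ae (Eventually.of_forall fun t => ?_)
    simp only [e2]
    ring
  rw [form, form, form, hF, hp 1 0 (by omega), Finset.sum_congr rfl hl, Finset.sum_add_distrib,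
    ← Finset.mul_sum, ← Finset.mul_sum]
  ring

theorem form_self (hu : Fam α k u) (hk : 1 ≤ k) (A : ℝ) (a : ℕ → ℝ) :
    form α A k a (k + 1) u u = nrm νp (hardy (fK (u 0 0))) ^ 2 + A * sz α u 1 0 ^ 2
      + ∑ j ∈ Finset.range (k + 1), a j * lev α k u j := by
  have hp : ∀ i j, i + j ≤ k → pair α u u i j = sz α u i j ^ 2 := by
    intro i j hij
    rw [pair, sz, ← integral_sq (hu.memLp i j hij)]
    simp only [sq]
  rw [form, hp 1 0 (by omega), pairF, ← integral_sq (memLp_hardy (memLp_moment_fam h0 h1 hu).1)]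
  congr 1
  · simp only [sq]
  · refine Finset.sum_congr rfl fun j hj => ?_
    rw [levPair, lev]
    congr 1
    exact Finset.sum_congr rfl fun i hi => hp i j (by
        have := Finset.mem_range.1 hi
        have := Finset.mem_range.1 hj
        omega)

theorem form_self_le (hu : Fam α k u) (hk : 1 ≤ k) {A : ℝ} (hA : 0 < A) {a : ℕ → ℝ}
    (ha : ∀ j, 0 < a j) : form α A k a (k + 1) u u
      ≤ (400 + A + ∑ j ∈ Finset.range (k + 1), a j) * ∑ j ∈ Finset.range (k + 1), lev α k u j := by
  rw [form_self h0 h1 hu hk]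
  set S := ∑ j ∈ Finset.range (k + 1), lev α k u j
  have hl : ∀ j ∈ Finset.range (k + 1), lev α k u j ≤ S := fun j hj =>
    Finset.single_le_sum (f := fun j => lev α k u j) (fun _ _ => lev_nonneg ..) hj
  have hs : ∀ i, i ≤ k → sz α u i 0 ^ 2 ≤ S := fun i hi =>
    (Finset.single_le_sum (f := fun i => sz α u i 0 ^ 2) (fun _ _ => sq_nonneg _)
      (Finset.mem_range.2 (by omega))).trans (hl 0 (Finset.mem_range.2 (by omega)))
  obtain ⟨m1, m2⟩ := memLp_moment_fam h0 h1 hu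
  -- 20 = 4·5, from `hardy` and the angular moment.
  have n1 : nrm νp (hardy (fK (u 0 0))) ≤ 20 * sz α u 0 0 := by linarith [nrm_hardy_le m1]
  have n2 : nrm νp (hardy (fK (u 0 0))) ^ 2 ≤ 400 * S := by
    have := pow_le_pow_left₀ (nrm_nonneg _ _) n1 2
    have := hs 0 (by omega)
    nlinarith
  have n3 := mul_le_mul_of_nonneg_left (hs 1 hk) hA.le
  have n4 : ∑ j ∈ Finset.range (k + 1), a j * lev α k u j
      ≤ (∑ j ∈ Finset.range (k + 1), a j) * S := by
    rw [Finset.sum_mul]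
    exact Finset.sum_le_sum fun j hj => mul_le_mul_of_nonneg_left (hl j hj) (ha j).le
  linarith

theorem le_form_self (hu : Fam α k u) (hk : 1 ≤ k) {A : ℝ} (hA : 0 < A) {a : ℕ → ℝ} {b : ℝ}
    (ha : ∀ j ∈ Finset.range (k + 1), b ≤ a j) :
    b * ∑ j ∈ Finset.range (k + 1), lev α k u j ≤ form α A k a (k + 1) u u := by
  rw [form_self h0 h1 hu hk, Finset.mul_sum]
  have := Finset.sum_le_sum fun j hj => mul_le_mul_of_nonneg_right (ha j hj) (lev_nonneg α k u j)
  nlinarith [sq_nonneg (nrm νp (hardy (fK (u 0 0)))), mul_nonneg hA.le (sq_nonneg (sz α u 1 0))]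

end

/-! ### Families of derivatives -/

/-- The derivatives of `f` in logarithmic coordinates. -/
def fam (f : X) (i j : ℕ) : ℝ × ℝ → ℝ := lift (D i j f)

theorem D_succ_left (i j : ℕ) (f : X) : D (i + 1) j f = Dθ (D i j f) := by
  simp only [D, Function.iterate_succ_apply']

theorem D_zero_succ (j : ℕ) (f : X) : D 0 (j + 1) f = Dy (D 0 j f) := by
  simp only [D, Function.iterate_succ_apply', Function.iterate_zero, id]

theorem MemHk.memLp_Wi {α : ℝ} {k : ℕ} {f : X} (hf : MemHk α k f) {i j : ℕ} (hij : i + j ≤ k) :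
    MemLp (fun p => D i j f p * Wi α i p) 2 μQ := by
  cases i with
  | zero => simpa only [Wi, if_true] using hf.2.1 j (by omega)
  | succ i => simpa only [Wi, Nat.succ_ne_zero, if_false] using hf.2.2 (i + 1) j (by omega) hij

theorem fam_of_memHk {α : ℝ} {k : ℕ} (h0 : 0 < α) (h1 : α ≤ 1 / 10) {f : X} (hf : MemHk α k f) :
    Fam α k (fam f) := by
  have hm : ∀ i j, i + j ≤ k → MemLp (fam f i j) 2 (νw (kap α i)) := fun i j hij =>
    memLp_lift (hf.memLp_Wi hij)
  have hl : ∀ i j, i + j ≤ k → LocallyIntegrable (fam f i j) := fun i j hij =>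
    locallyIntegrable_of_memLp (abs_kap_le h0 h1 i) (hm i j hij)
  refine ⟨hm, fun j hj => ?_, fun i j hij => ?_⟩
  · have h2 := hl 0 (j + 1) (by omega)
    rw [fam, D_zero_succ, Dy] at h2
    have := weakT_lift (hf.1.1 j hj).spec (hl 0 j (by omega)) h2
    unfold fam
    rw [D_zero_succ]
    exact this
  · have h2 := hl (i + 1) j (by omega)
    rw [fam, D_succ_left, Dθ] at h2
    have := weakS_lift (hf.1.2 i j hij).spec (hl i j (by omega)) h2
    unfold fam
    rw [D_succ_left]
    exact this

theorem fam_comb {α : ℝ} {k : ℕ} {f g : X} (hf : MemHk α k f) (hg : MemHk α k g) (x y : ℝ)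
    (i j : ℕ) (hij : i + j ≤ k) :
    fam (x • f + y • g) i j =ᵐ[volume] fun z => x * fam f i j z + y * fam g i j z := by
  unfold fam
  rw [D_comb x y hf.1 hg.1 i j hij]
  have : ∀ᵐ p ∂μQ, (x • D i j f + y • D i j g : X) p = x * D i j f p + y * D i j g p := by
    filter_upwards [AEEqFun.coeFn_add (x • D i j f) (y • D i j g), AEEqFun.coeFn_smul x (D i j f),
      AEEqFun.coeFn_smul y (D i j g)] with p h1 h2 h3
    rw [h1, Pi.add_apply, h2, h3]
    simp
  exact ae_comp_E0 this

/-- The ½ is that of the Jacobian. The double sum is regrouped by radial order, as the induction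
over levels needs it. -/
theorem hkNorm_sq {α : ℝ} {k : ℕ} {f : X} (hf : MemHk α k f) :
    hkNorm α k f ^ 2 = 1 / 2 * ∑ j ∈ Finset.range (k + 1), lev α k (fam f) j := by
  have hi : ∀ i j, i + j ≤ k →
      ∫ p in Q, (D i j f p * Wi α i p) ^ 2 = 1 / 2 * sz α (fam f) i j ^ 2 := fun i j hij =>
    integral_Q_sq (hf.memLp_Wi hij)
  rw [hkNorm, Real.sq_sqrt (by positivity)]
  have e : ∑ j ∈ Finset.range (k + 1), lev α k (fam f) j
      = ∑ i ∈ Finset.range (k + 1), ∑ j ∈ Finset.range (k + 1 - i), sz α (fam f) i j ^ 2 :=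
    Finset.sum_comm' fun i j => by simp only [Finset.mem_range]; omega
  have e' : ∀ F : ℕ → ℝ, ∑ i ∈ Finset.range (k + 1), F i = F 0 + ∑ i ∈ Finset.Ico 1 (k + 1), F i :=
    fun F => by rw [Finset.range_eq_Ico, Finset.sum_eq_sum_Ico_succ_bot (Nat.succ_pos k)]
  rw [e, e' fun i => ∑ j ∈ Finset.range (k + 1 - i), sz α (fam f) i j ^ 2, mul_add,
    Finset.mul_sum, Finset.mul_sum, Nat.sub_zero]
  congr 1
  · refine Finset.sum_congr rfl fun j hj => ?_
    rw [← hi 0 j (by have := Finset.mem_range.1 hj; omega)]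
    simp only [Wi, if_true]
  · refine Finset.sum_congr (by ext; simp) fun i hI => ?_
    rw [Finset.mul_sum]
    refine Finset.sum_congr rfl fun j hj => ?_
    have hI := Finset.mem_Ico.1 hI
    have hj := Finset.mem_range.1 hj
    rw [← hi i j (by omega)]
    simp only [Wi, if_neg (by omega : ¬ i = 0)]

/-- The weight is positive on the half-strip; this gives definiteness. -/
theorem eq_zero_of_sz_eq_zero {α : ℝ} {k : ℕ} {f : X} (hf : MemHk α k f)
    (h : sz α (fam f) 0 0 = 0) : f = 0 := by
  have hm := hf.memLp_Wi (i := 0) (j := 0) (by omega)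
  have e := integral_Q_sq hm
  rw [show nrm (νw (kap α 0)) (lift (D 0 0 f)) = 0 from h] at e
  have e2 := (integral_eq_zero_iff_of_nonneg (fun p => sq_nonneg _) hm.integrable_sq).1
    (by simpa using e)
  apply AEEqFun.ext
  filter_upwards [e2, AEEqFun.coeFn_zero (α := ℝ × ℝ) (β := ℝ) (μ := μQ),
    ae_restrict_mem isOpen_Q.measurableSet] with p h1 h2 h3
  rw [h2]
  have hs : 0 < Real.sin (2 * p.2) :=
    Real.sin_pos_of_pos_of_lt_pi (by linarith [h3.2.1]) (by linarith [h3.2.2])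
  have hy : 0 < p.1 := h3.1
  have hW : Wi α 0 p ≠ 0 := by
    simp only [Wi, if_true, W0, w]
    positivity
  have h4 : f p * Wi α 0 p = 0 := pow_eq_zero_iff two_ne_zero |>.1 h1
  exact (mul_eq_zero.1 h4).resolve_right hW

/-! ### The equation in the plane and the inner product on the space -/

/-- The moments of the family are the values of L₁₂: `mom` at index 0 is L₁₂(f)(e^t), and `trMom` is
L₁₂ of the transport term at 0. -/
theorem sys_of_eq {α s : ℝ} {k : ℕ} (h0 : 0 < α) (h1 : α ≤ 1 / 10) (hs : |s| ≤ 1) (hk : 1 ≤ k)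
    {f g : X} (hf : MemHk α k f) (hg : MemHk α k g) (hL : L12 f 0 = 0) (h : g =ᵐ[μQ] LT α s f) :
    Sys α s k (fam f) (fam g) := by
  refine ⟨⟨h0, h1, hs, hk, fam_of_memHk h0 h1 hf, ?_⟩, fam_of_memHk h0 h1 hg, ?_⟩
  · rw [← hL, L12_zero]
    rfl
  have htr : L12 (transport f) 0 = trMom (fam f) := by
    rw [L12_zero, trMom]
    refine integral_congr_ae (Eventually.of_forall fun t => ?_)
    have := fK_mul (fun t => 3 * q t) (fam f 1 0) t
    beta_reduce at this ⊢
    rw [← this]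
    unfold transport q fam
    congr 1
    ext z
    simp only [E0, lift, mul_one_div]
    rfl
  filter_upwards [ae_comp_E0 h] with z hz
  have e1 : L12 f (E0 z).1 = mom (fam f) 0 z.1 := L12_exp f z.1
  have e2 : Γ α (E0 z).2 = Γd α 0 z.2 := rfl
  have e3 : fam g 0 0 z = g (E0 z) := rfl
  have e4 : fam f 0 0 z = f (E0 z) := rfl
  have e5 : fam f 0 1 z = Dy f (E0 z) := rfl
  have e6 : fam f 1 0 z = Dθ f (E0 z) := rfl
  have e7 : (E0 z).1 = Real.exp z.1 := rfl
  rw [e3, e4, e5, e6, hz, LT, LF, transport, htr, e1, e2, e7, one_sub_q, q]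
  have hx := Real.exp_pos z.1
  field_simp

/-- Makes the operator without transport a special case, since the estimates use only |σ| ≤ 1. -/
theorem LF_eq_LT (α : ℝ) (f : X) : LF α f = LT α 0 f := by
  ext p
  simp [LT]

/-- The inner product on `𝓗^k` that a form defines. -/
@[reducible] def formCore {α : ℝ} {k : ℕ} (h0 : 0 < α) (h1 : α ≤ 1 / 10) (hk : 1 ≤ k) {A : ℝ} (hA : 0 < A)
    {a : ℕ → ℝ} (ha : ∀ j, 0 < a j) {r : ℝ} (hr : 0 < r) : InnerProductSpace.Core ℝ (Hk α k) where
  inner f g := r * form α A k a (k + 1) (fam f) (fam g)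
  conj_inner_symm f g := by
    rw [conj_trivial, form_comm]
  re_inner_nonneg f := by
    have := le_form_self h0 h1 (fam_of_memHk h0 h1 f.2) hk hA (a := a) (b := 0)
      fun j _ => (ha j).le
    rw [zero_mul] at this
    exact mul_nonneg hr.le this
  add_left f g h := by
    have := form_comb h0 h1 (fam_of_memHk h0 h1 h.2) (fam_of_memHk h0 h1 f.2)
      (fam_of_memHk h0 h1 g.2) hk (fam_comb f.2 g.2 1 1) A a
    rw [one_smul, one_smul] at this
    rw [Submodule.coe_add, this]
    ring
  smul_left f g x := by
    have := form_comb h0 h1 (fam_of_memHk h0 h1 g.2) (fam_of_memHk h0 h1 f.2)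
      (fam_of_memHk h0 h1 f.2) hk (fam_comb f.2 f.2 x 0) A a
    rw [zero_smul, add_zero] at this
    rw [Submodule.coe_smul, this, conj_trivial]
    ring
  definite f hf := by
    have hF := fam_of_memHk h0 h1 f.2
    have e := (mul_eq_zero.1 hf).resolve_left hr.ne'
    rw [form_self h0 h1 hF hk] at e
    have n1 : ∀ j, 0 ≤ a j * lev α k (fam f) j := fun j => mul_nonneg (ha j).le (lev_nonneg ..)
    have n2 := mul_nonneg hA.le (sq_nonneg (sz α (fam f) 1 0))
    have n3 := sq_nonneg (nrm νp (hardy (fK (fam f 0 0))))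
    have n4 := Finset.single_le_sum (f := fun j => a j * lev α k (fam f) j) (fun j _ => n1 j)
      (Finset.mem_range.2 (Nat.succ_pos k))
    have n5 : lev α k (fam f) 0 = 0 := by
      have : a 0 * lev α k (fam f) 0 = 0 := le_antisymm (by linarith) (n1 0)
      exact (mul_eq_zero.1 this).resolve_left (ha 0).ne'
    have n6 : sz α (fam f) 0 0 ^ 2 ≤ lev α k (fam f) 0 :=
      Finset.single_le_sum (f := fun i => sz α (fam f) i 0 ^ 2) (fun _ _ => sq_nonneg _)
        (Finset.mem_range.2 (by omega))
    have n7 : sz α (fam f) 0 0 = 0 := by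
      rw [n5] at n6
      exact pow_eq_zero_iff two_ne_zero |>.1 (le_antisymm n6 (sq_nonneg _))
    exact Subtype.ext (eq_zero_of_sz_eq_zero f.2 n7)

end EulerLin

theorem proposition3p1 :
    ∃ α₀ : ℝ, 0 < α₀ ∧ ∀ k : ℕ, 1 ≤ k → ∃ m M : ℝ, 0 < m ∧ 0 < M ∧
      ∀ α : ℝ, 0 < α → α < α₀ →
        ∃ ip : InnerProductSpace.Core ℝ (EulerLin.Hk α k),
          (∀ f : EulerLin.Hk α k,
            m * EulerLin.hkNorm α k f ≤ Real.sqrt (ip.inner f f) ∧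
            Real.sqrt (ip.inner f f) ≤ M * EulerLin.hkNorm α k f) ∧
          ∀ f : EulerLin.Hk α k, EulerLin.L12 (f : EulerLin.X) 0 = 0 →
            (∀ s : ℝ, s = 1 ∨ s = -1 → ∀ g : EulerLin.Hk α k,
              (g : EulerLin.X) =ᵐ[EulerLin.μQ] EulerLin.LT α s f →
                EulerLin.hkNorm α k f ^ 2 ≤ ip.inner g f) ∧
            (∀ g : EulerLin.Hk α k,
              (g : EulerLin.X) =ᵐ[EulerLin.μQ] EulerLin.LF α f →
                EulerLin.hkNorm α k f ^ 2 ≤ ip.inner g f) := by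
  obtain ⟨α₀, A, hα₀, hα₁, hA, hc⟩ := EulerLin.exists_coercive
  refine ⟨α₀, hα₀, fun k hk => ?_⟩
  obtain ⟨a, δ, ha, hδ, hc⟩ := hc k (k + 1) le_rfl
  obtain ⟨j₀, -, hb⟩ := Finset.exists_min_image (Finset.range (k + 1)) a ⟨0, by simp⟩
  set B : ℝ := 400 + A + ∑ j ∈ Finset.range (k + 1), a j
  have hB : 0 < B := by
    have := Finset.sum_nonneg fun j (_ : j ∈ Finset.range (k + 1)) => (ha j).le
    positivity
  have hj := ha j₀
  -- δ⁻¹ normalises the coercivity constant to 1, and 2 undoes the ½ of `hkNorm_sq`. Neither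
  -- constant involves α.
  refine ⟨Real.sqrt (2 * (δ⁻¹ * a j₀)), Real.sqrt (2 * (δ⁻¹ * B)), Real.sqrt_pos.2 (by positivity),
    Real.sqrt_pos.2 (by positivity), fun α h0 h1 => ?_⟩
  have h1' : α ≤ 1 / 10 := h1.le.trans hα₁
  have hδ' := inv_pos.2 hδ
  have hnn : ∀ f : EulerLin.X, 0 ≤ EulerLin.hkNorm α k f := fun f => Real.sqrt_nonneg _
  refine ⟨EulerLin.formCore h0 h1' hk hA ha hδ', fun f => ⟨?_, ?_⟩, fun f hL => ?_⟩
  · refine Real.le_sqrt_of_sq_le ?_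
    rw [mul_pow, Real.sq_sqrt (by positivity), EulerLin.hkNorm_sq f.2]
    have := mul_le_mul_of_nonneg_left (EulerLin.le_form_self h0 h1'
      (EulerLin.fam_of_memHk h0 h1' f.2) hk hA hb) hδ'.le
    refine le_trans (le_of_eq ?_) this
    ring
  · refine Real.sqrt_le_iff.2 ⟨mul_nonneg (Real.sqrt_nonneg _) (hnn f), ?_⟩
    rw [mul_pow, Real.sq_sqrt (by positivity), EulerLin.hkNorm_sq f.2]
    have := mul_le_mul_of_nonneg_left (EulerLin.form_self_le h0 h1'
      (EulerLin.fam_of_memHk h0 h1' f.2) hk hA ha) hδ'.le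
    refine this.trans (le_of_eq ?_)
    ring
  -- One estimate covers both signs and, with s = 0, the operator without transport.
  · have key : ∀ s : ℝ, |s| ≤ 1 → ∀ g : EulerLin.Hk α k,
        (g : EulerLin.X) =ᵐ[EulerLin.μQ] EulerLin.LT α s f →
          EulerLin.hkNorm α k f ^ 2
            ≤ δ⁻¹ * EulerLin.form α A k a (k + 1) (EulerLin.fam g) (EulerLin.fam f) := by
      intro s hs g hg
      have h2 := hc (EulerLin.sys_of_eq h0 h1' hs hk f.2 g.2 hL hg) h1
      rw [EulerLin.hkNorm_sq f.2, ← div_eq_inv_mul, le_div_iff₀ hδ]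
      refine le_trans ?_ h2
      rw [mul_comm]
      refine mul_le_mul_of_nonneg_left ?_ hδ.le
      have := Finset.sum_nonneg fun j (_ : j ∈ Finset.range (k + 1)) =>
        EulerLin.lev_nonneg α k (EulerLin.fam f) j
      unfold EulerLin.tot
      nlinarith [sq_nonneg (EulerLin.szF (EulerLin.fam f)),
        sq_nonneg (EulerLin.sz α (EulerLin.fam f) 1 0)]
    refine ⟨fun s hs g hg => key s ?_ g hg, fun g hg => key 0 (by simp) g ?_⟩
    · rcases hs with rfl | rfl <;> simp
    · rwa [← EulerLin.LF_eq_LT]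

end
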